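/- Let $k$ be a commutative ring and let $(X^*,d)$ be a cochain complex of $k$-modules indexed by $\mathbb Z$ (for example, but not necessarily, a complex of free $k$-modules, or a graded $k$-module with $d=0$). Write $T^n(X^*)=(\bigoplus_i X^i)^{\otimes n}$ and $T(X^*)=\bigoplus_{n\ge 0}T^n(X^*)$, with internal degree $|x_1\otimes\cdots\otimes x_n|=\sum_i|x_i|$ and differential $d(x_1\otimes\cdots\otimes x_n)=\sum_i(-1)^{|x_1|+\cdots+|x_{i-1}|}x_1\otimes\cdots\otimes dx_i\otimes\cdots\otimes x_n$. For $\sigma\in\mathfrak S_n$ and homogeneous $x_i$ put $$\sigma(x_1\otimes\cdots\otimes x_n)=(-1)^{\ell}\,x_{\sigma^{-1}(1)}\otimes\cdots\otimes x_{\sigma^{-1}(n)},\qquad \ell=\sum_{i<j,\ \sigma(i)>\sigma(j)}|x_i||x_j| .$$ For $f\in T^m(X^*)$ and $g\in T^n(X^*)$ let $f\star g=\sum_{\sigma}\sigma(f\otimes g)$, the sum running over all $(m,n)$-shuffles, i.e. all $\sigma\in\mathfrak S_{m+n}$ with $\sigma(1)<\cdots<\sigma(m)$ and $\sigma(m+1)<\cdots<\sigma(m+n)$.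 Let $TS^n(X^*)=T^n(X^*)^{\mathfrak S_n}$, $TS(X^*)=\bigoplus_{n\ge 0} TS^n(X^*)$, $T^+(X^*)=\bigoplus_{n>0}T^n(X^*)$ and $TS^+(X^*)=\bigoplus_{n>0}TS^n(X^*)$. For a strictly graded commutative dg algebra $R$ (that is, $xy=(-1)^{|x||y|}yx$ for homogeneous $x,y$, and $x^2=0$ for homogeneous $x$ of odd degree) and a dg ideal $I\subseteq R$, let $R_{ev}$ be the sum of the even-degree components and $I_{ev}=I\cap R_{ev}$. A divided power (pd) structure on $I$ is a sequence of maps $\gamma_n$ ($n\ge 0$) on $I_{ev}$, with values in $I_{ev}$ for $n\ge 1$, such that 1. $\gamma_0(x)=1$ and $\gamma_1(x)=x$ for $x\in I_{ev}$; 2. $\gamma_n(x)\gamma_m(x)=\binom{n+m}{m}\gamma_{n+m}(x)$ for $x\in I_{ev}$; 3. $\gamma_n(ax)=a^n\gamma_n(x)$ for $a\in R_{ev}$, $x\in I_{ev}$; 4. $\gamma_n(x+y)=\sum_{i=0}^n\gamma_i(x)\gamma_{n-i}(y)$ for $x,y\in I_{ev}$; 5. $\gamma_p(\gamma_q(x))=\frac{(pq)!}{p!\,(q!)^p}\gamma_{pq}(x)$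 for $x\in I_{ev}$, $q\ge1$; 6. $\gamma_n(x)\in R_{rn}$ for $x\in I$ homogeneous of even degree $r$; 7. $\gamma_n(xy)=0$ for $n\ge2$, $x\in R$ and $y\in I$ homogeneous of odd degrees; 8. $d(\gamma_n(x))=\gamma_{n-1}(x)\,d(x)$ for $n\ge1$, $x\in I_{ev}$. Then: (a) $(T(X^*),\star)$ is a strictly graded commutative dg $k$-algebra. The tensor degree $n$ makes it $\mathbb N$-graded, compatibly with the dg structure, and it is connected: its component of tensor degree $0$ is $k$. (b) $TS(X^*)$ is a dg subalgebra of $(T(X^*),\star)$ and is itself a connected $\mathbb N$-graded strictly graded commutative dg algebra. (c) There is a pd structure $\gamma$ on the dg ideal $T^+(X^*)$ of $(T(X^*),\star)$ such that, for every $p\ge1$ and every $x\in T^p(X^*)$ of even internal degree (or a sum of such elements), $$\gamma_n(x)=\sum_\sigma\sigma(x\otimes\cdots\otimes x)\qquad(n\text{ factors}),$$ where $\sigma$ runs over the permutations in $\mathfrak S_{np}$ that preserve the order within each of the $n$ consecutive blocks of length $p$ and satisfy $\sigma(p)<\sigma(2p)<\cdots<\sigma(np)$. (d) $TS^+(X^*)$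 is a dg ideal of $TS(X^*)$, the maps $\gamma_n$ restrict to $TS^+(X^*)$, and the restrictions form a pd structure satisfying 1–8. Thus $TS(X^*)$ is a pd dg subalgebra of $(T(X^*),\star)$. -/

import Mathlib

open scoped TensorProduct DirectSum Nat

universe u v

/-! ### Dg algebras and divided powers

The predicates below are about a `k`-module `A` with a bilinear multiplication `mul`, an element
`one`, a family `gr` of submodules (the homogeneous elements of each degree) and a linear map
`d`. -/

namespace DGAlg

section

variable {k A : Type*} [CommRing k] [AddCommMonoid A] [Module k A]

/-- `A` is an associative unital differential `ℤ`-graded `k`-algebra, with a differential of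
degree `+1`. -/
structure IsDGAlgebra (mul : A →ₗ[k] A →ₗ[k] A) (one : A) (gr : ℤ → Submodule k A)
    (d : A →ₗ[k] A) : Prop where
  isInternal : DirectSum.IsInternal gr
  mul_assoc : ∀ x y z, mul (mul x y) z = mul x (mul y z)
  one_mul : ∀ x, mul one x = x
  mul_one : ∀ x, mul x one = x
  one_mem : one ∈ gr 0
  mul_mem : ∀ i j, ∀ x ∈ gr i, ∀ y ∈ gr j, mul x y ∈ gr (i + j)
  d_mem : ∀ i, ∀ x ∈ gr i, d x ∈ gr (i + 1)
  d_d : ∀ x, d (d x) = 0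
  leibniz : ∀ i, ∀ x ∈ gr i, ∀ y, d (mul x y) = mul (d x) y + ((i.negOnePow : ℤ) : k) • mul x (d y)

/-- Graded commutativity, together with `x x = 0` for homogeneous `x` of odd degree. -/
structure IsStrictlyGradedCommutative (mul : A →ₗ[k] A →ₗ[k] A) (gr : ℤ → Submodule k A) :
    Prop where
  comm : ∀ i j, ∀ x ∈ gr i, ∀ y ∈ gr j, mul x y = (((i * j).negOnePow : ℤ) : k) • mul y x
  sq_eq_zero : ∀ i, Odd i → ∀ x ∈ gr i, mul x x = 0

/-- `w` is a further `ℕ`-grading of the dg algebra by graded subcomplexes which is connected: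
its component of weight `0` is `k`. -/
structure IsConnectedNGrading (mul : A →ₗ[k] A →ₗ[k] A) (one : A) (gr : ℤ → Submodule k A)
    (d : A →ₗ[k] A) (w : ℕ → Submodule k A) : Prop where
  isInternal : DirectSum.IsInternal w
  homogeneous : ∀ n, w n ≤ ⨆ i, w n ⊓ gr i
  one_mem : one ∈ w 0
  mul_mem : ∀ m n, ∀ x ∈ w m, ∀ y ∈ w n, mul x y ∈ w (m + n)
  d_mem : ∀ n, ∀ x ∈ w n, d x ∈ w n
  smul_one_injective : Function.Injective fun a : k => a • one
  exists_smul_one : ∀ x ∈ w 0, ∃ a : k, a • one = x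

/-- `I` is a two-sided graded ideal stable under the differential. -/
structure IsDGIdeal (mul : A →ₗ[k] A →ₗ[k] A) (gr : ℤ → Submodule k A) (d : A →ₗ[k] A)
    (I : Submodule k A) : Prop where
  homogeneous : I ≤ ⨆ i, I ⊓ gr i
  mul_mem_left : ∀ a, ∀ x ∈ I, mul a x ∈ I
  mul_mem_right : ∀ a, ∀ x ∈ I, mul x a ∈ I
  d_mem : ∀ x ∈ I, d x ∈ I

/-- The sum of the components of even degree. -/
def evenPart (gr : ℤ → Submodule k A) : Submodule k A := ⨆ i, ⨆ _ : Even i, gr i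

/-- The power `aⁿ` with respect to `mul`. -/
def npow (mul : A →ₗ[k] A →ₗ[k] A) (one : A) (a : A) (n : ℕ) : A := (fun b => mul a b)^[n] one

/-- `γ` is a divided power structure on the dg ideal `I`. Only the values of `γ n` on
`I_ev = I ⊓ evenPart gr` matter. -/
structure IsPDStructure (mul : A →ₗ[k] A →ₗ[k] A) (one : A) (gr : ℤ → Submodule k A)
    (d : A →ₗ[k] A) (I : Submodule k A) (γ : ℕ → A → A) : Prop where
  isDGIdeal : IsDGIdeal mul gr d I
  gamma_mem : ∀ n, 1 ≤ n → ∀ x ∈ I ⊓ evenPart gr, γ n x ∈ I ⊓ evenPart gr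
  gamma_zero : ∀ x ∈ I ⊓ evenPart gr, γ 0 x = one
  gamma_one : ∀ x ∈ I ⊓ evenPart gr, γ 1 x = x
  gamma_mul : ∀ n m, ∀ x ∈ I ⊓ evenPart gr, mul (γ n x) (γ m x) = (n + m).choose m • γ (n + m) x
  gamma_smul : ∀ n, ∀ a ∈ evenPart gr, ∀ x ∈ I ⊓ evenPart gr,
    γ n (mul a x) = mul (npow mul one a n) (γ n x)
  gamma_add : ∀ n, ∀ x ∈ I ⊓ evenPart gr, ∀ y ∈ I ⊓ evenPart gr,
    γ n (x + y) = ∑ i ∈ Finset.range (n + 1), mul (γ i x) (γ (n - i) y)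
  gamma_comp : ∀ p q, 1 ≤ q → ∀ x ∈ I ⊓ evenPart gr,
    γ p (γ q x) = ((p * q)! / (p ! * q ! ^ p)) • γ (p * q) x
  gamma_deg : ∀ (n : ℕ) (r : ℤ), Even r → ∀ x ∈ I ⊓ gr r, γ n x ∈ gr (n * r)
  gamma_odd : ∀ n, 2 ≤ n → ∀ i j, Odd i → Odd j → ∀ x ∈ gr i, ∀ y ∈ I ⊓ gr j, γ n (mul x y) = 0
  d_gamma : ∀ n, 1 ≤ n → ∀ x ∈ I ⊓ evenPart gr, d (γ n x) = mul (γ (n - 1) x) (d x)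

/-- `S` is a dg subalgebra. -/
structure IsDGSubalgebra (mul : A →ₗ[k] A →ₗ[k] A) (one : A) (gr : ℤ → Submodule k A)
    (d : A →ₗ[k] A) (S : Submodule k A) : Prop where
  homogeneous : S ≤ ⨆ i, S ⊓ gr i
  one_mem : one ∈ S
  mul_mem : ∀ x ∈ S, ∀ y ∈ S, mul x y ∈ S
  d_mem : ∀ x ∈ S, d x ∈ S

namespace IsDGSubalgebra

variable {mul : A →ₗ[k] A →ₗ[k] A} {one : A} {gr : ℤ → Submodule k A} {d : A →ₗ[k] A}
  {S : Submodule k A}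

/-- The multiplication induced on a dg subalgebra. -/
def subMul (h : IsDGSubalgebra mul one gr d S) : S →ₗ[k] S →ₗ[k] S :=
  LinearMap.mk₂ k (fun x y => ⟨mul x y, h.mul_mem x x.2 y y.2⟩)
    (fun _ _ _ => by ext; simp) (fun _ _ _ => by ext; simp)
    (fun _ _ _ => by ext; simp) (fun _ _ _ => by ext; simp)

/-- The unit of a dg subalgebra. -/
def subOne (h : IsDGSubalgebra mul one gr d S) : S := ⟨one, h.one_mem⟩

/-- The differential induced on a dg subalgebra. -/
def subD (h : IsDGSubalgebra mul one gr d S) : S →ₗ[k] S := d.restrict h.d_mem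

end IsDGSubalgebra

/-- The family of submodules of `S` cut out by a family of submodules of `A`. -/
def subGr {ι : Type*} (gr : ι → Submodule k A) (S : Submodule k A) (i : ι) : Submodule k S :=
  (gr i).comap S.subtype

end

end DGAlg

/-! ### The shuffle algebra of a complex -/

namespace ShuffleAlg

noncomputable section

variable {k : Type u} [CommRing k] (X : CochainComplex (ModuleCat.{v} k) ℤ)

/-- The graded module `⨁ i, Xⁱ` underlying the complex. -/
abbrev Tot : Type v := ⨁ i : ℤ, X.X i

/-- The differential of `X` on `⨁ i, Xⁱ`. -/
def totD : Tot X →ₗ[k] Tot X :=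
  DirectSum.toModule k ℤ (Tot X) fun i =>
    DirectSum.lof k ℤ (fun i => X.X i) (i + 1) ∘ₗ (X.d i (i + 1)).hom

/-- The map `x ↦ (-1)^|x| x` on `⨁ i, Xⁱ`. -/
def totSign : Tot X →ₗ[k] Tot X :=
  DirectSum.toModule k ℤ (Tot X) fun i =>
    ((i.negOnePow : ℤ) : k) • DirectSum.lof k ℤ (fun i => X.X i) i

/-- The projection of `⨁ i, Xⁱ` onto its part of even (`e = 0`) or odd (`e = 1`) degree. -/
def parityProj (e : ZMod 2) : Tot X →ₗ[k] Tot X :=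
  DirectSum.toModule k ℤ (Tot X) fun i =>
    if (i : ZMod 2) = e then DirectSum.lof k ℤ (fun i => X.X i) i else 0

/-- The Koszul sign of the permutation `σ` of factors of parities `e 0, …, e (n-1)`: the product of
`(-1)^(e i * e j)` over the inversions `(i, j)` of `σ`. -/
def koszulSign {n : ℕ} (σ : Equiv.Perm (Fin n)) (e : Fin n → ZMod 2) : ℤ :=
  ∏ i, ∏ j, if i < j ∧ σ j < σ i ∧ e i = 1 ∧ e j = 1 then -1 else 1

/-- The Koszul-signed action of `σ` on `Tⁿ(X)`; on tensors of homogeneous elements it is computed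
in `permAct_tprod`. -/
def permAct {n : ℕ} (σ : Equiv.Perm (Fin n)) : (⨂[k]^n (Tot X)) →ₗ[k] (⨂[k]^n (Tot X)) :=
  ∑ e : Fin n → ZMod 2, (koszulSign σ e : k) •
    ((PiTensorProduct.reindex k (fun _ : Fin n => Tot X) σ).toLinearMap ∘ₗ
      PiTensorProduct.map fun i => parityProj X (e i))

theorem permAct_tprod {n : ℕ} (σ : Equiv.Perm (Fin n)) (deg : Fin n → ℤ)
    (x : ∀ i, X.X (deg i)) :
    permAct X σ (PiTensorProduct.tprod k fun i =>
        DirectSum.lof k ℤ (fun i => X.X i) (deg i) (x i)) =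
      ((∏ i, ∏ j, if i < j ∧ σ j < σ i then ((deg i * deg j).negOnePow : ℤ) else 1 : ℤ) : k) •
        PiTensorProduct.tprod k fun i =>
          DirectSum.lof k ℤ (fun i => X.X i) (deg (σ.symm i)) (x (σ.symm i)) := by
  have key : ∀ e : Fin n → ZMod 2, (fun i => parityProj X (e i)
      (DirectSum.lof k ℤ (fun i => X.X i) (deg i) (x i))) = fun i =>
        if (deg i : ZMod 2) = e i then DirectSum.lof k ℤ (fun i => X.X i) (deg i) (x i) else 0 := by
    intro e
    funext i
    rw [parityProj, DirectSum.toModule_lof]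
    split_ifs <;> rfl
  rw [permAct, LinearMap.sum_apply, Finset.sum_eq_single fun i => (deg i : ZMod 2)]
  · rw [LinearMap.smul_apply, LinearMap.comp_apply, PiTensorProduct.map_tprod, key]
    simp only [if_true, LinearEquiv.coe_coe, PiTensorProduct.reindex_tprod]
    congr 2
    refine Finset.prod_congr rfl fun i _ => Finset.prod_congr rfl fun j _ => ?_
    have hp : ∀ z : ℤ, (z : ZMod 2) = 1 ↔ Odd z := fun z => ZMod.intCast_eq_one_iff_odd
    simp only [hp]
    by_cases h : i < j ∧ σ j < σ i
    · by_cases h' : Odd (deg i) ∧ Odd (deg j)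
      · rw [if_pos ⟨h.1, h.2, h'⟩, if_pos h, Int.negOnePow_odd _ (h'.1.mul h'.2)]
        rfl
      · rw [if_neg fun H => h' H.2.2, if_pos h, Int.negOnePow_even]
        · rfl
        · rwa [← Int.not_odd_iff_even, Int.odd_mul]
    · rw [if_neg h, if_neg fun H => h ⟨H.1, H.2.1⟩]
  · intro e _ he
    rw [LinearMap.smul_apply, LinearMap.comp_apply, PiTensorProduct.map_tprod, key]
    obtain ⟨i, hi⟩ : ∃ i, (deg i : ZMod 2) ≠ e i := by
      by_contra! H
      exact he (funext fun i => (H i).symm)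
    rw [MultilinearMap.map_coord_zero _ i (if_neg hi), map_zero, smul_zero]
  · exact fun h => absurd (Finset.mem_univ _) h

/-- The differential `x₁ ⊗ ⋯ ⊗ xₙ ↦ ∑ i, (-1)^(|x₁| + ⋯ + |xᵢ₋₁|) x₁ ⊗ ⋯ ⊗ d xᵢ ⊗ ⋯ ⊗ xₙ` of
`Tⁿ(X)`. -/
def powD (n : ℕ) : (⨂[k]^n (Tot X)) →ₗ[k] (⨂[k]^n (Tot X)) :=
  ∑ i : Fin n, PiTensorProduct.map fun j =>
    if j < i then totSign X else if j = i then totD X else LinearMap.id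

/-- The elements of degree `r` in `Tⁿ(X)`. -/
def powGr (n : ℕ) (r : ℤ) : Submodule k (⨂[k]^n (Tot X)) :=
  Submodule.span k {t | ∃ (deg : Fin n → ℤ) (x : ∀ i, X.X (deg i)), ∑ i, deg i = r ∧
    t = PiTensorProduct.tprod k fun i => DirectSum.lof k ℤ (fun i => X.X i) (deg i) (x i)}

/-- `T(X) = ⨁ n, Tⁿ(X)`. -/
abbrev T : Type (max u v) := ⨁ n : ℕ, ⨂[k]^n (Tot X)

/-- The elements of `T(X)` of (internal) degree `r`. -/
def gr (r : ℤ) : Submodule k (T X) :=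
  ⨅ n, (powGr X n r).comap (DirectSum.component k ℕ (fun n => ⨂[k]^n (Tot X)) n)

/-- The elements of `T(X)` of tensor degree `n`. -/
def tensorGr (n : ℕ) : Submodule k (T X) :=
  LinearMap.range (DirectSum.lof k ℕ (fun n => ⨂[k]^n (Tot X)) n)

/-- The differential of `T(X)`. -/
def d : T X →ₗ[k] T X :=
  DirectSum.lmap (powD X)

/-- The `(m, n)`-shuffles. -/
def IsShuffle (m n : ℕ) (σ : Equiv.Perm (Fin (m + n))) : Prop :=
  StrictMono (fun i : Fin m => σ (Fin.castAdd n i)) ∧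
    StrictMono (fun i : Fin n => σ (Fin.natAdd m i))

open Classical in
/-- The shuffle product `f ⋆ g = ∑ σ ∈ Sh(m, n), σ (f ⊗ g)` of `f ∈ Tᵐ(X)` and `g ∈ Tⁿ(X)`. -/
def powShuffle (m n : ℕ) :
    (⨂[k]^m (Tot X)) →ₗ[k] (⨂[k]^n (Tot X)) →ₗ[k] (⨂[k]^(m + n) (Tot X)) :=
  (TensorProduct.mk k (⨂[k]^m (Tot X)) (⨂[k]^n (Tot X))).compr₂
    (∑ σ : Equiv.Perm (Fin (m + n)) with IsShuffle m n σ,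
      permAct X σ ∘ₗ TensorPower.mulEquiv.toLinearMap)

/-- The shuffle product on `T(X)`. -/
def shuffle : T X →ₗ[k] T X →ₗ[k] T X :=
  DirectSum.toModule k ℕ (T X →ₗ[k] T X) fun m =>
    (DirectSum.toModule k ℕ ((⨂[k]^m (Tot X)) →ₗ[k] T X) fun n =>
      ((powShuffle X m n).compr₂ (DirectSum.lof k ℕ (fun n => ⨂[k]^n (Tot X)) (m + n))).flip).flip

/-- The unit of `T(X)`, the empty tensor. -/
def one : T X :=
  DirectSum.lof k ℕ (fun n => ⨂[k]^n (Tot X)) 0 (PiTensorProduct.tprod k Fin.elim0)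

/-- The ideal `T⁺(X)` of elements without component in `T⁰(X)`. -/
def TPlus : Submodule k (T X) :=
  LinearMap.ker (DirectSum.component k ℕ (fun n => ⨂[k]^n (Tot X)) 0)

/-- `TSⁿ(X)`, the invariants of the Koszul-signed action of the symmetric group on `Tⁿ(X)`. -/
def powTS (n : ℕ) : Submodule k (⨂[k]^n (Tot X)) :=
  ⨅ σ : Equiv.Perm (Fin n), LinearMap.eqLocus (permAct X σ) LinearMap.id

/-- `TS(X) = ⨁ n, TSⁿ(X)` inside `T(X)`. -/
def TS : Submodule k (T X) :=
  ⨅ n, (powTS X n).comap (DirectSum.component k ℕ (fun n => ⨂[k]^n (Tot X)) n)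

/-- The ideal `TS⁺(X) = ⨁ n > 0, TSⁿ(X)` of `TS(X)`. -/
def TSPlus : Submodule k (TS X) := (TPlus X).comap (TS X).subtype

/-- The permutations of `n` consecutive blocks of size `p` that preserve the order inside every
block and the order of the last elements of the blocks; `finProdFinEquiv (a, b)` is the `b`-th
element of the `a`-th block. -/
def IsBlockShuffle (n p : ℕ) (σ : Equiv.Perm (Fin (n * p))) : Prop :=
  (∀ a : Fin n, StrictMono fun b : Fin p => σ (finProdFinEquiv (a, b))) ∧
    ∀ b : Fin p, (b : ℕ) + 1 = p → StrictMono fun a : Fin n => σ (finProdFinEquiv (a, b))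

/-- The tensor power `x ⊗ ⋯ ⊗ x ∈ Tⁿᵖ(X)` of `x ∈ Tᵖ(X)`. -/
def tensorPow (n : ℕ) {p : ℕ} (x : ⨂[k]^p (Tot X)) : ⨂[k]^(n * p) (Tot X) :=
  GradedMonoid.GMonoid.gnpow (A := fun n => ⨂[k]^n (Tot X)) n x

open Classical in
/-- `∑ σ (x ⊗ ⋯ ⊗ x)`, over all `n`-block shuffles `σ`, for `x ∈ Tᵖ(X)`. -/
def powGamma (n : ℕ) {p : ℕ} (x : ⨂[k]^p (Tot X)) : ⨂[k]^(n * p) (Tot X) :=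
  ∑ σ : Equiv.Perm (Fin (n * p)) with IsBlockShuffle n p σ, permAct X σ (tensorPow X n x)

end

end ShuffleAlg

universe w

/-!
`S_n` permutes the factors of `Tⁿ(X)` with Koszul signs, and every product of shuffles is a
sum over permutations increasing on the fibres of a map to a linear order. Such permutations form a
set of representatives of the cosets of the fibre-preserving ones; this makes `⋆` associative and
shows that it preserves symmetric tensors. For `x ∈ Tᵖ(X)` of even degree the signs of block
permutations disappear on `x ⊗ ⋯ ⊗ x`, so that the `n`-th power of `x` is `n!` times the sum
`γ_n(x)` over block shuffles.

If `T(X)` is torsion free, all identities for divided powers follow from `n! γ_n(x) = xⁿ`. In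
general `X` is the image of a complex of free modules over a polynomial ring over `ℤ`, the map on
shuffle algebras is compatible with the `γ_n`, and the identities descend.
-/

namespace ShuffleAlg

noncomputable section

/-! ### Koszul signs -/

/-- The sign `(-1)^e` of a parity `e`. -/
def paritySign (R : Type*) [Ring R] (e : ZMod 2) : R := if e = 0 then 1 else -1

theorem zmod_two_cases (a : ZMod 2) : a = 0 ∨ a = 1 := by
  revert a; decide

theorem zmod_two_add_self (a : ZMod 2) : a + a = 0 := CharTwo.add_self_eq_zero a

section ParitySign

variable {R : Type*} [Ring R]

@[simp] theorem paritySign_zero : paritySign R 0 = 1 := if_pos rfl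

@[simp] theorem paritySign_one : paritySign R 1 = -1 := if_neg (by decide)

theorem paritySign_add (a b : ZMod 2) :
    paritySign R (a + b) = paritySign R a * paritySign R b := by
  rcases zmod_two_cases a with rfl | rfl <;> rcases zmod_two_cases b with rfl | rfl <;>
    simp [zmod_two_add_self]

theorem paritySign_sum {R : Type*} [CommRing R] {ι : Type*} (s : Finset ι) (f : ι → ZMod 2) :
    paritySign R (∑ i ∈ s, f i) = ∏ i ∈ s, paritySign R (f i) := by
  classical
  induction s using Finset.induction_on with
  | empty => simp
  | insert a s ha ih => rw [Finset.sum_insert ha, Finset.prod_insert ha, paritySign_add, ih]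

theorem intCast_paritySign (e : ZMod 2) : ((paritySign ℤ e : ℤ) : R) = paritySign R e := by
  rcases zmod_two_cases e with rfl | rfl <;> simp

theorem negOnePow_eq_paritySign (i : ℤ) :
    ((i.negOnePow : ℤ) : R) = paritySign R (i : ZMod 2) := by
  rcases Int.even_or_odd i with h | h
  · rw [Int.negOnePow_even i h, ZMod.intCast_eq_zero_iff_even.2 h]; simp
  · rw [Int.negOnePow_odd i h, ZMod.intCast_eq_one_iff_odd.2 h]; simp

end ParitySign

section InversionSum

variable {ι κ μ : Type*} [LinearOrder ι] [LinearOrder κ] [LinearOrder μ] [Fintype ι]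

/-- The exponent of the Koszul sign of a bijection `σ` of linearly ordered index types, for factors
of parities `e i`: the sum of `e i * e j` over the inversions `(i, j)` of `σ`. -/
def inversionSum (σ : ι ≃ κ) (e : ι → ZMod 2) : ZMod 2 :=
  ∑ i, ∑ j, if i < j ∧ σ j < σ i then e i * e j else 0

theorem koszulSign_eq_paritySign {n : ℕ} (σ : Equiv.Perm (Fin n)) (e : Fin n → ZMod 2) :
    koszulSign σ e = paritySign ℤ (inversionSum σ e) := by
  simp only [koszulSign, inversionSum, paritySign_sum]
  refine Finset.prod_congr rfl fun i _ => Finset.prod_congr rfl fun j _ => ?_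
  rcases zmod_two_cases (e i) with hi | hi <;> rcases zmod_two_cases (e j) with hj | hj <;>
    by_cases h : i < j ∧ σ j < σ i <;> simp [hi, hj, h]

theorem sum_sum_eq_zero_of_add_swap {ι A : Type*} [Fintype ι] [AddCommMonoid A]
    (F : ι → ι → A) (hdiag : ∀ i, F i i = 0) (hswap : ∀ i j, F i j + F j i = 0) :
    ∑ i, ∑ j, F i j = 0 := by
  rw [← Fintype.sum_prod_type']
  refine Finset.sum_involution (fun p _ => p.swap) (fun p _ => hswap p.1 p.2) ?_
    (fun _ _ => Finset.mem_univ _) (fun p _ => Prod.swap_swap p)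
  rintro ⟨i, j⟩ _ hne heq
  obtain rfl : i = j := congrArg Prod.snd heq
  exact hne (hdiag i)

theorem inversionSum_comp_symm {ι κ μ : Type*} [Fintype ι] [Fintype κ] [LinearOrder κ]
    [LinearOrder μ] (σ : ι ≃ κ) (τ : κ ≃ μ) (e : ι → ZMod 2) :
    inversionSum τ (e ∘ σ.symm) =
      ∑ i, ∑ j, if σ i < σ j ∧ τ (σ j) < τ (σ i) then e i * e j else 0 := by
  rw [inversionSum, ← σ.sum_comp]
  refine Finset.sum_congr rfl fun i _ => ?_
  rw [← σ.sum_comp]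
  simp only [Function.comp_apply, Equiv.symm_apply_apply]

theorem inversionSum_trans [Fintype κ] (σ : ι ≃ κ) (τ : κ ≃ μ) (e : ι → ZMod 2) :
    inversionSum (σ.trans τ) e = inversionSum σ e + inversionSum τ (e ∘ σ.symm) := by
  rw [inversionSum_comp_symm, inversionSum, inversionSum, ← sub_eq_zero]
  simp_rw [← Finset.sum_add_distrib, ← Finset.sum_sub_distrib, Equiv.trans_apply]
  -- A pair inverted by both `σ` and `τ` is counted twice on the right-hand side.
  refine sum_sum_eq_zero_of_add_swap _ (fun i => by simp) fun i j => ?_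
  have := zmod_two_add_self (e i * e j)
  rcases eq_or_ne i j with rfl | hij
  · simp
  have hσ := σ.injective.ne hij
  have hτ := τ.injective.ne hσ
  grind

theorem inversionSum_of_strictMono {σ : ι ≃ κ} (h : StrictMono σ) (e : ι → ZMod 2) :
    inversionSum σ e = 0 :=
  Finset.sum_eq_zero fun _ _ => Finset.sum_eq_zero fun _ _ =>
    if_neg fun H => (h H.1).not_gt H.2

theorem update_add_one_mul_update_add_one {ι : Type*} [DecidableEq ι] (e : ι → ZMod 2) {i a b : ι}
    (hab : a ≠ b) :
    Function.update e i (e i + 1) a * Function.update e i (e i + 1) b =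
      e a * e b + ((if i = a then e b else 0) + if i = b then e a else 0) := by
  grind

/-- Raising the parity at the position `i` changes the exponent of the Koszul sign by the parities
of the positions which form an inversion with `i`. -/
theorem inversionSum_update (σ : ι ≃ κ) (e : ι → ZMod 2) (i : ι) :
    inversionSum σ (Function.update e i (e i + 1)) + ∑ j, (if j < i then e j else 0) =
      inversionSum σ e + ∑ j, (if σ j < σ i then e j else 0) := by
  have inversion_term : ∀ a b, (if a < b ∧ σ b < σ a then
      Function.update e i (e i + 1) a * Function.update e i (e i + 1) b else 0) =
      (if a < b ∧ σ b < σ a then e a * e b else 0) +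
        ((if i = a then (if a < b ∧ σ b < σ a then e b else 0) else 0) +
          if i = b then (if a < b ∧ σ b < σ a then e a else 0) else 0) := by
    intro a b
    by_cases h : a < b ∧ σ b < σ a
    · simp only [if_pos h, update_add_one_mul_update_add_one e h.1.ne]
    · simp only [if_neg h, ite_self, add_zero]
  have involving : ∀ j, (if i < j ∧ σ j < σ i then e j else 0) +
      (if j < i ∧ σ i < σ j then e j else 0) + (if j < i then e j else 0) =
      if σ j < σ i then e j else 0 := by
    intro j
    have := zmod_two_add_self (e j)
    rcases eq_or_ne i j with rfl | hij
    · simp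
    have := σ.injective.ne hij
    grind
  simp only [inversionSum, inversion_term, Finset.sum_add_distrib, add_assoc, ← involving]
  rw [Finset.sum_comm (f := fun a b => if i = a then _ else _)]
  simp only [Finset.sum_ite_eq, Finset.mem_univ, if_true]

end InversionSum

end

end ShuffleAlg

namespace ShuffleAlg

noncomputable section

variable {k : Type u} [CommRing k] (X : CochainComplex (ModuleCat.{v} k) ℤ)

/-! ### The signed action of bijections on tensor powers -/

/-- The homogeneous elements of degree `r` of `⨁ i, Xⁱ`. -/
def homog (r : ℤ) : Submodule k (Tot X) :=
  LinearMap.range (DirectSum.lof k ℤ (fun i => X.X i) r)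

variable {X}

theorem lof_mem_homog (r : ℤ) (x : X.X r) :
    DirectSum.lof k ℤ (fun i => X.X i) r x ∈ homog X r := ⟨x, rfl⟩

theorem parityProj_of_mem {r : ℤ} {x : Tot X} (hx : x ∈ homog X r) (e : ZMod 2) :
    parityProj X e x = if (r : ZMod 2) = e then x else 0 := by
  obtain ⟨y, rfl⟩ := hx
  rw [parityProj, DirectSum.toModule_lof]
  split_ifs <;> rfl

theorem totSign_of_mem {r : ℤ} {x : Tot X} (hx : x ∈ homog X r) :
    totSign X x = paritySign k (r : ZMod 2) • x := by
  obtain ⟨y, rfl⟩ := hx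
  rw [totSign, DirectSum.toModule_lof, LinearMap.smul_apply, negOnePow_eq_paritySign]

theorem totD_lof (r : ℤ) (x : X.X r) :
    totD X (DirectSum.lof k ℤ (fun i => X.X i) r x) =
      DirectSum.lof k ℤ (fun i => X.X i) (r + 1) ((X.d r (r + 1)).hom x) := by
  rw [totD, DirectSum.toModule_lof]; rfl

theorem totD_mem {r : ℤ} {x : Tot X} (hx : x ∈ homog X r) : totD X x ∈ homog X (r + 1) := by
  obtain ⟨y, rfl⟩ := hx
  rw [totD_lof]
  exact lof_mem_homog _ _

theorem totD_totD (x : Tot X) : totD X (totD X x) = 0 := by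
  suffices totD X ∘ₗ totD X = 0 from LinearMap.congr_fun this x
  refine DirectSum.linearMap_ext _ fun r => LinearMap.ext fun x => ?_
  have hdd : (X.d (r + 1) (r + 1 + 1)).hom ((X.d r (r + 1)).hom x) = 0 := by
    rw [← LinearMap.comp_apply, ← ModuleCat.hom_comp, X.d_comp_d]
    rfl
  simp only [LinearMap.comp_apply, totD_lof, hdd, map_zero, LinearMap.zero_apply]

theorem span_homog :
    Submodule.span k (Set.range fun p : Σ r : ℤ, homog X r => (p.2 : Tot X)) = ⊤ := by
  rw [eq_top_iff]
  rintro x -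
  induction x using DirectSum.induction_on with
  | zero => exact zero_mem _
  | of i x => exact Submodule.subset_span ⟨⟨i, ⟨_, lof_mem_homog i x⟩⟩, rfl⟩
  | add x y hx hy => exact add_mem hx hy

theorem ext_homog {ι : Type*} [Finite ι] {N : Type*} [AddCommMonoid N] [Module k N]
    {f g : (⨂[k] _ : ι, Tot X) →ₗ[k] N}
    (h : ∀ (deg : ι → ℤ) (x : ι → Tot X), (∀ i, x i ∈ homog X (deg i)) →
      f (PiTensorProduct.tprod k x) = g (PiTensorProduct.tprod k x)) : f = g :=
  PiTensorProduct.ext_of_span_eq_top (g := fun _ (p : Σ r : ℤ, homog X r) => (p.2 : Tot X))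
    (fun _ => span_homog) fun j => h (fun i => (j i).1) _ fun i => (j i).2.2

section Action

variable {ι κ μ : Type*} [LinearOrder ι] [LinearOrder κ] [LinearOrder μ] [Fintype ι]

variable (X) in
/-- The Koszul-signed action of a bijection of linearly ordered index types on tensor powers. It
extends `permAct` to bijections between different index types, such as `Fin (m + n)` and
`Fin (n + m)`, which are needed to compare `Tᵐ⁺ⁿ(X)` with `Tⁿ⁺ᵐ(X)`. -/
def bijAct (σ : ι ≃ κ) : (⨂[k] _ : ι, Tot X) →ₗ[k] (⨂[k] _ : κ, Tot X) :=
  ∑ e : ι → ZMod 2, paritySign k (inversionSum σ e) •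
    ((PiTensorProduct.reindex k (fun _ : ι => Tot X) σ).toLinearMap ∘ₗ
      PiTensorProduct.map fun i => parityProj X (e i))

theorem permAct_eq_bijAct {n : ℕ} (σ : Equiv.Perm (Fin n)) : permAct X σ = bijAct X σ := by
  simp only [permAct, bijAct, koszulSign_eq_paritySign, intCast_paritySign]

theorem map_parityProj_tprod {ι : Type*} [Fintype ι] (e : ι → ZMod 2) {deg : ι → ℤ} {x : ι → Tot X}
    (hx : ∀ i, x i ∈ homog X (deg i)) :
    PiTensorProduct.map (fun i => parityProj X (e i)) (PiTensorProduct.tprod k x) =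
      if (fun i => (deg i : ZMod 2)) = e then PiTensorProduct.tprod k x else 0 := by
  simp only [PiTensorProduct.map_tprod, parityProj_of_mem (hx _)]
  split_ifs with he
  · simp only [congrFun he, if_true]
  · obtain ⟨i, hi⟩ := Function.ne_iff.1 he
    exact MultilinearMap.map_coord_zero _ i (if_neg hi)

theorem bijAct_tprod (σ : ι ≃ κ) {deg : ι → ℤ} {x : ι → Tot X}
    (hx : ∀ i, x i ∈ homog X (deg i)) :
    bijAct X σ (PiTensorProduct.tprod k x) =
      paritySign k (inversionSum σ fun i => (deg i : ZMod 2)) •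
        PiTensorProduct.tprod k (x ∘ σ.symm) := by
  simp only [bijAct, LinearMap.sum_apply, LinearMap.smul_apply, LinearMap.comp_apply,
    map_parityProj_tprod _ hx, apply_ite, map_zero, smul_zero, LinearEquiv.coe_coe,
    PiTensorProduct.reindex_tprod, Finset.sum_ite_eq, Finset.mem_univ, if_true]
  rfl

theorem bijAct_trans [Fintype κ] (σ : ι ≃ κ) (τ : κ ≃ μ) (x : ⨂[k] _ : ι, Tot X) :
    bijAct X (σ.trans τ) x = bijAct X τ (bijAct X σ x) := by
  suffices bijAct X (σ.trans τ) = bijAct X τ ∘ₗ bijAct X σ from LinearMap.congr_fun this x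
  refine ext_homog fun deg x hx => ?_
  rw [LinearMap.comp_apply, bijAct_tprod _ hx, bijAct_tprod _ hx, map_smul,
    bijAct_tprod (deg := deg ∘ σ.symm) (x := x ∘ σ.symm) _ (fun i => hx _),
    inversionSum_trans, paritySign_add, mul_smul]
  rfl

theorem bijAct_mul (σ τ : Equiv.Perm ι) (x : ⨂[k] _ : ι, Tot X) :
    bijAct X (σ * τ) x = bijAct X σ (bijAct X τ x) := bijAct_trans τ σ x

theorem bijAct_of_strictMono {σ : ι ≃ κ} (h : StrictMono σ) :
    bijAct X σ = (PiTensorProduct.reindex k (fun _ : ι => Tot X) σ).toLinearMap := by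
  refine ext_homog fun deg x hx => ?_
  rw [bijAct_tprod _ hx, inversionSum_of_strictMono h, paritySign_zero, one_smul]
  exact (PiTensorProduct.reindex_tprod (R := k) (s := fun _ => Tot X) σ x).symm

theorem bijAct_one (x : ⨂[k] _ : ι, Tot X) : bijAct X (1 : Equiv.Perm ι) x = x := by
  rw [bijAct_of_strictMono (σ := 1) strictMono_id]
  change PiTensorProduct.reindex k (fun _ : ι => Tot X) (Equiv.refl _) x = x
  rw [PiTensorProduct.reindex_refl]; rfl

theorem bijAct_finCongr {m n : ℕ} (h : m = n) (x : ⨂[k]^m (Tot X)) :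
    bijAct X (finCongr h) x = TensorPower.cast k (Tot X) h x := by
  rw [bijAct_of_strictMono (σ := finCongr h) (fun _ _ h => h)]; rfl

end Action

theorem lof_cast {m n : ℕ} (h : m = n) (x : ⨂[k]^m (Tot X)) :
    DirectSum.lof k ℕ (fun n => ⨂[k]^n (Tot X)) n (TensorPower.cast k (Tot X) h x) =
      DirectSum.lof k ℕ (fun n => ⨂[k]^n (Tot X)) m x := by
  subst h; simp

end

end ShuffleAlg

namespace ShuffleAlg

noncomputable section

variable {k : Type u} [CommRing k] {X : CochainComplex (ModuleCat.{v} k) ℤ}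

/-! ### Concatenation of tensors -/

section Fin

variable {m n m' n' : ℕ}

theorem castAdd_lt_castAdd_iff {i j : Fin m} : Fin.castAdd n i < Fin.castAdd n j ↔ i < j :=
  Iff.rfl

theorem castAdd_lt_natAdd (i : Fin m) (j : Fin n) : Fin.castAdd n i < Fin.natAdd m j :=
  Fin.lt_def.2 (by simp only [Fin.val_castAdd, Fin.val_natAdd]; omega)

theorem not_natAdd_lt_castAdd (i : Fin m) (j : Fin n) : ¬ Fin.natAdd m j < Fin.castAdd n i :=
  (castAdd_lt_natAdd i j).not_gt

theorem append_update_left {α : Type*} (a : Fin m → α) (b : Fin n → α) (i : Fin m) (c : α) :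
    Fin.append (Function.update a i c) b =
      Function.update (Fin.append a b) (Fin.castAdd n i) c := by
  funext j
  induction j using Fin.addCases with
  | left j => simp [Function.update_apply]
  | right j => simp [(castAdd_lt_natAdd i j).ne']

theorem append_update_right {α : Type*} (a : Fin m → α) (b : Fin n → α) (i : Fin n) (c : α) :
    Fin.append a (Function.update b i c) =
      Function.update (Fin.append a b) (Fin.natAdd m i) c := by
  funext j
  induction j using Fin.addCases with
  | left j => simp [(castAdd_lt_natAdd j i).ne]
  | right j => simp [Function.update_apply]

theorem finAddFlip_symm : (finAddFlip (m := m) (n := n)).symm = finAddFlip := by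
  refine Equiv.ext fun i => (Equiv.symm_apply_eq _).2 ?_
  induction i using Fin.addCases <;> simp

/-- The juxtaposition of two bijections. -/
def finSum (σ : Fin m ≃ Fin m') (τ : Fin n ≃ Fin n') : Fin (m + n) ≃ Fin (m' + n') :=
  finSumFinEquiv.symm.trans ((σ.sumCongr τ).trans finSumFinEquiv)

@[simp] theorem finSum_castAdd (σ : Fin m ≃ Fin m') (τ : Fin n ≃ Fin n') (i : Fin m) :
    finSum σ τ (Fin.castAdd n i) = Fin.castAdd n' (σ i) := by
  simp [finSum]

@[simp] theorem finSum_natAdd (σ : Fin m ≃ Fin m') (τ : Fin n ≃ Fin n') (i : Fin n) :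
    finSum σ τ (Fin.natAdd m i) = Fin.natAdd m' (τ i) := by
  simp [finSum]

@[simp] theorem finSum_symm (σ : Fin m ≃ Fin m') (τ : Fin n ≃ Fin n') :
    (finSum σ τ).symm = finSum σ.symm τ.symm := rfl

theorem inversionSum_finSum (σ : Fin m ≃ Fin m') (τ : Fin n ≃ Fin n') (e : Fin m → ZMod 2)
    (e' : Fin n → ZMod 2) :
    inversionSum (finSum σ τ) (Fin.append e e') = inversionSum σ e + inversionSum τ e' := by
  simp [inversionSum, Fin.sum_univ_add, castAdd_lt_castAdd_iff, castAdd_lt_natAdd,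
    not_natAdd_lt_castAdd]

theorem inversionSum_finAddFlip (e : Fin m → ZMod 2) (e' : Fin n → ZMod 2) :
    inversionSum finAddFlip (Fin.append e e') = (∑ i, e i) * ∑ j, e' j := by
  have not_lt_and_gt : ∀ {l : ℕ} (i j : Fin l), ¬ (i < j ∧ j < i) := fun _ _ h => h.1.not_gt h.2
  simp [inversionSum, Fin.sum_univ_add, castAdd_lt_castAdd_iff, castAdd_lt_natAdd,
    not_natAdd_lt_castAdd, Finset.sum_mul_sum, not_lt_and_gt]

theorem intCast_append (deg : Fin m → ℤ) (deg' : Fin n → ℤ) :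
    (fun i => ((Fin.append deg deg' i : ℤ) : ZMod 2)) =
      Fin.append (fun i => (deg i : ZMod 2)) fun i => (deg' i : ZMod 2) := by
  funext i
  induction i using Fin.addCases <;> simp

end Fin

section Concatenation

variable {l m n m' n' : ℕ}

variable (X) in
/-- The tensor product `Tᵐ(X) × Tⁿ(X) → Tᵐ⁺ⁿ(X)`. -/
def conc (m n : ℕ) : (⨂[k]^m (Tot X)) →ₗ[k] (⨂[k]^n (Tot X)) →ₗ[k] (⨂[k]^(m + n) (Tot X)) :=
  (TensorProduct.mk k (⨂[k]^m (Tot X)) (⨂[k]^n (Tot X))).compr₂ TensorPower.mulEquiv.toLinearMap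

theorem conc_tprod (a : Fin m → Tot X) (b : Fin n → Tot X) :
    conc X m n (PiTensorProduct.tprod k a) (PiTensorProduct.tprod k b) =
      PiTensorProduct.tprod k (Fin.append a b) :=
  TensorPower.tprod_mul_tprod k a b

theorem conc_assoc (x : ⨂[k]^l (Tot X)) (y : ⨂[k]^m (Tot X)) (z : ⨂[k]^n (Tot X)) :
    TensorPower.cast k (Tot X) (add_assoc l m n) (conc X (l + m) n (conc X l m x y) z) =
      conc X l (m + n) x (conc X m n y z) :=
  TensorPower.mul_assoc x y z

theorem one_conc (x : ⨂[k]^n (Tot X)) :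
    TensorPower.cast k (Tot X) (zero_add n)
      (conc X 0 n (PiTensorProduct.tprod k Fin.elim0) x) = x :=
  TensorPower.one_mul x

theorem conc_one (x : ⨂[k]^n (Tot X)) :
    TensorPower.cast k (Tot X) (add_zero n)
      (conc X n 0 x (PiTensorProduct.tprod k Fin.elim0)) = x :=
  TensorPower.mul_one x

theorem append_mem_homog {deg : Fin m → ℤ} {deg' : Fin n → ℤ} {a : Fin m → Tot X}
    {b : Fin n → Tot X} (ha : ∀ i, a i ∈ homog X (deg i)) (hb : ∀ i, b i ∈ homog X (deg' i))
    (i : Fin (m + n)) : Fin.append a b i ∈ homog X (Fin.append deg deg' i) := by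
  induction i using Fin.addCases with
  | left i => simpa using ha i
  | right i => simpa using hb i

theorem ext_homog₂ {N : Type*} [AddCommMonoid N] [Module k N]
    {f g : (⨂[k]^m (Tot X)) →ₗ[k] (⨂[k]^n (Tot X)) →ₗ[k] N}
    (h : ∀ (deg : Fin m → ℤ) (deg' : Fin n → ℤ) (a : Fin m → Tot X) (b : Fin n → Tot X),
      (∀ i, a i ∈ homog X (deg i)) → (∀ i, b i ∈ homog X (deg' i)) →
      f (PiTensorProduct.tprod k a) (PiTensorProduct.tprod k b) =
        g (PiTensorProduct.tprod k a) (PiTensorProduct.tprod k b)) : f = g :=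
  ext_homog fun deg a ha => ext_homog fun deg' b hb => h deg deg' a b ha hb

theorem bijAct_finSum_conc (σ : Fin m ≃ Fin m') (τ : Fin n ≃ Fin n')
    (x : ⨂[k]^m (Tot X)) (y : ⨂[k]^n (Tot X)) :
    bijAct X (finSum σ τ) (conc X m n x y) = conc X m' n' (bijAct X σ x) (bijAct X τ y) := by
  suffices (conc X m n).compr₂ (bijAct X (finSum σ τ)) =
      (conc X m' n').compl₁₂ (bijAct X σ) (bijAct X τ) from
    LinearMap.congr_fun₂ this x y
  refine ext_homog₂ fun deg deg' a b ha hb => ?_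
  rw [LinearMap.compr₂_apply, LinearMap.compl₁₂_apply, conc_tprod,
    bijAct_tprod _ (append_mem_homog ha hb), bijAct_tprod _ ha, bijAct_tprod _ hb, intCast_append,
    inversionSum_finSum, paritySign_add, map_smul, map_smul, LinearMap.smul_apply, conc_tprod,
    smul_smul, mul_comm]
  congr 2
  funext i
  induction i using Fin.addCases <;> simp

/-! ### Homogeneous tensors -/

theorem tprod_mem_powGr {deg : Fin n → ℤ} {a : Fin n → Tot X} (ha : ∀ i, a i ∈ homog X (deg i)) :
    PiTensorProduct.tprod k a ∈ powGr X n (∑ i, deg i) := by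
  choose x hx using ha
  exact Submodule.subset_span ⟨deg, x, rfl, by simp only [hx]⟩

theorem powGr_le {r : ℤ} {N : Submodule k (⨂[k]^n (Tot X))}
    (h : ∀ (deg : Fin n → ℤ) (a : Fin n → Tot X), (∀ i, a i ∈ homog X (deg i)) →
      ∑ i, deg i = r → PiTensorProduct.tprod k a ∈ N) : powGr X n r ≤ N := by
  refine Submodule.span_le.2 ?_
  rintro _ ⟨deg, x, hr, rfl⟩
  exact h deg _ (fun i => lof_mem_homog _ _) hr

theorem eq_on_powGr₂ {r s : ℤ} {N : Type*} [AddCommMonoid N] [Module k N]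
    {f g : (⨂[k]^m (Tot X)) →ₗ[k] (⨂[k]^n (Tot X)) →ₗ[k] N}
    (h : ∀ (deg : Fin m → ℤ) (deg' : Fin n → ℤ) (a : Fin m → Tot X) (b : Fin n → Tot X),
      (∀ i, a i ∈ homog X (deg i)) → (∀ i, b i ∈ homog X (deg' i)) →
      ∑ i, deg i = r → ∑ i, deg' i = s →
      f (PiTensorProduct.tprod k a) (PiTensorProduct.tprod k b) =
        g (PiTensorProduct.tprod k a) (PiTensorProduct.tprod k b))
    {x : ⨂[k]^m (Tot X)} (hx : x ∈ powGr X m r) {y : ⨂[k]^n (Tot X)} (hy : y ∈ powGr X n s) :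
    f x y = g x y := by
  suffices powGr X m r ≤ LinearMap.eqLocus (f.flip y) (g.flip y) from this hx
  refine powGr_le fun deg a ha hr => ?_
  suffices powGr X n s ≤ LinearMap.eqLocus (f (PiTensorProduct.tprod k a))
    (g (PiTensorProduct.tprod k a)) from this hy
  exact powGr_le fun deg' b hb hs => h deg deg' a b ha hb hr hs

theorem bijAct_mem_powGr (σ : Fin m ≃ Fin n) {r : ℤ} {x : ⨂[k]^m (Tot X)}
    (hx : x ∈ powGr X m r) : bijAct X σ x ∈ powGr X n r := by
  suffices powGr X m r ≤ (powGr X n r).comap (bijAct X σ) from this hx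
  refine powGr_le fun deg a ha hr => ?_
  rw [Submodule.mem_comap, bijAct_tprod σ ha]
  refine Submodule.smul_mem _ _ ?_
  rw [← hr, ← σ.symm.sum_comp]
  exact tprod_mem_powGr (deg := fun i => deg (σ.symm i)) fun i => ha _

theorem conc_mem_powGr {r s : ℤ} {x : ⨂[k]^m (Tot X)} {y : ⨂[k]^n (Tot X)}
    (hx : x ∈ powGr X m r) (hy : y ∈ powGr X n s) : conc X m n x y ∈ powGr X (m + n) (r + s) := by
  suffices powGr X m r ≤ (powGr X (m + n) (r + s)).comap ((conc X m n).flip y) from this hx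
  refine powGr_le fun deg a ha hr => ?_
  suffices powGr X n s ≤ (powGr X (m + n) (r + s)).comap
    (conc X m n (PiTensorProduct.tprod k a)) from this hy
  refine powGr_le fun deg' b hb hs => ?_
  rw [Submodule.mem_comap, conc_tprod]
  convert tprod_mem_powGr (append_mem_homog ha hb) using 1
  simp [Fin.sum_univ_add, hr, hs]

theorem bijAct_finAddFlip_conc {r s : ℤ} {x : ⨂[k]^m (Tot X)} {y : ⨂[k]^n (Tot X)}
    (hx : x ∈ powGr X m r) (hy : y ∈ powGr X n s) :
    bijAct X finAddFlip (conc X m n x y) =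
      paritySign k ((r * s : ℤ) : ZMod 2) • conc X n m y x := by
  refine eq_on_powGr₂ (f := (conc X m n).compr₂ (bijAct X finAddFlip))
    (g := paritySign k ((r * s : ℤ) : ZMod 2) • (conc X n m).flip)
    (fun deg deg' a b ha hb hr hs => ?_) hx hy
  simp only [LinearMap.compr₂_apply, LinearMap.smul_apply, LinearMap.flip_apply, conc_tprod]
  rw [bijAct_tprod _ (append_mem_homog ha hb), intCast_append, inversionSum_finAddFlip, ← hr, ← hs,
    finAddFlip_symm]
  push_cast
  congr 2
  funext i
  induction i using Fin.addCases <;> simp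

end Concatenation

/-! ### The differential on tensor powers -/

section Differential

variable {ι κ : Type*} [LinearOrder ι] [LinearOrder κ]

variable (X) in
/-- The summand of the differential of a tensor power which applies `d` to the factor `i`. -/
def powDTerm (i : ι) : (⨂[k] _ : ι, Tot X) →ₗ[k] (⨂[k] _ : ι, Tot X) :=
  PiTensorProduct.map fun j =>
    if j < i then totSign X else if j = i then totD X else LinearMap.id

theorem powD_eq_sum (n : ℕ) : powD X n = ∑ i, powDTerm X i := rfl

theorem update_totD_mem_homog {ι : Type*} [DecidableEq ι] (i : ι) {deg : ι → ℤ} {a : ι → Tot X}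
    (ha : ∀ i, a i ∈ homog X (deg i)) (j : ι) :
    Function.update a i (totD X (a i)) j ∈ homog X (Function.update deg i (deg i + 1) j) := by
  rcases eq_or_ne j i with rfl | h
  · simpa using totD_mem (ha j)
  · simpa [h] using ha j

theorem intCast_update_add_one {ι : Type*} [DecidableEq ι] (i : ι) (deg : ι → ℤ) :
    (fun j => ((Function.update deg i (deg i + 1) j : ℤ) : ZMod 2)) =
      Function.update (fun j => (deg j : ZMod 2)) i ((deg i : ZMod 2) + 1) := by
  funext j
  rcases eq_or_ne j i with rfl | h <;> simp [*]

theorem powDTerm_tprod [Fintype ι] (i : ι) {deg : ι → ℤ} {a : ι → Tot X}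
    (ha : ∀ i, a i ∈ homog X (deg i)) :
    powDTerm X i (PiTensorProduct.tprod k a) =
      paritySign k (∑ j, if j < i then (deg j : ZMod 2) else 0) •
        PiTensorProduct.tprod k (Function.update a i (totD X (a i))) := by
  rw [powDTerm, PiTensorProduct.map_tprod, paritySign_sum, ← MultilinearMap.map_smul_univ]
  congr 1
  funext j
  rcases lt_trichotomy j i with h | rfl | h
  · simp [h, h.ne, totSign_of_mem (ha j)]
  · simp
  · simp [h.not_gt, h.ne']

theorem bijAct_powDTerm [Fintype ι] [Finite κ] (σ : ι ≃ κ) (i : ι) (x : ⨂[k] _ : ι, Tot X) :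
    bijAct X σ (powDTerm X i x) = powDTerm X (σ i) (bijAct X σ x) := by
  suffices bijAct X σ ∘ₗ powDTerm X i = powDTerm X (σ i) ∘ₗ bijAct X σ from
    LinearMap.congr_fun this x
  cases nonempty_fintype κ
  refine ext_homog fun deg a ha => ?_
  rw [LinearMap.comp_apply, LinearMap.comp_apply, powDTerm_tprod i ha, map_smul,
    bijAct_tprod σ (update_totD_mem_homog i ha), bijAct_tprod σ ha, map_smul,
    powDTerm_tprod (deg := deg ∘ σ.symm) (a := a ∘ σ.symm) _ (fun i => ha _), smul_smul, smul_smul,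
    ← paritySign_add, ← paritySign_add, intCast_update_add_one, add_comm, inversionSum_update,
    ← σ.sum_comp (fun j => if j < σ i then (((deg ∘ σ.symm) j : ℤ) : ZMod 2) else 0)]
  simp only [Function.comp_apply, Equiv.symm_apply_apply]
  rw [Function.update_comp_equiv]
  rfl

theorem sum_parity_update [Fintype ι] (deg : ι → ℤ) (i j : ι) :
    (∑ l, if l < i then ((Function.update deg j (deg j + 1) l : ℤ) : ZMod 2) else 0) =
      (∑ l, if l < i then (deg l : ZMod 2) else 0) + if j < i then 1 else 0 := by
  rw [← (Finset.sum_ite_eq' Finset.univ j fun l => if l < i then (1 : ZMod 2) else 0).trans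
    (if_pos (Finset.mem_univ j)), ← Finset.sum_add_distrib]
  refine Finset.sum_congr rfl fun l _ => ?_
  rcases eq_or_ne l j with rfl | hl
  · by_cases h : l < i <;> simp [h]
  · simp [hl]

theorem powDTerm_powDTerm_self [Finite ι] (i : ι) {deg : ι → ℤ} {a : ι → Tot X}
    (ha : ∀ i, a i ∈ homog X (deg i)) :
    powDTerm X i (powDTerm X i (PiTensorProduct.tprod k a)) = 0 := by
  cases nonempty_fintype ι
  rw [powDTerm_tprod i ha, map_smul, powDTerm_tprod i (update_totD_mem_homog i ha),
    Function.update_self, Function.update_idem, totD_totD, MultilinearMap.map_update_zero,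
    smul_zero, smul_zero]

theorem powDTerm_powDTerm_tprod [Fintype ι] {i j : ι} (hij : i ≠ j) {deg : ι → ℤ} {a : ι → Tot X}
    (ha : ∀ i, a i ∈ homog X (deg i)) :
    powDTerm X i (powDTerm X j (PiTensorProduct.tprod k a)) =
      paritySign k ((∑ l, if l < i then (deg l : ZMod 2) else 0) +
        (∑ l, if l < j then (deg l : ZMod 2) else 0) + if j < i then 1 else 0) •
      PiTensorProduct.tprod k
        (Function.update (Function.update a j (totD X (a j))) i (totD X (a i))) := by
  rw [powDTerm_tprod j ha, map_smul, powDTerm_tprod i (update_totD_mem_homog j ha), smul_smul,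
    ← paritySign_add, sum_parity_update, Function.update_of_ne hij]
  congr 2
  abel

theorem powDTerm_powDTerm_add_swap [Finite ι] (i j : ι) {deg : ι → ℤ} {a : ι → Tot X}
    (ha : ∀ i, a i ∈ homog X (deg i)) :
    powDTerm X i (powDTerm X j (PiTensorProduct.tprod k a)) +
      powDTerm X j (powDTerm X i (PiTensorProduct.tprod k a)) = 0 := by
  cases nonempty_fintype ι
  rcases eq_or_ne i j with rfl | hij
  · rw [powDTerm_powDTerm_self i ha, add_zero]
  · rw [powDTerm_powDTerm_tprod hij ha, powDTerm_powDTerm_tprod hij.symm ha,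
      Function.update_comm hij, ← add_smul]
    rcases hij.lt_or_gt with h | h <;> simp [h, h.not_gt, paritySign_add, mul_comm]

end Differential

section TotalDifferential

variable {m n : ℕ}

theorem bijAct_powD (σ : Fin m ≃ Fin n) (x : ⨂[k]^m (Tot X)) :
    bijAct X σ (powD X m x) = powD X n (bijAct X σ x) := by
  simp only [powD_eq_sum, LinearMap.sum_apply, map_sum, bijAct_powDTerm]
  exact σ.sum_comp fun i => powDTerm X i (bijAct X σ x)

theorem powD_mem_powGr {r : ℤ} {x : ⨂[k]^n (Tot X)} (hx : x ∈ powGr X n r) :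
    powD X n x ∈ powGr X n (r + 1) := by
  suffices powGr X n r ≤ (powGr X n (r + 1)).comap (powD X n) from this hx
  refine powGr_le fun deg a ha hr => ?_
  rw [Submodule.mem_comap, powD_eq_sum, LinearMap.sum_apply]
  refine Submodule.sum_mem _ fun i _ => ?_
  rw [powDTerm_tprod i ha]
  refine Submodule.smul_mem _ _ ?_
  convert tprod_mem_powGr (update_totD_mem_homog i ha) using 2
  rw [Finset.sum_update_of_mem (Finset.mem_univ i), ← hr,
    ← Finset.add_sum_erase _ _ (Finset.mem_univ i), Finset.erase_eq]
  exact add_right_comm _ _ _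

theorem powD_powD (x : ⨂[k]^n (Tot X)) : powD X n (powD X n x) = 0 := by
  suffices powD X n ∘ₗ powD X n = 0 from LinearMap.congr_fun this x
  refine ext_homog fun deg a ha => ?_
  simp only [powD_eq_sum, LinearMap.comp_apply, LinearMap.sum_apply, map_sum, LinearMap.zero_apply]
  exact sum_sum_eq_zero_of_add_swap _ (fun i => powDTerm_powDTerm_self i ha)
    fun i j => powDTerm_powDTerm_add_swap j i ha

theorem powDTerm_castAdd_conc {a : Fin m → Tot X} {b : Fin n → Tot X} {deg : Fin m → ℤ}
    {deg' : Fin n → ℤ} (ha : ∀ i, a i ∈ homog X (deg i)) (hb : ∀ i, b i ∈ homog X (deg' i))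
    (i : Fin m) :
    powDTerm X (Fin.castAdd n i) (PiTensorProduct.tprod k (Fin.append a b)) =
      conc X m n (powDTerm X i (PiTensorProduct.tprod k a)) (PiTensorProduct.tprod k b) := by
  rw [powDTerm_tprod _ ha, powDTerm_tprod _ (append_mem_homog ha hb), map_smul,
    LinearMap.smul_apply, conc_tprod, append_update_left, Fin.append_left]
  congr 2
  simp [Fin.sum_univ_add, castAdd_lt_castAdd_iff, not_natAdd_lt_castAdd]

theorem powDTerm_natAdd_conc {a : Fin m → Tot X} {b : Fin n → Tot X} {deg : Fin m → ℤ}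
    {deg' : Fin n → ℤ} (ha : ∀ i, a i ∈ homog X (deg i)) (hb : ∀ i, b i ∈ homog X (deg' i))
    (i : Fin n) :
    powDTerm X (Fin.natAdd m i) (PiTensorProduct.tprod k (Fin.append a b)) =
      paritySign k (((∑ j, deg j : ℤ)) : ZMod 2) •
        conc X m n (PiTensorProduct.tprod k a) (powDTerm X i (PiTensorProduct.tprod k b)) := by
  rw [powDTerm_tprod _ hb, powDTerm_tprod _ (append_mem_homog ha hb), map_smul, conc_tprod,
    append_update_right, Fin.append_right, smul_smul, ← paritySign_add]
  congr 2
  simp [Fin.sum_univ_add, castAdd_lt_natAdd]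

theorem powD_conc {r : ℤ} {x : ⨂[k]^m (Tot X)} (hx : x ∈ powGr X m r) (y : ⨂[k]^n (Tot X)) :
    powD X (m + n) (conc X m n x y) = conc X m n (powD X m x) y +
      paritySign k (r : ZMod 2) • conc X m n x (powD X n y) := by
  suffices powGr X m r ≤ LinearMap.eqLocus (powD X (m + n) ∘ₗ (conc X m n).flip y)
    ((conc X m n).flip y ∘ₗ powD X m +
      paritySign k (r : ZMod 2) • (conc X m n).flip (powD X n y)) from this hx
  refine powGr_le fun deg a ha hr => ?_
  suffices powD X (m + n) ∘ₗ (conc X m n (PiTensorProduct.tprod k a)) =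
    conc X m n (powD X m (PiTensorProduct.tprod k a)) +
      paritySign k (r : ZMod 2) • conc X m n (PiTensorProduct.tprod k a) ∘ₗ powD X n from
    LinearMap.congr_fun this y
  refine ext_homog fun deg' b hb => ?_
  simp only [LinearMap.comp_apply, LinearMap.add_apply, LinearMap.smul_apply, conc_tprod,
    powD_eq_sum, LinearMap.sum_apply, map_sum, Fin.sum_univ_add, Finset.smul_sum,
    powDTerm_castAdd_conc ha hb, powDTerm_natAdd_conc ha hb, hr]

end TotalDifferential

end

end ShuffleAlg

namespace ShuffleAlg

noncomputable section

/-! ### Permutations which are increasing on the fibres of a labelling -/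

section FiberMono

variable {ι κ L : Type*} [LinearOrder ι] [LinearOrder κ]

/-- `σ` is increasing on every fibre of `f`. Shuffles and the permutations in the definition of the
divided powers are of this kind, up to the order of the blocks in the latter case. -/
def FiberMono (f : ι → L) (σ : ι ≃ κ) : Prop :=
  ∀ i j, i < j → f i = f j → σ i < σ j

theorem FiberMono.lt_iff {f : ι → L} {σ : ι ≃ κ} (h : FiberMono f σ) {i j : ι} (hij : f i = f j) :
    σ i < σ j ↔ i < j := by
  refine ⟨fun hlt => lt_of_not_ge fun hle => ?_, fun hlt => h i j hlt hij⟩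
  rcases hle.lt_or_eq with h' | rfl
  · exact (h j i h' hij.symm).not_gt hlt
  · exact hlt.false

theorem FiberMono.eq_one [WellFoundedLT ι] {f : ι → L} {σ : Equiv.Perm ι} (h : FiberMono f σ)
    (hf : ∀ i, f (σ i) = f i) : σ = 1 := by
  refine Equiv.ext fun i => ?_
  induction i using WellFoundedLT.induction with
  | ind i ih =>
    by_contra hne
    obtain ⟨l, hl⟩ := σ.surjective i
    rcases lt_or_gt_of_ne hne with hlt | hgt
    · exact hlt.ne (σ.injective (ih _ hlt))
    · rcases lt_trichotomy l i with hli | rfl | hil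
      · exact hli.ne ((ih _ hli).symm.trans hl)
      · exact hgt.ne' hl
      · exact (h i l hil (by rw [← hf l, hl])).not_gt (hl ▸ hgt)

/-- Among the permutations `σ * β`, with `β` preserving the fibres of `f`, the lexicographically
smallest one is increasing on the fibres. -/
theorem exists_fiberMono_mul [Finite ι] (f : ι → L) (σ : Equiv.Perm ι) :
    ∃ α β : Equiv.Perm ι, σ = α * β ∧ FiberMono f α ∧ ∀ i, f (β i) = f i := by
  classical
  cases nonempty_fintype ι
  obtain ⟨β, hβ, hmin⟩ := Finset.exists_min_image
    {β : Equiv.Perm ι | ∀ i, f (β i) = f i} (fun β => toLex (⇑(σ * β))) ⟨1, by simp⟩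
  simp only [Finset.mem_filter, Finset.mem_univ, true_and] at hβ hmin
  refine ⟨σ * β, β⁻¹, by simp, fun i j hij hf => ?_, fun i => ?_⟩
  · by_contra! hle
    have hlt : (σ * β) j < (σ * β) i := lt_of_le_of_ne hle fun h => hij.ne' ((σ * β).injective h)
    refine (hmin (β * Equiv.swap i j) fun l => ?_).not_gt (Pi.lex_desc hij.le hlt)
    rw [Equiv.Perm.mul_apply, hβ, Equiv.swap_apply_def]
    grind
  · rw [← hβ]; simp

theorem FiberMono.mul_inj [WellFoundedLT ι] {f : ι → L} {α α' β β' : Equiv.Perm ι}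
    (hα : FiberMono f α) (hα' : FiberMono f α') (hβ : ∀ i, f (β i) = f i)
    (hβ' : ∀ i, f (β' i) = f i) : α * β = α' * β' ↔ α = α' ∧ β = β' := by
  refine ⟨fun h => ?_, fun h => by rw [h.1, h.2]⟩
  have hinv : ∀ i, f (β⁻¹ i) = f i := fun i => by rw [← hβ]; simp
  have hδ : ∀ i, f ((β' * β⁻¹) i) = f i := fun i => by
    rw [Equiv.Perm.mul_apply, hβ', hinv]
  have hα_eq : α = α' * (β' * β⁻¹) := by rw [← mul_assoc, ← h]; simp
  have hβ_eq : β' * β⁻¹ = 1 := by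
    refine FiberMono.eq_one (f := f) (fun i j hij hf => ?_) hδ
    rw [← hα'.lt_iff (by rw [hδ, hδ, hf])]
    have hlt := hα i j hij hf
    rwa [hα_eq] at hlt
  obtain rfl : β' = β := mul_inv_eq_one.1 hβ_eq
  exact ⟨mul_right_cancel h, rfl⟩

end FiberMono

section Side

variable {m n : ℕ} {L L' : Type*}

/-- The side of the element `i` of a sum of two blocks. -/
def side (m n : ℕ) : Fin (m + n) → Bool := Fin.append (fun _ => false) fun _ => true

@[simp] theorem side_castAdd (i : Fin m) : side m n (Fin.castAdd n i) = false := by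
  simp [side]

@[simp] theorem side_natAdd (i : Fin n) : side m n (Fin.natAdd m i) = true := by
  simp [side]

theorem isShuffle_iff_fiberMono (σ : Equiv.Perm (Fin (m + n))) :
    IsShuffle m n σ ↔ FiberMono (side m n) σ := by
  constructor
  · rintro ⟨hm, hn⟩ i j hij hf
    induction i using Fin.addCases with
    | left i =>
      induction j using Fin.addCases with
      | left j => exact hm hij
      | right j => simp at hf
    | right i =>
      induction j using Fin.addCases with
      | left j => simp at hf
      | right j => exact hn (by simpa using hij)
  · exact fun h =>
      ⟨fun i j hij => h _ _ hij (by simp), fun i j hij => h _ _ (by simpa using hij) (by simp)⟩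

theorem fiberMono_finAddFlip (m n : ℕ) :
    FiberMono (side m n) (finAddFlip : Fin (m + n) ≃ Fin (n + m)) := by
  intro i j hij hf
  induction i using Fin.addCases <;> induction j using Fin.addCases <;>
    simp_all [castAdd_lt_castAdd_iff]

theorem side_finAddFlip (i : Fin (m + n)) : side n m (finAddFlip i) = !side m n i := by
  induction i using Fin.addCases <;> simp

theorem side_finSum (α : Equiv.Perm (Fin m)) (β : Equiv.Perm (Fin n)) (i : Fin (m + n)) :
    side m n (finSum α β i) = side m n i := by
  induction i using Fin.addCases <;> simp

theorem exists_eq_finSum (β : Equiv.Perm (Fin (m + n)))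
    (h : ∀ i, side m n (β i) = side m n i) :
    ∃ (β₁ : Equiv.Perm (Fin m)) (β₂ : Equiv.Perm (Fin n)), β = finSum β₁ β₂ := by
  obtain ⟨⟨β₁, β₂⟩, hβ⟩ := Equiv.Perm.mem_sumCongrHom_range_of_perm_mapsTo_inl
    (σ := (finSumFinEquiv.trans β).trans finSumFinEquiv.symm) (by
      rintro _ ⟨i, rfl⟩
      have hi := h (Fin.castAdd n i)
      simp only [Equiv.trans_apply, finSumFinEquiv_apply_left]
      generalize β (Fin.castAdd n i) = j at hi
      induction j using Fin.addCases with
      | left j => simp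
      | right j => simp at hi)
  refine ⟨β₁, β₂, Equiv.ext fun i => ?_⟩
  have hi := Equiv.congr_fun hβ (finSumFinEquiv.symm i)
  simp only [Equiv.trans_apply, Equiv.apply_symm_apply] at hi
  rw [Equiv.eq_symm_apply] at hi
  exact hi.symm

theorem finSum_inj {α α' : Equiv.Perm (Fin m)} {β β' : Equiv.Perm (Fin n)} :
    finSum α β = finSum α' β' ↔ α = α' ∧ β = β' := by
  refine ⟨fun h => ⟨Equiv.ext fun i => ?_, Equiv.ext fun i => ?_⟩, fun h => by rw [h.1, h.2]⟩
  · simpa using Equiv.congr_fun h (Fin.castAdd n i)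
  · simpa using Equiv.congr_fun h (Fin.natAdd m i)

/-- The labelling of a sum of two labelled blocks. -/
def sumLabel (f : Fin m → L) (g : Fin n → L') : Fin (m + n) → L ⊕ L' :=
  Fin.append (Sum.inl ∘ f) (Sum.inr ∘ g)

@[simp] theorem sumLabel_castAdd (f : Fin m → L) (g : Fin n → L') (i : Fin m) :
    sumLabel f g (Fin.castAdd n i) = Sum.inl (f i) := by
  simp [sumLabel]

@[simp] theorem sumLabel_natAdd (f : Fin m → L) (g : Fin n → L') (i : Fin n) :
    sumLabel f g (Fin.natAdd m i) = Sum.inr (g i) := by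
  simp [sumLabel]

theorem sumLabel_assoc {l : ℕ} {L'' : Type*} (f : Fin l → L) (g : Fin m → L') (h : Fin n → L'')
    (i : Fin (l + m + n)) :
    sumLabel f (sumLabel g h) (Fin.cast (add_assoc l m n) i) =
      Equiv.sumAssoc _ _ _ (sumLabel (sumLabel f g) h i) := by
  simp only [sumLabel]
  induction i using Fin.addCases with
  | left i =>
    induction i using Fin.addCases with
    | left i =>
      have : Fin.cast (add_assoc l m n) (Fin.castAdd n (Fin.castAdd m i)) =
        Fin.castAdd (m + n) i := rfl
      simp [this]
    | right i =>
      have : Fin.cast (add_assoc l m n) (Fin.castAdd n (Fin.natAdd l i)) =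
        Fin.natAdd l (Fin.castAdd n i) := rfl
      simp [this]
  | right i =>
    have : Fin.cast (add_assoc l m n) (Fin.natAdd (l + m) i) =
      Fin.natAdd l (Fin.natAdd m i) := Fin.ext (Nat.add_assoc _ _ _)
    simp [this]

theorem side_eq_of_sumLabel_eq {f : Fin m → L} {g : Fin n → L'} {i j : Fin (m + n)}
    (h : sumLabel f g i = sumLabel f g j) : side m n i = side m n j := by
  induction i using Fin.addCases <;> induction j using Fin.addCases <;> simp_all

theorem fiberMono_sumLabel_finSum {f : Fin m → L} {g : Fin n → L'} {α : Equiv.Perm (Fin m)}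
    {β : Equiv.Perm (Fin n)} :
    FiberMono (sumLabel f g) (finSum α β) ↔ FiberMono f α ∧ FiberMono g β := by
  constructor
  · intro h
    refine ⟨fun i j hij hf => ?_, fun i j hij hf => ?_⟩
    · simpa [castAdd_lt_castAdd_iff] using
        h (Fin.castAdd n i) (Fin.castAdd n j) hij (by simp [hf])
    · simpa using h (Fin.natAdd m i) (Fin.natAdd m j) (by simpa using hij) (by simp [hf])
  · rintro ⟨hα, hβ⟩ i j hij hf
    induction i using Fin.addCases with
    | left i =>
      induction j using Fin.addCases with
      | left j => simpa [castAdd_lt_castAdd_iff] using hα i j hij (by simpa using hf)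
      | right j => simp at hf
    | right i =>
      induction j using Fin.addCases with
      | left j => simp at hf
      | right j => simpa using hβ i j (by simpa using hij) (by simpa using hf)

theorem fiberMono_sumLabel_mul_finSum {f : Fin m → L} {g : Fin n → L'}
    {σ : Equiv.Perm (Fin (m + n))} (hσ : FiberMono (side m n) σ) {α : Equiv.Perm (Fin m)}
    {β : Equiv.Perm (Fin n)} :
    FiberMono (sumLabel f g) (σ * finSum α β) ↔ FiberMono f α ∧ FiberMono g β := by
  rw [← fiberMono_sumLabel_finSum]
  refine forall₄_congr fun i j _ hf => hσ.lt_iff ?_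
  rw [side_finSum, side_finSum, side_eq_of_sumLabel_eq hf]

/-- The permutations increasing on the fibres of a labelling of a sum of two blocks are uniquely
products of a shuffle and of such permutations of the two blocks. -/
theorem sum_fiberMono_sumLabel (f : Fin m → L) (g : Fin n → L') {A : Type*} [AddCommMonoid A]
    (F : Equiv.Perm (Fin (m + n)) → A)
    [DecidablePred fun α : Equiv.Perm (Fin m) => FiberMono f α]
    [DecidablePred fun α : Equiv.Perm (Fin n) => FiberMono g α]
    [DecidablePred fun α : Equiv.Perm (Fin (m + n)) => FiberMono (side m n) α]
    [DecidablePred fun α : Equiv.Perm (Fin (m + n)) => FiberMono (sumLabel f g) α] :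
    ∑ α : Equiv.Perm (Fin m) with FiberMono f α, ∑ β : Equiv.Perm (Fin n) with FiberMono g β,
      ∑ σ : Equiv.Perm (Fin (m + n)) with FiberMono (side m n) σ, F (σ * finSum α β) =
    ∑ τ : Equiv.Perm (Fin (m + n)) with FiberMono (sumLabel f g) τ, F τ := by
  simp_rw [← Finset.sum_product']
  refine Finset.sum_bij (fun p _ => p.2.2 * finSum p.1 p.2.1) ?_ ?_ ?_ fun _ _ => rfl
  · rintro ⟨α, β, σ⟩ h
    simp only [Finset.mem_product, Finset.mem_filter, Finset.mem_univ, true_and] at h ⊢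
    exact (fiberMono_sumLabel_mul_finSum h.2.2).2 ⟨h.1, h.2.1⟩
  · rintro ⟨α, β, σ⟩ h ⟨α', β', σ'⟩ h' heq
    simp only [Finset.mem_product, Finset.mem_filter, Finset.mem_univ, true_and] at h h'
    rw [h.2.2.mul_inj h'.2.2 (side_finSum _ _) (side_finSum _ _), finSum_inj] at heq
    obtain ⟨rfl, rfl, rfl⟩ := heq
    rfl
  · intro τ hτ
    simp only [Finset.mem_filter, Finset.mem_univ, true_and] at hτ
    obtain ⟨σ, δ, rfl, hσ, hδ⟩ := exists_fiberMono_mul (side m n) τ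
    obtain ⟨α, β, rfl⟩ := exists_eq_finSum δ hδ
    rw [fiberMono_sumLabel_mul_finSum hσ] at hτ
    exact ⟨(α, β, σ), by simp [hτ, hσ], rfl⟩

end Side

/-! ### Shuffle sums -/

variable {k : Type u} [CommRing k] {X : CochainComplex (ModuleCat.{v} k) ℤ}

variable (X) in
/-- The inclusion of `Tⁿ(X)` into `T(X)`. -/
abbrev incl (n : ℕ) : (⨂[k]^n (Tot X)) →ₗ[k] T X := DirectSum.lof k ℕ (fun n => ⨂[k]^n (Tot X)) n

section ShuffleSum

variable {l m n : ℕ} {L L' : Type*}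

open Classical in
/-- The map sending `x` to the sum of `σ x` over the permutations `σ` which are increasing on the
fibres of `f`. Iterated shuffle products and divided powers are values of such maps. -/
def shuffleSum (f : Fin n → L) : (⨂[k]^n (Tot X)) →ₗ[k] T X :=
  ∑ σ : Equiv.Perm (Fin n) with FiberMono f σ, incl X n ∘ₗ bijAct X σ

open Classical in
theorem shuffleSum_apply (f : Fin n → L) (x : ⨂[k]^n (Tot X)) :
    shuffleSum f x = ∑ σ : Equiv.Perm (Fin n) with FiberMono f σ, incl X n (bijAct X σ x) := by
  simp only [shuffleSum, LinearMap.sum_apply, LinearMap.comp_apply]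

theorem shuffleSum_bijAct {f : Fin m → L} {g : Fin n → L'} (ψ : Fin m ≃ Fin n)
    (hψ : FiberMono f ψ) (h : ∀ i j, g (ψ i) = g (ψ j) ↔ f i = f j) (x : ⨂[k]^m (Tot X)) :
    shuffleSum g (bijAct X ψ x) = shuffleSum f x := by
  classical
  obtain rfl : m = n := by simpa using Fintype.card_congr ψ
  simp only [shuffleSum_apply]
  refine Finset.sum_equiv (Equiv.mulRight (ψ : Equiv.Perm (Fin m))) (fun σ => ?_) fun σ _ => ?_
  · simp only [Finset.mem_filter, Finset.mem_univ, true_and, Equiv.coe_mulRight]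
    refine ⟨fun hσ i j hij hf => hσ _ _ (hψ i j hij hf) ((h i j).2 hf), fun hσ i j hij hg => ?_⟩
    obtain ⟨a, rfl⟩ := ψ.surjective i
    obtain ⟨b, rfl⟩ := ψ.surjective j
    have hf := (h a b).1 hg
    exact hσ a b ((hψ.lt_iff hf).1 hij) hf
  · rw [Equiv.coe_mulRight, bijAct_mul]

theorem shuffleSum_cast {f : Fin m → L} {g : Fin n → L'} (hmn : m = n)
    (h : ∀ i j, g (Fin.cast hmn i) = g (Fin.cast hmn j) ↔ f i = f j) (x : ⨂[k]^m (Tot X)) :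
    shuffleSum g (TensorPower.cast k (Tot X) hmn x) = shuffleSum f x := by
  rw [← bijAct_finCongr, shuffleSum_bijAct (finCongr hmn) (fun i j hij _ => hij) h]

theorem shuffle_incl_incl (x : ⨂[k]^m (Tot X)) (y : ⨂[k]^n (Tot X)) :
    shuffle X (incl X m x) (incl X n y) = shuffleSum (side m n) (conc X m n x y) := by
  classical
  have shuffle_eq : shuffle X (incl X m x) (incl X n y) =
      incl X (m + n) (powShuffle X m n x y) := by
    rw [shuffle, DirectSum.toModule_lof, LinearMap.flip_apply, DirectSum.toModule_lof]
    rfl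
  rw [shuffle_eq, powShuffle, shuffleSum_apply, LinearMap.compr₂_apply, LinearMap.sum_apply,
    map_sum]
  refine Finset.sum_congr (Finset.filter_congr fun σ _ => isShuffle_iff_fiberMono σ) fun σ _ => ?_
  rw [permAct_eq_bijAct]
  rfl

theorem shuffle_shuffleSum (f : Fin m → L) (g : Fin n → L') (x : ⨂[k]^m (Tot X))
    (y : ⨂[k]^n (Tot X)) :
    shuffle X (shuffleSum f x) (shuffleSum g y) = shuffleSum (sumLabel f g) (conc X m n x y) := by
  classical
  simp only [shuffleSum_apply, map_sum, LinearMap.sum_apply]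
  rw [← sum_fiberMono_sumLabel f g, Finset.sum_comm]
  refine Finset.sum_congr rfl fun α _ => Finset.sum_congr rfl fun β _ => ?_
  simp only [shuffle_incl_incl, shuffleSum_apply, bijAct_mul, bijAct_finSum_conc]

theorem incl_eq_shuffleSum (x : ⨂[k]^n (Tot X)) : incl X n x = shuffleSum (fun _ => ()) x := by
  classical
  rw [shuffleSum_apply, Finset.sum_eq_single_of_mem 1, bijAct_one]
  · simp only [Finset.mem_filter, Finset.mem_univ, true_and]
    exact fun i j hij _ => hij
  · intro σ hσ hne
    simp only [Finset.mem_filter, Finset.mem_univ, true_and] at hσ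
    exact absurd (hσ.eq_one fun _ => rfl) hne

theorem shuffle_assoc_incl (x : ⨂[k]^l (Tot X)) (y : ⨂[k]^m (Tot X)) (z : ⨂[k]^n (Tot X)) :
    shuffle X (shuffle X (incl X l x) (incl X m y)) (incl X n z) =
      shuffle X (incl X l x) (shuffle X (incl X m y) (incl X n z)) := by
  rw [incl_eq_shuffleSum, incl_eq_shuffleSum, incl_eq_shuffleSum, shuffle_shuffleSum,
    shuffle_shuffleSum, shuffle_shuffleSum, shuffle_shuffleSum, ← conc_assoc]
  refine (shuffleSum_cast _ (fun i j => ?_) _).symm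
  rw [sumLabel_assoc, sumLabel_assoc, (Equiv.sumAssoc _ _ _).apply_eq_iff_eq]

theorem shuffle_comm_incl {r s : ℤ} {x : ⨂[k]^m (Tot X)} {y : ⨂[k]^n (Tot X)}
    (hx : x ∈ powGr X m r) (hy : y ∈ powGr X n s) :
    shuffle X (incl X m x) (incl X n y) =
      paritySign k ((r * s : ℤ) : ZMod 2) • shuffle X (incl X n y) (incl X m x) := by
  rw [shuffle_incl_incl, shuffle_incl_incl, ← map_smul, ← bijAct_finAddFlip_conc hx hy,
    shuffleSum_bijAct finAddFlip (fiberMono_finAddFlip m n)]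
  simp [side_finAddFlip]

theorem add_neg_one_smul {R M : Type*} [Ring R] [AddCommMonoid M] [Module R M] (x : M) :
    x + (-1 : R) • x = 0 := by
  nth_rewrite 1 [← one_smul R x]
  rw [← add_smul, add_neg_cancel, zero_smul]

theorem powGr_zero {r : ℤ} (hr : r ≠ 0) : powGr X 0 r = ⊥ := by
  rw [eq_bot_iff]
  refine powGr_le fun deg a _ h => absurd ?_ hr
  simpa using h.symm

/-- Exchanging the two blocks pairs off the shuffles, and by the Koszul rule it changes the sign of
`x ⊗ x` for `x` of odd degree. -/
theorem shuffle_self_incl {r : ℤ} (hr : Odd r) {x : ⨂[k]^n (Tot X)} (hx : x ∈ powGr X n r) :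
    shuffle X (incl X n x) (incl X n x) = 0 := by
  classical
  rcases Nat.eq_zero_or_pos n with rfl | hn
  · rw [powGr_zero (by rintro rfl; simp at hr), Submodule.mem_bot] at hx
    simp [hx]
  rw [shuffle_incl_incl, shuffleSum_apply]
  refine Finset.sum_involution (fun σ _ => σ * (finAddFlip : Fin (n + n) ≃ Fin (n + n)))
    ?_ ?_ ?_ ?_
  · intro σ _
    rw [bijAct_mul, bijAct_finAddFlip_conc hx hx, ZMod.intCast_eq_one_iff_odd.2 (hr.mul hr),
      paritySign_one, map_smul, map_smul, add_neg_one_smul]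
  · intro σ _ _ h
    have hfix := Equiv.congr_fun h (Fin.castAdd n ⟨0, hn⟩)
    rw [Equiv.Perm.mul_apply, finAddFlip_apply_castAdd] at hfix
    exact (castAdd_lt_natAdd (n := n) ⟨0, hn⟩ ⟨0, hn⟩).ne' (σ.injective hfix)
  · intro σ hσ
    simp only [Finset.mem_filter, Finset.mem_univ, true_and] at hσ ⊢
    intro i j hij hf
    rw [Equiv.Perm.mul_apply, Equiv.Perm.mul_apply]
    exact hσ _ _ (fiberMono_finAddFlip n n i j hij hf) (by simp [side_finAddFlip, hf])
  · intro σ _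
    refine Equiv.ext fun i => congrArg σ ?_
    simpa only [finAddFlip_symm] using (finAddFlip : Fin (n + n) ≃ _).symm_apply_apply i

theorem d_incl (x : ⨂[k]^n (Tot X)) : d X (incl X n x) = incl X n (powD X n x) := by
  simp [d]

theorem d_shuffleSum (f : Fin n → L) (x : ⨂[k]^n (Tot X)) :
    d X (shuffleSum f x) = shuffleSum f (powD X n x) := by
  simp only [shuffleSum_apply, map_sum, d_incl, bijAct_powD]

theorem leibniz_incl {r : ℤ} {x : ⨂[k]^m (Tot X)} (hx : x ∈ powGr X m r) (y : ⨂[k]^n (Tot X)) :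
    d X (shuffle X (incl X m x) (incl X n y)) = shuffle X (d X (incl X m x)) (incl X n y) +
      paritySign k (r : ZMod 2) • shuffle X (incl X m x) (d X (incl X n y)) := by
  simp only [d_incl, shuffle_incl_incl, d_shuffleSum, powD_conc hx, map_add, map_smul]

end ShuffleSum

end

end ShuffleAlg

namespace DGAlg

/-! ### Gradings and their projections -/

section Grading

variable {k A ι : Type*} [CommRing k] [AddCommMonoid A] [Module k A]

/-- The linear maps `π i` are the projections of a grading of `A` by the submodules `gr i`. -/
structure IsGradingProj (gr : ι → Submodule k A) (π : ι → A →ₗ[k] A) : Prop where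
  eq_self : ∀ i, ∀ x ∈ gr i, π i x = x
  eq_zero : ∀ i j, i ≠ j → ∀ x ∈ gr j, π i x = 0
  iSup_eq_top : ⨆ i, gr i = ⊤

theorem exists_isGradingProj [DecidableEq ι] {gr : ι → Submodule k A}
    (h : DirectSum.IsInternal gr) : ∃ π, IsGradingProj gr π := by
  let := h.chooseDecomposition
  refine ⟨fun i => (gr i).subtype ∘ₗ DirectSum.component k ι (fun i => gr i) i ∘ₗ
    (DirectSum.decomposeLinearEquiv gr).toLinearMap, fun i x hx => ?_, fun i j hij x hx => ?_,
    h.submodule_iSup_eq_top⟩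
  · exact DirectSum.decompose_of_mem_same gr hx
  · exact DirectSum.decompose_of_mem_ne gr hx hij.symm

namespace IsGradingProj

variable {gr : ι → Submodule k A} {π : ι → A →ₗ[k] A} {S : Submodule k A}

theorem exists_sum (h : IsGradingProj gr π) (x : A) :
    (∀ i, π i x ∈ gr i) ∧ ∃ s : Finset ι, x = ∑ i ∈ s, π i x := by
  classical
  have hx : x ∈ ⨆ i, gr i := h.iSup_eq_top ▸ Submodule.mem_top
  obtain ⟨f, hf, rfl⟩ := (Submodule.mem_iSup_iff_exists_finsupp gr x).1 hx
  have proj_sum : ∀ i, π i (f.sum fun _ a => a) = f i := by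
    intro i
    rw [Finsupp.sum, map_sum]
    by_cases hi : i ∈ f.support
    · rw [Finset.sum_eq_single_of_mem i hi fun j _ hj => h.eq_zero i j hj.symm _ (hf j),
        h.eq_self i _ (hf i)]
    · rw [Finsupp.notMem_support_iff.1 hi]
      exact Finset.sum_eq_zero fun j hj => h.eq_zero i j (fun e => hi (e ▸ hj)) _ (hf j)
  exact ⟨fun i => (proj_sum i).symm ▸ hf i, f.support,
    Finset.sum_congr rfl fun i _ => (proj_sum i).symm⟩

theorem proj_mem (h : IsGradingProj gr π) (i : ι) (x : A) : π i x ∈ gr i := (h.exists_sum x).1 i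

theorem mem_of_forall_proj_mem (h : IsGradingProj gr π) {x : A} (hx : ∀ i, π i x ∈ S) :
    x ∈ S := by
  obtain ⟨-, s, hs⟩ := h.exists_sum x
  rw [hs]
  exact Submodule.sum_mem _ fun i _ => hx i

theorem mem_iff (h : IsGradingProj gr π) {i : ι} {x : A} :
    x ∈ gr i ↔ ∀ j, j ≠ i → π j x = 0 := by
  refine ⟨fun hx j hj => h.eq_zero j i hj x hx, fun hx => h.mem_of_forall_proj_mem fun j => ?_⟩
  obtain rfl | hj := eq_or_ne j i
  · exact h.proj_mem j x
  · exact hx j hj ▸ zero_mem _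

theorem map_proj (h : IsGradingProj gr π) {B : Type*} [AddCommMonoid B] [Module k B]
    {gr' : ι → Submodule k B} {π' : ι → B →ₗ[k] B} (h' : IsGradingProj gr' π') {f : A →ₗ[k] B}
    (hf : ∀ i, ∀ x ∈ gr i, f x ∈ gr' i) (i : ι) (x : A) : f (π i x) = π' i (f x) := by
  suffices ⨆ j, gr j ≤ LinearMap.eqLocus (f ∘ₗ π i) (π' i ∘ₗ f) from
    this (h.iSup_eq_top ▸ Submodule.mem_top)
  refine iSup_le fun j x hx => ?_
  rw [LinearMap.mem_eqLocus, LinearMap.comp_apply, LinearMap.comp_apply]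
  obtain rfl | hij := eq_or_ne i j
  · rw [h.eq_self i x hx, h'.eq_self i _ (hf i x hx)]
  · rw [h.eq_zero i j hij x hx, h'.eq_zero i j hij _ (hf j x hx), map_zero]

theorem isInternal [DecidableEq ι] (h : IsGradingProj gr π) : DirectSum.IsInternal gr := by
  have proj_coe : ∀ (a : ⨁ i, gr i) (i : ι), π i (DirectSum.coeAddMonoidHom gr a) = a i := by
    intro a i
    induction a using DirectSum.induction_on with
    | zero => simp
    | of j x =>
      rw [DirectSum.coeAddMonoidHom_of]
      obtain rfl | hij := eq_or_ne i j
      · rw [h.eq_self _ _ x.2, DirectSum.of_eq_same]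
      · rw [h.eq_zero i j hij _ x.2, DirectSum.of_eq_of_ne _ _ _ hij]
        rfl
    | add x y hx hy => rw [map_add, map_add, hx, hy]; rfl
  refine ⟨fun a b hab => DFinsupp.ext fun i => Subtype.ext ?_, fun x => ?_⟩
  · rw [← proj_coe, ← proj_coe, hab]
  · obtain ⟨hm, s, hs⟩ := h.exists_sum x
    refine ⟨∑ i ∈ s, DirectSum.of (fun i => gr i) i ⟨π i x, hm i⟩, ?_⟩
    rw [map_sum]
    simp only [DirectSum.coeAddMonoidHom_of]
    exact hs.symm

theorem le_iSup_inf_iff (h : IsGradingProj gr π) :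
    S ≤ ⨆ i, S ⊓ gr i ↔ ∀ i, ∀ x ∈ S, π i x ∈ S := by
  refine ⟨fun hS i => ?_, fun hS x hx => ?_⟩
  · suffices ⨆ j, S ⊓ gr j ≤ S.comap (π i) from hS.trans this
    refine iSup_le fun j x hx => ?_
    obtain rfl | hij := eq_or_ne i j
    · rw [Submodule.mem_comap, h.eq_self i x hx.2]
      exact hx.1
    · rw [Submodule.mem_comap, h.eq_zero i j hij x hx.2]
      exact zero_mem S
  · exact h.mem_of_forall_proj_mem fun i =>
      Submodule.mem_iSup_of_mem i ⟨hS i x hx, h.proj_mem i x⟩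

theorem subGr (h : IsGradingProj gr π) (hS : ∀ i, ∀ x ∈ S, π i x ∈ S) :
    IsGradingProj (subGr gr S) fun i => (π i).restrict (hS i) where
  eq_self i x hx := Subtype.ext (h.eq_self i x hx)
  eq_zero i j hij x hx := Subtype.ext (h.eq_zero i j hij x hx)
  iSup_eq_top := by
    rw [eq_top_iff]
    intro x _
    obtain ⟨hm, s, hs⟩ := h.exists_sum (x : A)
    have hx : x = ∑ i ∈ s, (π i).restrict (hS i) x :=
      Subtype.ext (by rwa [AddSubmonoidClass.coe_finsetSum])
    rw [hx]
    exact Submodule.sum_mem _ fun i _ => Submodule.mem_iSup_of_mem i (hm i)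

end IsGradingProj

section EvenPart

variable {gr : ℤ → Submodule k A} {π : ℤ → A →ₗ[k] A} {S : Submodule k A} {x : A}

theorem mem_evenPart_of_mem {i : ℤ} (hi : Even i) (hx : x ∈ gr i) : x ∈ evenPart gr :=
  Submodule.mem_iSup_of_mem i (Submodule.mem_iSup_of_mem hi hx)

theorem evenPart_le (h : ∀ i, Even i → gr i ≤ S) : evenPart gr ≤ S :=
  iSup_le fun i => iSup_le fun hi => h i hi

theorem evenPart_induction {p : A → Prop} (hx : x ∈ evenPart gr)
    (mem : ∀ i, Even i → ∀ x ∈ gr i, p x) (zero : p 0) (add : ∀ x y, p x → p y → p (x + y)) :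
    p x := by
  rw [evenPart, iSup_subtype'] at hx
  exact Submodule.iSup_induction _ (motive := p) hx (fun i x hx => mem i i.2 x hx) zero add

theorem IsGradingProj.mem_evenPart_iff (h : IsGradingProj gr π) :
    x ∈ evenPart gr ↔ ∀ i, Odd i → π i x = 0 := by
  refine ⟨fun hx i hi => ?_, fun hx => h.mem_of_forall_proj_mem fun i => ?_⟩
  · suffices evenPart gr ≤ LinearMap.ker (π i) from this hx
    refine evenPart_le fun j hj y hy => h.eq_zero i j ?_ y hy
    rintro rfl
    exact Int.not_even_iff_odd.2 hi hj
  · rcases Int.even_or_odd i with hi | hi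
    · exact mem_evenPart_of_mem hi (h.proj_mem i x)
    · exact hx i hi ▸ zero_mem _

theorem IsGradingProj.mem_evenPart_subGr_iff (h : IsGradingProj gr π)
    (hS : S ≤ ⨆ i, S ⊓ gr i) {x : S} :
    x ∈ evenPart (DGAlg.subGr gr S) ↔ (x : A) ∈ evenPart gr := by
  rw [h.mem_evenPart_iff, (h.subGr (h.le_iSup_inf_iff.1 hS)).mem_evenPart_iff]
  simp only [Subtype.ext_iff]
  rfl

theorem IsGradingProj.inf_evenPart_le (h : IsGradingProj gr π) (hS : S ≤ ⨆ i, S ⊓ gr i) :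
    S ⊓ evenPart gr ≤ evenPart fun i => S ⊓ gr i := by
  rintro x ⟨hxS, hx⟩
  refine h.mem_of_forall_proj_mem fun i => ?_
  rcases Int.even_or_odd i with hi | hi
  · exact mem_evenPart_of_mem (gr := fun i => S ⊓ gr i) hi
      ⟨h.le_iSup_inf_iff.1 hS i x hxS, h.proj_mem i x⟩
  · exact h.mem_evenPart_iff.1 hx i hi ▸ zero_mem _

theorem exists_mem_evenPart_map_eq {l B : Type*} [CommRing l] [AddCommMonoid B] [Module l B]
    {gr' : ℤ → Submodule l B} {f : A →+ B} (hf : ∀ i, ∀ y ∈ gr' i, ∃ x ∈ gr i, f x = y) {y : B}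
    (hy : y ∈ evenPart gr') : ∃ x ∈ evenPart gr, f x = y := by
  refine evenPart_induction (p := fun y => ∃ x ∈ evenPart gr, f x = y) hy
    (fun i hi y hy => ?_) ⟨0, zero_mem _, map_zero f⟩ ?_
  · obtain ⟨x, hx, rfl⟩ := hf i y hy
    exact ⟨x, mem_evenPart_of_mem hi hx, rfl⟩
  · rintro _ _ ⟨x, hx, rfl⟩ ⟨x', hx', rfl⟩
    exact ⟨x + x', add_mem hx hx', map_add f x x'⟩

end EvenPart

end Grading

/-! ### Powers and even elements -/

section DGAlgebra

variable {k A : Type*} [CommRing k] [AddCommMonoid A] [Module k A] {mul : A →ₗ[k] A →ₗ[k] A}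
  {one : A} {gr : ℤ → Submodule k A} {d : A →ₗ[k] A} {S I : Submodule k A}

theorem npow_zero (a : A) : npow mul one a 0 = one := rfl

theorem npow_succ (a : A) (n : ℕ) : npow mul one a (n + 1) = mul a (npow mul one a n) :=
  Function.iterate_succ_apply' _ _ _

namespace IsDGAlgebra

/-- The ring structure of a dg algebra. -/
abbrev toSemiring (hA : IsDGAlgebra mul one gr d) : Semiring A :=
  { (inferInstance : AddCommMonoid A) with
    mul := fun x y => mul x y
    one := one
    left_distrib := fun x y z => map_add (mul x) y z
    right_distrib := fun x y z => LinearMap.map_add₂ mul x y z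
    zero_mul := fun x => LinearMap.map_zero₂ mul x
    mul_zero := fun x => map_zero (mul x)
    mul_assoc := hA.mul_assoc
    one_mul := hA.one_mul
    mul_one := hA.mul_one }

theorem npow_eq_pow (hA : IsDGAlgebra mul one gr d) (a : A) (n : ℕ) :
    letI := hA.toSemiring
    npow mul one a n = a ^ n := by
  let := hA.toSemiring
  induction n with
  | zero => exact (pow_zero a).symm
  | succ n ih => rw [npow_succ, ih, pow_succ']; rfl

theorem npow_succ' (hA : IsDGAlgebra mul one gr d) (a : A) (n : ℕ) :
    npow mul one a (n + 1) = mul (npow mul one a n) a := by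
  let := hA.toSemiring
  rw [hA.npow_eq_pow, hA.npow_eq_pow, pow_succ]
  rfl

theorem mul_mem_evenPart (hA : IsDGAlgebra mul one gr d) {x y : A} (hx : x ∈ evenPart gr)
    (hy : y ∈ evenPart gr) : mul x y ∈ evenPart gr := by
  suffices evenPart gr ≤ (evenPart gr).comap (mul.flip y) from this hx
  refine evenPart_le fun i hi x hx => ?_
  suffices evenPart gr ≤ (evenPart gr).comap (mul x) from this hy
  exact evenPart_le fun j hj y hy => mem_evenPart_of_mem (hi.add hj) (hA.mul_mem i j x hx y hy)

theorem npow_mem (hA : IsDGAlgebra mul one gr d) {i : ℤ} {x : A} (hx : x ∈ gr i) (n : ℕ) :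
    npow mul one x n ∈ gr (n * i) := by
  induction n with
  | zero => simpa [npow_zero] using hA.one_mem
  | succ n ih =>
    rw [npow_succ, Nat.cast_succ, add_mul, _root_.one_mul, add_comm]
    exact hA.mul_mem _ _ x hx _ ih

theorem npow_mem_evenPart (hA : IsDGAlgebra mul one gr d) {x : A} (hx : x ∈ evenPart gr) (n : ℕ) :
    npow mul one x n ∈ evenPart gr := by
  induction n with
  | zero => exact mem_evenPart_of_mem Even.zero hA.one_mem
  | succ n ih => exact npow_succ (mul := mul) x n ▸ hA.mul_mem_evenPart hx ih

theorem leibniz_of_mem_evenPart (hA : IsDGAlgebra mul one gr d) {x : A} (hx : x ∈ evenPart gr)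
    (y : A) : d (mul x y) = mul (d x) y + mul x (d y) := by
  suffices evenPart gr ≤ LinearMap.eqLocus (d ∘ₗ mul.flip y) (mul.flip y ∘ₗ d + mul.flip (d y)) from
    this hx
  refine evenPart_le fun i hi x hx => ?_
  simpa [Int.negOnePow_even i hi] using hA.leibniz i x hx y

theorem mul_comm_of_mem_evenPart (hA : IsDGAlgebra mul one gr d)
    (hc : IsStrictlyGradedCommutative mul gr) {x : A} (hx : x ∈ evenPart gr) (y : A) :
    mul x y = mul y x := by
  suffices evenPart gr ≤ LinearMap.eqLocus (mul.flip y) (mul y) from this hx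
  refine evenPart_le fun i hi x hx => ?_
  suffices ⨆ j, gr j ≤ LinearMap.eqLocus (mul x) (mul.flip x) from
    this (hA.isInternal.submodule_iSup_eq_top ▸ Submodule.mem_top)
  refine iSup_le fun j y hy => ?_
  simpa [Int.negOnePow_even _ (hi.mul_right j)] using hc.comm i j x hx y hy

theorem d_npow_succ (hA : IsDGAlgebra mul one gr d) (hc : IsStrictlyGradedCommutative mul gr)
    {x : A} (hx : x ∈ evenPart gr) (n : ℕ) :
    d (npow mul one x (n + 1)) = (n + 1) • mul (npow mul one x n) (d x) := by
  induction n with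
  | zero => rw [npow_succ, npow_zero, hA.mul_one, hA.one_mul, zero_add, one_smul]
  | succ n ih =>
    have d_mul_npow : mul (d x) (npow mul one x (n + 1)) = mul (npow mul one x (n + 1)) (d x) :=
      (hA.mul_comm_of_mem_evenPart hc (hA.npow_mem_evenPart hx _) _).symm
    rw [npow_succ, hA.leibniz_of_mem_evenPart hx, ih, d_mul_npow, map_nsmul, ← hA.mul_assoc,
      ← npow_succ, succ_nsmul' _ (n + 1)]

theorem npow_mul_eq_zero (hA : IsDGAlgebra mul one gr d)
    (hc : IsStrictlyGradedCommutative mul gr) {i j : ℤ} (hj : Odd j) {x y : A} (hx : x ∈ gr i)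
    (hy : y ∈ gr j) {n : ℕ} (hn : 2 ≤ n) : npow mul one (mul x y) n = 0 := by
  let := hA.toSemiring
  have sq_eq_zero : mul (mul x y) (mul x y) = 0 := by
    rw [hA.mul_assoc, ← hA.mul_assoc y, hc.comm j i y hy x hx, LinearMap.map_smul₂, map_smul,
      hA.mul_assoc x y y, hc.sq_eq_zero j hj y hy, map_zero, map_zero, smul_zero]
  obtain ⟨m, rfl⟩ := Nat.exists_eq_add_of_le hn
  rw [hA.npow_eq_pow, pow_add, pow_two]
  exact (congrArg (· * mul x y ^ m) sq_eq_zero).trans (zero_mul _)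

end IsDGAlgebra

theorem IsDGIdeal.npow_mem (hI : IsDGIdeal mul gr d I) {x : A} (hx : x ∈ I) {n : ℕ} (hn : n ≠ 0) :
    npow mul one x n ∈ I := by
  obtain ⟨n, rfl⟩ := Nat.exists_eq_succ_of_ne_zero hn
  exact npow_succ (mul := mul) x n ▸ hI.mul_mem_right _ _ hx

end DGAlgebra

/-! ### Divided powers and division by factorials -/

section Factorial

variable {R : Type*} [Semiring R] {m n p q : ℕ} {a b c x y : R}

theorem factorial_smul_sum_mul (hxy : Commute x y) {f g : ℕ → R} (hf : ∀ i, i ! • f i = x ^ i)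
    (hg : ∀ i, i ! • g i = y ^ i) (n : ℕ) :
    n ! • ∑ i ∈ Finset.range (n + 1), f i * g (n - i) = (x + y) ^ n := by
  rw [hxy.add_pow, Finset.smul_sum]
  refine Finset.sum_congr rfl fun i hi => ?_
  rw [← hf i, ← hg (n - i),
    ← Nat.choose_mul_factorial_mul_factorial (Nat.lt_succ_iff.1 (Finset.mem_range.1 hi)),
    smul_mul_smul_comm, ← nsmul_eq_mul', smul_smul, mul_assoc]

variable [IsAddTorsionFree R]

theorem mul_eq_choose_smul_of_factorial_smul (ha : n ! • a = x ^ n) (hb : m ! • b = x ^ m)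
    (hc : (n + m)! • c = x ^ (n + m)) : a * b = (n + m).choose m • c := by
  refine nsmul_right_injective (n := n ! * m !) (by positivity) ?_
  dsimp only
  rw [← smul_mul_smul_comm, ha, hb, smul_smul, ← pow_add, ← hc,
    ← Nat.add_choose_mul_factorial_mul_factorial]
  congr 1
  ring

theorem eq_pow_mul_of_factorial_smul (hax : Commute a x) (hb : n ! • b = x ^ n)
    (hc : n ! • c = (a * x) ^ n) : c = a ^ n * b := by
  refine nsmul_right_injective (n := n !) (by positivity) ?_
  dsimp only
  rw [hc, ← mul_smul_comm, hb, hax.mul_pow]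

theorem eq_smul_of_factorial_smul_comp (hq : q ≠ 0) (ha : q ! • a = x ^ q)
    (hb : p ! • b = a ^ p) (hc : (p * q)! • c = x ^ (p * q)) :
    b = ((p * q)! / (p ! * q ! ^ p)) • c := by
  refine nsmul_right_injective (n := p ! * q ! ^ p) (by positivity) ?_
  have hdvd : p ! * q ! ^ p ∣ (p * q)! :=
    ⟨p.uniformBell q, by rw [← Nat.uniformBell_mul_eq p hq]; ring⟩
  dsimp only
  rw [smul_smul, Nat.mul_div_cancel' hdvd, hc, mul_comm (p !), mul_smul, hb, ← smul_pow, ha,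
    ← pow_mul, mul_comm]

end Factorial

section OfFactorialSMul

variable {k A : Type*} [CommRing k] [AddCommMonoid A] [Module k A] [IsAddTorsionFree A]
  {mul : A →ₗ[k] A →ₗ[k] A} {one : A} {gr : ℤ → Submodule k A} {d : A →ₗ[k] A}
  {I : Submodule k A} {γ : ℕ → A → A}

theorem IsGradingProj.mem_of_smul_mem {π : ℤ → A →ₗ[k] A} (h : IsGradingProj gr π) {n : ℕ}
    (hn : n ≠ 0) {i : ℤ} {x : A} (hx : n • x ∈ gr i) : x ∈ gr i := by
  refine h.mem_iff.2 fun j hj => nsmul_right_injective hn ?_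
  simpa using h.mem_iff.1 hx j hj

theorem IsGradingProj.mem_evenPart_of_smul_mem {π : ℤ → A →ₗ[k] A} (h : IsGradingProj gr π)
    {n : ℕ} (hn : n ≠ 0) {x : A} (hx : n • x ∈ evenPart gr) : x ∈ evenPart gr := by
  refine h.mem_evenPart_iff.2 fun i hi => nsmul_right_injective hn ?_
  simpa using h.mem_evenPart_iff.1 hx i hi

theorem IsPDStructure.of_factorial_smul (hA : IsDGAlgebra mul one gr d)
    (hc : IsStrictlyGradedCommutative mul gr) (hI : IsDGIdeal mul gr d I)
    (hI_sat : ∀ n : ℕ, n ≠ 0 → ∀ x, n • x ∈ I → x ∈ I)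
    (hγ : ∀ n, ∀ x ∈ I ⊓ evenPart gr, n ! • γ n x = npow mul one x n) :
    IsPDStructure mul one gr d I γ := by
  let := hA.toSemiring
  obtain ⟨π, hπ⟩ := exists_isGradingProj hA.isInternal
  have hγ_pow : ∀ n, ∀ x ∈ I ⊓ evenPart gr, n ! • γ n x = x ^ n := fun n x hx =>
    (hγ n x hx).trans (hA.npow_eq_pow x n)
  have gamma_mem : ∀ n, 1 ≤ n → ∀ x ∈ I ⊓ evenPart gr, γ n x ∈ I ⊓ evenPart gr :=
    fun n hn x hx => ⟨hI_sat n ! n.factorial_ne_zero _ (hγ n x hx ▸ hI.npow_mem hx.1 (by lia)),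
      hπ.mem_evenPart_of_smul_mem n.factorial_ne_zero (hγ n x hx ▸ hA.npow_mem_evenPart hx.2 n)⟩
  refine
    { isDGIdeal := hI
      gamma_mem := gamma_mem
      gamma_zero := fun x hx => by simpa [npow_zero] using hγ 0 x hx
      gamma_one := fun x hx => by simpa using hγ_pow 1 x hx
      gamma_mul := fun n m x hx =>
        mul_eq_choose_smul_of_factorial_smul (hγ_pow n x hx) (hγ_pow m x hx) (hγ_pow _ x hx)
      gamma_smul := fun n a ha x hx => hA.npow_eq_pow a n ▸
        eq_pow_mul_of_factorial_smul (hA.mul_comm_of_mem_evenPart hc ha x) (hγ_pow n x hx)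
          (hγ_pow n _ ⟨hI.mul_mem_left a x hx.1, hA.mul_mem_evenPart ha hx.2⟩)
      gamma_add := fun n x hx y hy => nsmul_right_injective n.factorial_ne_zero ?_
      gamma_comp := fun p q hq x hx => eq_smul_of_factorial_smul_comp (Nat.one_le_iff_ne_zero.1 hq)
        (hγ_pow q x hx) (hγ_pow p _ (gamma_mem q hq x hx)) (hγ_pow _ x hx)
      gamma_deg := fun n r hr x hx => hπ.mem_of_smul_mem n.factorial_ne_zero
        (hγ n x ⟨hx.1, mem_evenPart_of_mem hr hx.2⟩ ▸ hA.npow_mem hx.2 n)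
      gamma_odd := fun n hn i j hi hj x hx y hy => nsmul_right_injective n.factorial_ne_zero ?_
      d_gamma := fun n hn x hx => nsmul_right_injective n.factorial_ne_zero ?_ }
  · exact (hγ_pow n _ (add_mem hx hy)).trans (factorial_smul_sum_mul
      (hA.mul_comm_of_mem_evenPart hc hx.2 y) (hγ_pow · x hx) (hγ_pow · y hy) n).symm
  · have hxy : mul x y ∈ I ⊓ evenPart gr :=
      ⟨hI.mul_mem_left x y hy.1, mem_evenPart_of_mem (hi.add_odd hj) (hA.mul_mem i j x hx y hy.2)⟩
    exact (hγ n _ hxy).trans ((hA.npow_mul_eq_zero hc hj hx hy.2 hn).trans (smul_zero _).symm)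
  · obtain ⟨n, rfl⟩ := Nat.exists_eq_add_of_le' hn
    dsimp only
    rw [← map_nsmul, hγ _ x hx, hA.d_npow_succ hc hx.2, Nat.add_sub_cancel, ← hγ n x hx,
      map_nsmul, LinearMap.smul_apply, smul_smul, Nat.factorial_succ]

end OfFactorialSMul

/-! ### Change of the dg algebra -/

section Hom

variable {k l A B : Type*} [CommRing k] [AddCommMonoid A] [Module k A] [CommRing l]
  [AddCommMonoid B] [Module l B] {mul : A →ₗ[k] A →ₗ[k] A} {one : A} {gr : ℤ → Submodule k A}
  {d : A →ₗ[k] A} {I : Submodule k A} {γ : ℕ → A → A} {mul' : B →ₗ[l] B →ₗ[l] B} {one' : B}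
  {gr' : ℤ → Submodule l B} {d' : B →ₗ[l] B} {J : Submodule l B} {γ' : ℕ → B → B} {f : A →+ B}

/-- `f` is a morphism of dg algebras. The two algebras may have different base rings, so `f` is
only asked to be additive. -/
structure IsDGHom (mul : A →ₗ[k] A →ₗ[k] A) (one : A) (gr : ℤ → Submodule k A) (d : A →ₗ[k] A)
    (mul' : B →ₗ[l] B →ₗ[l] B) (one' : B) (gr' : ℤ → Submodule l B) (d' : B →ₗ[l] B)
    (f : A →+ B) : Prop where
  map_mul : ∀ x y, f (mul x y) = mul' (f x) (f y)
  map_one : f one = one'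
  map_mem : ∀ i, ∀ x ∈ gr i, f x ∈ gr' i
  map_d : ∀ x, f (d x) = d' (f x)

namespace IsDGHom

theorem map_npow (hf : IsDGHom mul one gr d mul' one' gr' d' f) (x : A) (n : ℕ) :
    f (npow mul one x n) = npow mul' one' (f x) n := by
  induction n with
  | zero => exact hf.map_one
  | succ n ih => rw [npow_succ, npow_succ, hf.map_mul, ih]

theorem map_mem_evenPart (hf : IsDGHom mul one gr d mul' one' gr' d' f) {x : A}
    (hx : x ∈ evenPart gr) : f x ∈ evenPart gr' :=
  evenPart_induction (p := fun x => f x ∈ evenPart gr') hx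
    (fun i hi x hx => mem_evenPart_of_mem hi (hf.map_mem i x hx)) (map_zero f ▸ zero_mem _)
    fun x y hx hy => map_add f x y ▸ add_mem hx hy

end IsDGHom

theorem IsGradingProj.exists_mem_inf_evenPart_map_eq {π : ℤ → B →ₗ[l] B}
    (hπ : IsGradingProj gr' π) (hJ : J ≤ ⨆ i, J ⊓ gr' i)
    (hf : ∀ i, ∀ y ∈ J ⊓ gr' i, ∃ x ∈ I ⊓ gr i, f x = y) {y : B} (hy : y ∈ J ⊓ evenPart gr') :
    ∃ x ∈ I ⊓ evenPart gr, f x = y := by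
  obtain ⟨x, hx, rfl⟩ := exists_mem_evenPart_map_eq hf (hπ.inf_evenPart_le hJ hy)
  have evenPart_inf_le : evenPart (fun i => I ⊓ gr i) ≤ I ⊓ evenPart gr :=
    evenPart_le fun i hi x hx => ⟨hx.1, mem_evenPart_of_mem hi hx.2⟩
  exact ⟨x, evenPart_inf_le hx, rfl⟩

theorem IsPDStructure.of_surjective (hγ : IsPDStructure mul one gr d I γ)
    (hA : IsDGAlgebra mul one gr d) (hf : IsDGHom mul one gr d mul' one' gr' d' f)
    (hgr' : DirectSum.IsInternal gr') (hJ : IsDGIdeal mul' gr' d' J) (hIJ : ∀ x ∈ I, f x ∈ J)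
    (hf_gr : ∀ i, ∀ y ∈ gr' i, ∃ x ∈ gr i, f x = y)
    (hf_inf : ∀ i, ∀ y ∈ J ⊓ gr' i, ∃ x ∈ I ⊓ gr i, f x = y)
    (hγ' : ∀ n, ∀ x ∈ I ⊓ evenPart gr, γ' n (f x) = f (γ n x)) :
    IsPDStructure mul' one' gr' d' J γ' := by
  obtain ⟨π, hπ⟩ := exists_isGradingProj hgr'
  have lift : ∀ y ∈ J ⊓ evenPart gr', ∃ x ∈ I ⊓ evenPart gr, f x = y := fun _ hy =>
    hπ.exists_mem_inf_evenPart_map_eq hJ.homogeneous hf_inf hy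
  constructor
  case isDGIdeal => exact hJ
  case gamma_smul =>
    intro n b hb y hy
    obtain ⟨x, hx, rfl⟩ := lift y hy
    obtain ⟨a, ha, rfl⟩ := exists_mem_evenPart_map_eq hf_gr hb
    have hax : mul a x ∈ I ⊓ evenPart gr :=
      ⟨hγ.isDGIdeal.mul_mem_left a x hx.1, hA.mul_mem_evenPart ha hx.2⟩
    rw [← hf.map_mul, hγ' n _ hax, hγ' n x hx, ← hf.map_npow, ← hf.map_mul,
      hγ.gamma_smul n a ha x hx]
  case gamma_deg =>
    intro n r hr y hy
    obtain ⟨x, hx, rfl⟩ := hf_inf r y hy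
    rw [hγ' n x ⟨hx.1, mem_evenPart_of_mem hr hx.2⟩]
    exact hf.map_mem _ _ (hγ.gamma_deg n r hr x hx)
  case gamma_odd =>
    intro n hn i j hi hj b hb y hy
    obtain ⟨x, hx, rfl⟩ := hf_inf j y hy
    obtain ⟨a, ha, rfl⟩ := hf_gr i b hb
    have hax : mul a x ∈ I ⊓ evenPart gr := ⟨hγ.isDGIdeal.mul_mem_left a x hx.1,
      mem_evenPart_of_mem (hi.add_odd hj) (hA.mul_mem i j a ha x hx.2)⟩
    rw [← hf.map_mul, hγ' n _ hax, hγ.gamma_odd n hn i j hi hj a ha x hx, map_zero]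
  case gamma_add =>
    intro n y hy y' hy'
    obtain ⟨x, hx, rfl⟩ := lift y hy
    obtain ⟨x', hx', rfl⟩ := lift y' hy'
    rw [← map_add, hγ' n _ (add_mem hx hx'), hγ.gamma_add n x hx x' hx', map_sum]
    exact Finset.sum_congr rfl fun i _ => by rw [hf.map_mul, hγ' i x hx, hγ' (n - i) x' hx']
  case gamma_comp =>
    intro p q hq y hy
    obtain ⟨x, hx, rfl⟩ := lift y hy
    rw [hγ' q x hx, hγ' p _ (hγ.gamma_mem q hq x hx), hγ' _ x hx, hγ.gamma_comp p q hq x hx,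
      map_nsmul]
  case gamma_mem =>
    intro n hn y hy
    obtain ⟨x, hx, rfl⟩ := lift y hy
    have hγx := hγ.gamma_mem n hn x hx
    exact hγ' n x hx ▸ ⟨hIJ _ hγx.1, hf.map_mem_evenPart hγx.2⟩
  case gamma_mul =>
    intro n m y hy
    obtain ⟨x, hx, rfl⟩ := lift y hy
    rw [hγ' n x hx, hγ' m x hx, hγ' _ x hx, ← hf.map_mul, hγ.gamma_mul n m x hx, map_nsmul]
  case d_gamma =>
    intro n hn y hy
    obtain ⟨x, hx, rfl⟩ := lift y hy
    rw [hγ' n x hx, hγ' (n - 1) x hx, ← hf.map_d, ← hf.map_d, ← hf.map_mul, hγ.d_gamma n hn x hx]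
  all_goals
    intro y hy
    obtain ⟨x, hx, rfl⟩ := lift y hy
  · rw [hγ' 0 x hx, hγ.gamma_zero x hx, hf.map_one]
  · rw [hγ' 1 x hx, hγ.gamma_one x hx]

end Hom

section Sub

variable {k A : Type*} [CommRing k] [AddCommMonoid A] [Module k A] {mul : A →ₗ[k] A →ₗ[k] A}
  {one : A} {gr : ℤ → Submodule k A} {d : A →ₗ[k] A} {S I : Submodule k A} {γ : ℕ → A → A}

theorem IsDGAlgebra.sub (hA : IsDGAlgebra mul one gr d) (h : IsDGSubalgebra mul one gr d S) :
    IsDGAlgebra h.subMul h.subOne (subGr gr S) h.subD where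
  isInternal := by
    obtain ⟨π, hπ⟩ := exists_isGradingProj hA.isInternal
    exact (hπ.subGr (hπ.le_iSup_inf_iff.1 h.homogeneous)).isInternal
  mul_assoc x y z := Subtype.ext (hA.mul_assoc x y z)
  one_mul x := Subtype.ext (hA.one_mul x)
  mul_one x := Subtype.ext (hA.mul_one x)
  one_mem := hA.one_mem
  mul_mem i j x hx y hy := hA.mul_mem i j x hx y hy
  d_mem i x hx := hA.d_mem i x hx
  d_d x := Subtype.ext (hA.d_d x)
  leibniz i x hx y := Subtype.ext (hA.leibniz i x hx y)

theorem IsStrictlyGradedCommutative.sub (hc : IsStrictlyGradedCommutative mul gr)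
    (h : IsDGSubalgebra mul one gr d S) :
    IsStrictlyGradedCommutative h.subMul (subGr gr S) where
  comm i j x hx y hy := Subtype.ext (hc.comm i j x hx y hy)
  sq_eq_zero i hi x hx := Subtype.ext (hc.sq_eq_zero i hi x hx)

theorem IsGradingProj.comap_le_iSup_inf {π : ℤ → A →ₗ[k] A} (hπ : IsGradingProj gr π)
    (hS : S ≤ ⨆ i, S ⊓ gr i) (hI : I ≤ ⨆ i, I ⊓ gr i) :
    I.comap S.subtype ≤ ⨆ i, I.comap S.subtype ⊓ DGAlg.subGr gr S i :=
  (hπ.subGr (hπ.le_iSup_inf_iff.1 hS)).le_iSup_inf_iff.2 fun i x hx =>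
    hπ.le_iSup_inf_iff.1 hI i x hx

theorem IsConnectedNGrading.sub {w : ℕ → Submodule k A} (hw : IsConnectedNGrading mul one gr d w)
    (hA : IsDGAlgebra mul one gr d) (h : IsDGSubalgebra mul one gr d S)
    (hS : S ≤ ⨆ n, S ⊓ w n) :
    IsConnectedNGrading h.subMul h.subOne (subGr gr S) h.subD (subGr w S) where
  isInternal := by
    obtain ⟨π, hπ⟩ := exists_isGradingProj hw.isInternal
    exact (hπ.subGr (hπ.le_iSup_inf_iff.1 hS)).isInternal
  homogeneous n := by
    obtain ⟨π, hπ⟩ := exists_isGradingProj hA.isInternal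
    exact hπ.comap_le_iSup_inf h.homogeneous (hw.homogeneous n)
  one_mem := hw.one_mem
  mul_mem m n x hx y hy := hw.mul_mem m n x hx y hy
  d_mem n x hx := hw.d_mem n x hx
  smul_one_injective a b hab := hw.smul_one_injective (congrArg Subtype.val hab)
  exists_smul_one x hx := (hw.exists_smul_one x hx).imp fun _ ha => Subtype.ext ha

theorem IsDGIdeal.sub (hI : IsDGIdeal mul gr d I) (hgr : DirectSum.IsInternal gr)
    (h : IsDGSubalgebra mul one gr d S) :
    IsDGIdeal h.subMul (subGr gr S) h.subD (I.comap S.subtype) where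
  homogeneous := by
    obtain ⟨π, hπ⟩ := exists_isGradingProj hgr
    exact hπ.comap_le_iSup_inf h.homogeneous hI.homogeneous
  mul_mem_left a x hx := hI.mul_mem_left a x hx
  mul_mem_right a x hx := hI.mul_mem_right a x hx
  d_mem x hx := hI.d_mem x hx

theorem IsDGSubalgebra.isDGHom_subtype (h : IsDGSubalgebra mul one gr d S) :
    IsDGHom h.subMul h.subOne (subGr gr S) h.subD mul one gr d S.subtype.toAddMonoidHom where
  map_mul _ _ := rfl
  map_one := rfl
  map_mem _ _ hx := hx
  map_d _ := rfl

theorem IsPDStructure.sub {γ' : ℕ → S → S} (hγ : IsPDStructure mul one gr d I γ)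
    (hA : IsDGAlgebra mul one gr d) (h : IsDGSubalgebra mul one gr d S)
    (hγ' : ∀ n, ∀ x ∈ I.comap S.subtype ⊓ evenPart (subGr gr S), (γ' n x : A) = γ n x) :
    IsPDStructure h.subMul h.subOne (subGr gr S) h.subD (I.comap S.subtype) γ' := by
  obtain ⟨π, hπ⟩ := exists_isGradingProj hA.isInternal
  have hid := hγ.isDGIdeal.sub hA.isInternal h
  have mem_even_iff : ∀ {x : S}, x ∈ evenPart (subGr gr S) ↔ (x : A) ∈ evenPart gr :=
    hπ.mem_evenPart_subGr_iff h.homogeneous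
  have mem_inf_iff : ∀ {x : S}, x ∈ I.comap S.subtype ⊓ evenPart (subGr gr S) ↔
      (x : A) ∈ I ⊓ evenPart gr := and_congr Iff.rfl mem_even_iff
  have gamma_mem : ∀ n, 1 ≤ n → ∀ x ∈ I.comap S.subtype ⊓ evenPart (subGr gr S),
      γ' n x ∈ I.comap S.subtype ⊓ evenPart (subGr gr S) := fun n hn x hx => by
    rw [mem_inf_iff, hγ' n x hx]
    exact hγ.gamma_mem n hn x (mem_inf_iff.1 hx)
  refine
    { isDGIdeal := hid
      gamma_mem := gamma_mem
      gamma_zero := fun x hx =>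
        Subtype.ext ((hγ' 0 x hx).trans (hγ.gamma_zero x (mem_inf_iff.1 hx)))
      gamma_one := fun x hx => Subtype.ext ((hγ' 1 x hx).trans (hγ.gamma_one x (mem_inf_iff.1 hx)))
      gamma_mul := fun n m x hx => Subtype.ext ?_
      gamma_smul := fun n a ha x hx => Subtype.ext ?_
      gamma_add := fun n x hx y hy => Subtype.ext ?_
      gamma_comp := fun p q hq x hx => Subtype.ext ?_
      gamma_deg := fun n r hr x hx => ?_
      gamma_odd := fun n hn i j hi hj x hx y hy => Subtype.ext ?_
      d_gamma := fun n hn x hx => Subtype.ext ?_ }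
  · change mul (γ' n x) (γ' m x) = _
    rw [hγ' n x hx, hγ' m x hx, Submodule.coe_smul_of_tower, hγ' _ x hx]
    exact hγ.gamma_mul n m x (mem_inf_iff.1 hx)
  · rw [hγ' n _ ⟨hid.mul_mem_left a x hx.1, (hA.sub h).mul_mem_evenPart ha hx.2⟩]
    change γ n (mul a x) = mul (S.subtype.toAddMonoidHom (npow h.subMul h.subOne a n)) (γ' n x)
    rw [h.isDGHom_subtype.map_npow, hγ' n x hx]
    exact hγ.gamma_smul n a (mem_even_iff.1 ha) x (mem_inf_iff.1 hx)
  · rw [hγ' n _ (add_mem hx hy), AddSubmonoidClass.coe_finsetSum]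
    refine (hγ.gamma_add n x (mem_inf_iff.1 hx) y (mem_inf_iff.1 hy)).trans ?_
    refine Finset.sum_congr rfl fun i _ => ?_
    change _ = mul (γ' i x) (γ' (n - i) y)
    rw [hγ' i x hx, hγ' (n - i) y hy]
  · rw [hγ' p _ (gamma_mem q hq x hx), hγ' q x hx, Submodule.coe_smul_of_tower, hγ' _ x hx]
    exact hγ.gamma_comp p q hq x (mem_inf_iff.1 hx)
  · change (γ' n x : A) ∈ gr (n * r)
    rw [hγ' n x ⟨hx.1, mem_evenPart_of_mem hr hx.2⟩]
    exact hγ.gamma_deg n r hr x hx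
  · rw [hγ' n _ ⟨hid.mul_mem_left x y hy.1,
      mem_evenPart_of_mem (hi.add_odd hj) ((hA.sub h).mul_mem i j x hx y hy.2)⟩]
    exact hγ.gamma_odd n hn i j hi hj x hx y hy
  · change d (γ' n x) = mul (γ' (n - 1) x) (d x)
    rw [hγ' n x hx, hγ' _ x hx]
    exact hγ.d_gamma n hn x (mem_inf_iff.1 hx)

theorem IsPDStructure.exists_restrict (hγ : IsPDStructure mul one gr d I γ)
    (hA : IsDGAlgebra mul one gr d) (h : IsDGSubalgebra mul one gr d S)
    (hγS : ∀ n, ∀ x ∈ I ⊓ evenPart gr, x ∈ S → γ n x ∈ S) :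
    ∃ γ' : ℕ → S → S,
      IsPDStructure h.subMul h.subOne (subGr gr S) h.subD (I.comap S.subtype) γ' ∧
      ∀ n, ∀ x ∈ I.comap S.subtype ⊓ evenPart (subGr gr S), (γ' n x : A) = γ n x := by
  obtain ⟨π, hπ⟩ := exists_isGradingProj hA.isInternal
  have exists_coe_eq : ∀ (n : ℕ) (x : S), ∃ y : S,
      x ∈ I.comap S.subtype ⊓ evenPart (subGr gr S) → (y : A) = γ n x := fun n x => by
    by_cases hx : x ∈ I.comap S.subtype ⊓ evenPart (subGr gr S)
    · exact ⟨⟨γ n x, hγS n x ⟨hx.1, (hπ.mem_evenPart_subGr_iff h.homogeneous).1 hx.2⟩ x.2⟩,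
        fun _ => rfl⟩
    · exact ⟨0, fun hx' => absurd hx' hx⟩
  choose γ' hγ' using exists_coe_eq
  exact ⟨γ', hγ.sub hA h hγ', hγ'⟩

end Sub

end DGAlg

namespace ShuffleAlg

open DGAlg

noncomputable section

variable {k : Type u} [CommRing k] {X : CochainComplex (ModuleCat.{v} k) ℤ}

/-! ### The gradings of the shuffle algebra -/

section PowProj

variable {n : ℕ} {r s : ℤ} {x : ⨂[k]^n (Tot X)}

variable (X) in
/-- The projection of `Tⁿ(X)` onto its part of degree `r`, by way of the decomposition of `Tⁿ(X)`
into the tensor products `X^(i₁) ⊗ ⋯ ⊗ X^(iₙ)`. -/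
def powProj (n : ℕ) (r : ℤ) : (⨂[k]^n (Tot X)) →ₗ[k] (⨂[k]^n (Tot X)) :=
  (PiTensorProduct.ofDirectSumEquiv (R := k) (ι := Fin n) (κ := fun _ => ℤ)
    (M := fun _ i => X.X i)).symm.toLinearMap ∘ₗ
  (DirectSum.toModule k (Fin n → ℤ) _ fun deg => if ∑ i, deg i = r then
    DirectSum.lof k (Fin n → ℤ) (fun deg => ⨂[k] i, X.X (deg i)) deg else 0) ∘ₗ
  (PiTensorProduct.ofDirectSumEquiv (R := k) (ι := Fin n) (κ := fun _ => ℤ)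
    (M := fun _ i => X.X i)).toLinearMap

theorem powProj_tprod {deg : Fin n → ℤ} {a : Fin n → Tot X} (ha : ∀ i, a i ∈ homog X (deg i)) :
    powProj X n r (PiTensorProduct.tprod k a) =
      if ∑ i, deg i = r then PiTensorProduct.tprod k a else 0 := by
  choose x hx using ha
  obtain rfl : (fun i => DirectSum.lof k ℤ (fun i => X.X i) (deg i) (x i)) = a := funext hx
  simp only [powProj, LinearMap.comp_apply, LinearEquiv.coe_coe,
    PiTensorProduct.ofDirectSumEquiv_tprod_lof, DirectSum.toModule_lof]
  split_ifs
  · rw [PiTensorProduct.ofDirectSumEquiv_symm_lof_tprod]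
  · simp

theorem span_tprod_homog (n : ℕ) : Submodule.span k (Set.range
    fun j : Fin n → Σ r : ℤ, homog X r => PiTensorProduct.tprod k fun i => ((j i).2 : Tot X)) = ⊤ :=
  PiTensorProduct.submodule_span_eq_top (g := fun _ (p : Σ r : ℤ, homog X r) => (p.2 : Tot X))
    (fun _ => span_homog)

variable (X) in
theorem isGradingProj_powGr (n : ℕ) : IsGradingProj (powGr X n) (powProj X n) where
  eq_self r x hx := by
    suffices powGr X n r ≤ LinearMap.eqLocus (powProj X n r) LinearMap.id from this hx
    refine powGr_le fun deg a ha hr => ?_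
    rw [LinearMap.mem_eqLocus, powProj_tprod ha, if_pos hr, LinearMap.id_apply]
  eq_zero r s hrs x hx := by
    suffices powGr X n s ≤ LinearMap.ker (powProj X n r) from this hx
    refine powGr_le fun deg a ha hs => ?_
    rw [LinearMap.mem_ker, powProj_tprod ha, if_neg fun hr => hrs (hr.symm.trans hs)]
  iSup_eq_top := by
    rw [eq_top_iff, ← span_tprod_homog n, Submodule.span_le]
    rintro _ ⟨j, rfl⟩
    exact Submodule.mem_iSup_of_mem _ (tprod_mem_powGr fun i => (j i).2.2)

end PowProj

variable (X) in
/-- The component of tensor degree `n`. -/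
abbrev comp (n : ℕ) : T X →ₗ[k] (⨂[k]^n (Tot X)) :=
  DirectSum.component k ℕ (fun n => ⨂[k]^n (Tot X)) n

theorem comp_incl (n : ℕ) (x : ⨂[k]^n (Tot X)) : comp X n (incl X n x) = x :=
  DirectSum.component.lof_self k (M := fun n => ⨂[k]^n (Tot X)) n x

theorem comp_incl_of_ne {m n : ℕ} (h : m ≠ n) (x : ⨂[k]^m (Tot X)) :
    comp X n (incl X m x) = 0 := by
  rw [DirectSum.component.of, dif_neg h]

theorem ext_comp {x y : T X} (h : ∀ n, comp X n x = comp X n y) : x = y := DFinsupp.ext h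

theorem incl_injective (n : ℕ) : Function.Injective (incl X n) :=
  Function.LeftInverse.injective (comp_incl n)

theorem exists_eq_sum_incl (x : T X) : ∃ s : Finset ℕ, x = ∑ n ∈ s, incl X n (comp X n x) := by
  classical
  exact ⟨DFinsupp.support x, (DirectSum.sum_support_of x).symm⟩

@[elab_as_elim]
theorem incl_induction {p : T X → Prop} (x : T X) (zero : p 0)
    (incl : ∀ n (x : ⨂[k]^n (Tot X)), p (incl X n x))
    (add : ∀ x y, p x → p y → p (x + y)) : p x :=
  DirectSum.induction_on x zero incl add

theorem mem_gr_iff {r : ℤ} {x : T X} : x ∈ gr X r ↔ ∀ n, comp X n x ∈ powGr X n r := by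
  simp [gr, Submodule.mem_iInf]

theorem incl_mem_gr {n : ℕ} {r : ℤ} {x : ⨂[k]^n (Tot X)} (hx : x ∈ powGr X n r) :
    incl X n x ∈ gr X r := by
  refine mem_gr_iff.2 fun m => ?_
  obtain rfl | hnm := eq_or_ne n m
  · rwa [comp_incl]
  · exact comp_incl_of_ne hnm x ▸ zero_mem _

theorem gr_le {r : ℤ} {N : Submodule k (T X)} (h : ∀ n, ∀ x ∈ powGr X n r, incl X n x ∈ N) :
    gr X r ≤ N := by
  intro x hx
  obtain ⟨s, hs⟩ := exists_eq_sum_incl x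
  rw [hs]
  exact Submodule.sum_mem _ fun n _ => h n _ (mem_gr_iff.1 hx n)

variable (X) in
/-- The projection of `T(X)` onto its part of degree `r`. -/
def grProj (r : ℤ) : T X →ₗ[k] T X := DirectSum.lmap fun n => powProj X n r

theorem comp_grProj (n : ℕ) (r : ℤ) (x : T X) :
    comp X n (grProj X r x) = powProj X n r (comp X n x) := rfl

variable (X) in
theorem isGradingProj_gr : IsGradingProj (gr X) (grProj X) where
  eq_self r x hx := ext_comp fun n => (isGradingProj_powGr X n).eq_self r _ (mem_gr_iff.1 hx n)
  eq_zero r s hrs x hx := ext_comp fun n =>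
    (isGradingProj_powGr X n).eq_zero r s hrs _ (mem_gr_iff.1 hx n)
  iSup_eq_top := by
    refine eq_top_iff.2 fun x _ => incl_induction x (zero_mem _) (fun n x => ?_)
      fun _ _ => add_mem
    suffices ⨆ r, powGr X n r ≤ (⨆ r, gr X r).comap (incl X n) from
      this ((isGradingProj_powGr X n).iSup_eq_top ▸ Submodule.mem_top)
    exact iSup_le fun r x hx => Submodule.mem_iSup_of_mem r (incl_mem_gr hx)

variable (X) in
theorem isGradingProj_tensorGr : IsGradingProj (tensorGr X) fun n => incl X n ∘ₗ comp X n where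
  eq_self n := by
    rintro _ ⟨x, rfl⟩
    rw [LinearMap.comp_apply, comp_incl]
  eq_zero m n hmn := by
    rintro _ ⟨x, rfl⟩
    rw [LinearMap.comp_apply, comp_incl_of_ne hmn.symm, map_zero]
  iSup_eq_top := eq_top_iff.2 fun x _ => incl_induction x (zero_mem _)
    (fun n x => Submodule.mem_iSup_of_mem n ⟨x, rfl⟩) fun _ _ => add_mem

/-! ### The dg algebra structure -/

theorem shuffle_assoc (x y z : T X) :
    shuffle X (shuffle X x y) z = shuffle X x (shuffle X y z) := by
  induction x using incl_induction with
  | zero => simp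
  | add x x' hx hx' => simp only [map_add, LinearMap.add_apply, hx, hx']
  | incl l x =>
    induction y using incl_induction with
    | zero => simp
    | add y y' hy hy' => simp only [map_add, LinearMap.add_apply, hy, hy']
    | incl m y =>
      induction z using incl_induction with
      | zero => simp
      | add z z' hz hz' => simp only [map_add, hz, hz']
      | incl n z => exact shuffle_assoc_incl x y z

theorem one_shuffle (x : T X) : shuffle X (one X) x = x := by
  induction x using incl_induction with
  | zero => rw [map_zero]
  | add x y hx hy => rw [map_add, hx, hy]
  | incl n x =>
    have side_eq : ∀ i j : Fin (0 + n), () = () ↔ side 0 n i = side 0 n j := fun i j => by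
      induction i using Fin.addCases with
      | left i => exact i.elim0
      | right i =>
        induction j using Fin.addCases with
        | left j => exact j.elim0
        | right j => exact iff_of_true rfl ((side_natAdd i).trans (side_natAdd j).symm)
    rw [one, shuffle_incl_incl, ← shuffleSum_cast (g := fun _ : Fin n => ()) (zero_add n) side_eq,
      one_conc, ← incl_eq_shuffleSum]

theorem shuffle_one (x : T X) : shuffle X x (one X) = x := by
  induction x using incl_induction with
  | zero => rw [map_zero, LinearMap.zero_apply]
  | add x y hx hy => rw [map_add, LinearMap.add_apply, hx, hy]
  | incl n x =>
    have side_eq : ∀ i j : Fin (n + 0), () = () ↔ side n 0 i = side n 0 j := fun i j => by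
      induction i using Fin.addCases with
      | right i => exact i.elim0
      | left i =>
        induction j using Fin.addCases with
        | right j => exact j.elim0
        | left j => exact iff_of_true rfl ((side_castAdd i).trans (side_castAdd j).symm)
    rw [one, shuffle_incl_incl, ← shuffleSum_cast (g := fun _ : Fin n => ()) (add_zero n) side_eq,
      conc_one, ← incl_eq_shuffleSum]

theorem one_mem_gr : one X ∈ gr X 0 :=
  incl_mem_gr (by simpa using tprod_mem_powGr (X := X) (deg := Fin.elim0) (a := Fin.elim0) nofun)

theorem shuffleSum_mem_gr {n : ℕ} {L : Type*} (f : Fin n → L) {r : ℤ} {x : ⨂[k]^n (Tot X)}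
    (hx : x ∈ powGr X n r) : shuffleSum f x ∈ gr X r := by
  rw [shuffleSum_apply]
  exact Submodule.sum_mem _ fun _ _ => incl_mem_gr (bijAct_mem_powGr _ hx)

theorem shuffleSum_mem_tensorGr {n : ℕ} {L : Type*} (f : Fin n → L) (x : ⨂[k]^n (Tot X)) :
    shuffleSum f x ∈ tensorGr X n := by
  rw [shuffleSum_apply]
  exact Submodule.sum_mem _ fun _ _ => ⟨_, rfl⟩

theorem shuffle_mem_gr {i j : ℤ} {x y : T X} (hx : x ∈ gr X i) (hy : y ∈ gr X j) :
    shuffle X x y ∈ gr X (i + j) := by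
  suffices gr X i ≤ (gr X (i + j)).comap ((shuffle X).flip y) from this hx
  refine gr_le fun m x hx => ?_
  suffices gr X j ≤ (gr X (i + j)).comap (shuffle X (incl X m x)) from this hy
  refine gr_le fun n y hy => ?_
  rw [Submodule.mem_comap, shuffle_incl_incl]
  exact shuffleSum_mem_gr _ (conc_mem_powGr hx hy)

theorem leibniz {i : ℤ} {x : T X} (hx : x ∈ gr X i) (y : T X) :
    d X (shuffle X x y) = shuffle X (d X x) y +
      paritySign k (i : ZMod 2) • shuffle X x (d X y) := by
  suffices gr X i ≤ LinearMap.eqLocus (d X ∘ₗ (shuffle X).flip y)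
    ((shuffle X).flip y ∘ₗ d X + paritySign k (i : ZMod 2) • (shuffle X).flip (d X y)) from this hx
  refine gr_le fun m x hx => ?_
  simp only [LinearMap.mem_eqLocus, LinearMap.comp_apply, LinearMap.add_apply,
    LinearMap.smul_apply, LinearMap.flip_apply]
  induction y using incl_induction with
  | zero => simp
  | add y y' hy hy' =>
    simp only [map_add, hy, hy', smul_add]
    abel
  | incl n y => exact leibniz_incl hx y

variable (X) in
theorem isDGAlgebra : IsDGAlgebra (shuffle X) (one X) (gr X) (d X) where
  isInternal := (isGradingProj_gr X).isInternal
  mul_assoc := shuffle_assoc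
  one_mul := one_shuffle
  mul_one := shuffle_one
  one_mem := one_mem_gr
  mul_mem _ _ _ hx _ hy := shuffle_mem_gr hx hy
  d_mem _ _ hx := mem_gr_iff.2 fun n => powD_mem_powGr (mem_gr_iff.1 hx n)
  d_d _ := ext_comp fun _ => powD_powD _
  leibniz _ _ hx y := negOnePow_eq_paritySign (R := k) _ ▸ leibniz hx y

theorem shuffle_comm {i j : ℤ} {x y : T X} (hx : x ∈ gr X i) (hy : y ∈ gr X j) :
    shuffle X x y = paritySign k ((i * j : ℤ) : ZMod 2) • shuffle X y x := by
  suffices gr X i ≤ LinearMap.eqLocus ((shuffle X).flip y)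
    (paritySign k ((i * j : ℤ) : ZMod 2) • shuffle X y) from this hx
  refine gr_le fun m x hx => ?_
  suffices gr X j ≤ LinearMap.eqLocus (shuffle X (incl X m x))
    (paritySign k ((i * j : ℤ) : ZMod 2) • (shuffle X).flip (incl X m x)) from this hy
  exact gr_le fun n y hy => shuffle_comm_incl hx hy

theorem shuffle_self {i : ℤ} (hi : Odd i) {x : T X} (hx : x ∈ gr X i) : shuffle X x x = 0 := by
  obtain ⟨s, hs⟩ := exists_eq_sum_incl x
  have incl_comp_mem : ∀ n, incl X n (comp X n x) ∈ gr X i :=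
    fun n => incl_mem_gr (mem_gr_iff.1 hx n)
  rw [hs]
  clear hs
  induction s using Finset.induction_on with
  | empty => simp
  | insert n s hn ih =>
    rw [Finset.sum_insert hn]
    simp only [map_add, LinearMap.add_apply]
    rw [ih, shuffle_self_incl hi (mem_gr_iff.1 hx n), zero_add, add_zero,
      shuffle_comm (incl_comp_mem n) (Submodule.sum_mem _ fun m _ => incl_comp_mem m),
      ZMod.intCast_eq_one_iff_odd.2 (hi.mul hi), paritySign_one, add_neg_one_smul]

variable (X) in
theorem isStrictlyGradedCommutative : IsStrictlyGradedCommutative (shuffle X) (gr X) where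
  comm _ _ _ hx _ hy := negOnePow_eq_paritySign (R := k) _ ▸ shuffle_comm hx hy
  sq_eq_zero _ hi _ hx := shuffle_self hi hx

variable (X) in
theorem isConnectedNGrading :
    IsConnectedNGrading (shuffle X) (one X) (gr X) (d X) (tensorGr X) where
  isInternal := (isGradingProj_tensorGr X).isInternal
  homogeneous n := (isGradingProj_gr X).le_iSup_inf_iff.2 fun r => by
    rintro _ ⟨x, rfl⟩
    exact ⟨powProj X n r x, (DirectSum.lmap_lof (fun n => powProj X n r) n x).symm⟩
  one_mem := ⟨_, rfl⟩
  mul_mem m n := by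
    rintro _ ⟨x, rfl⟩ _ ⟨y, rfl⟩
    exact shuffle_incl_incl x y ▸ shuffleSum_mem_tensorGr _ _
  d_mem n := by
    rintro _ ⟨x, rfl⟩
    exact ⟨powD X n x, (d_incl x).symm⟩
  smul_one_injective a b hab := by
    simp only [one, ← map_smul] at hab
    refine (TensorPower.algebraMap₀ (R := k) (M := Tot X)).injective ?_
    rw [TensorPower.algebraMap₀_eq_smul_one, TensorPower.algebraMap₀_eq_smul_one]
    exact incl_injective 0 hab
  exists_smul_one := by
    rintro _ ⟨x, rfl⟩
    obtain ⟨a, rfl⟩ := (TensorPower.algebraMap₀ (R := k) (M := Tot X)).surjective x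
    refine ⟨a, ?_⟩
    rw [TensorPower.algebraMap₀_eq_smul_one, map_smul]
    rfl

/-! ### Block shuffles -/

section BlockShuffle

variable {n p : ℕ}

theorem divNat_finProdFinEquiv (a : Fin n) (b : Fin p) : (finProdFinEquiv (a, b)).divNat = a :=
  congrArg Prod.fst (finProdFinEquiv.symm_apply_apply (a, b))

theorem modNat_finProdFinEquiv (a : Fin n) (b : Fin p) : (finProdFinEquiv (a, b)).modNat = b :=
  congrArg Prod.snd (finProdFinEquiv.symm_apply_apply (a, b))

theorem finProdFinEquiv_lt_iff {a a' : Fin n} {b b' : Fin p} :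
    finProdFinEquiv (a, b) < finProdFinEquiv (a', b') ↔ a < a' ∨ a = a' ∧ b < b' := by
  have lt_of_lt : ∀ {a a' : Fin n} (b b' : Fin p), a < a' →
      finProdFinEquiv (a, b) < finProdFinEquiv (a', b') := fun {a a'} b b' h => by
    have hle : p * (a + 1 : ℕ) ≤ p * a' := Nat.mul_le_mul_left p h
    simp only [Fin.lt_def, finProdFinEquiv_apply_val]
    rw [Nat.mul_succ] at hle
    omega
  rcases lt_trichotomy a a' with h | rfl | h
  · exact iff_of_true (lt_of_lt b b' h) (Or.inl h)
  · simp only [Fin.lt_def, finProdFinEquiv_apply_val]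
    simp
  · exact iff_of_false (lt_of_lt b' b h).not_gt (by simp [h.not_gt, h.ne'])

/-- The permutation of `n` consecutive blocks of size `p` which moves them by `π`. -/
def blockPerm (p : ℕ) (π : Equiv.Perm (Fin n)) : Equiv.Perm (Fin (n * p)) :=
  finProdFinEquiv.symm.trans ((π.prodCongr (Equiv.refl (Fin p))).trans finProdFinEquiv)

theorem blockPerm_finProdFinEquiv (π : Equiv.Perm (Fin n)) (a : Fin n) (b : Fin p) :
    blockPerm p π (finProdFinEquiv (a, b)) = finProdFinEquiv (π a, b) := by
  simp [blockPerm]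

theorem blockPerm_symm (π : Equiv.Perm (Fin n)) : (blockPerm p π).symm = blockPerm p π.symm := rfl

theorem fiberMono_divNat_iff {ι : Type*} [LinearOrder ι] {σ : Fin (n * p) ≃ ι} :
    FiberMono Fin.divNat σ ↔
      ∀ a : Fin n, StrictMono fun b : Fin p => σ (finProdFinEquiv (a, b)) := by
  constructor
  · intro h a b b' hb
    refine h _ _ (finProdFinEquiv_lt_iff.2 (Or.inr ⟨rfl, hb⟩)) ?_
    rw [divNat_finProdFinEquiv, divNat_finProdFinEquiv]
  · intro h i j hij hf
    obtain ⟨⟨a, b⟩, rfl⟩ := finProdFinEquiv.surjective i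
    obtain ⟨⟨a', b'⟩, rfl⟩ := finProdFinEquiv.surjective j
    obtain rfl : a = a' := by rwa [divNat_finProdFinEquiv, divNat_finProdFinEquiv] at hf
    exact h a (by simpa [finProdFinEquiv_lt_iff] using hij)

theorem fiberMono_divNat_mul_blockPerm {σ : Equiv.Perm (Fin (n * p))}
    (hσ : FiberMono Fin.divNat σ) (π : Equiv.Perm (Fin n)) :
    FiberMono Fin.divNat (σ * blockPerm p π) := by
  rw [fiberMono_divNat_iff] at hσ ⊢
  intro a
  simpa only [Equiv.Perm.mul_apply, blockPerm_finProdFinEquiv] using hσ (π a)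

theorem isBlockShuffle_iff {b : Fin p} (hb : (b : ℕ) + 1 = p) {σ : Equiv.Perm (Fin (n * p))} :
    IsBlockShuffle n p σ ↔
      FiberMono Fin.divNat σ ∧ StrictMono fun a : Fin n => σ (finProdFinEquiv (a, b)) := by
  rw [fiberMono_divNat_iff, IsBlockShuffle]
  refine and_congr_right fun _ => ⟨fun h => h b hb, fun h b' hb' => ?_⟩
  obtain rfl : b' = b := Fin.ext (by omega)
  exact h

/-- Sorting the blocks by their last elements turns a permutation which is increasing on the blocks
into a block shuffle. -/
theorem exists_isBlockShuffle_mul (hp : 1 ≤ p) {τ : Equiv.Perm (Fin (n * p))}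
    (hτ : FiberMono Fin.divNat τ) :
    ∃ (σ : Equiv.Perm (Fin (n * p))) (π : Equiv.Perm (Fin n)),
      IsBlockShuffle n p σ ∧ σ * blockPerm p π = τ := by
  let last : Fin p := ⟨p - 1, by omega⟩
  let imageLast : Fin n → Fin (n * p) := fun a => τ (finProdFinEquiv (a, last))
  have imageLast_injective : Function.Injective imageLast :=
    fun a a' h => by simpa using τ.injective h
  let ρ := Tuple.sort imageLast
  refine ⟨τ * blockPerm p ρ, ρ⁻¹, (isBlockShuffle_iff (b := last) (by simp only [last]; omega)).2
    ⟨fiberMono_divNat_mul_blockPerm hτ ρ, ?_⟩, ?_⟩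
  · simp only [Equiv.Perm.mul_apply, blockPerm_finProdFinEquiv]
    exact (Tuple.monotone_sort imageLast).strictMono_of_injective
      (imageLast_injective.comp ρ.injective)
  · exact mul_inv_cancel_right τ (blockPerm p ρ)

theorem IsBlockShuffle.mul_blockPerm_inj (hp : 1 ≤ p) {σ σ' : Equiv.Perm (Fin (n * p))}
    {π π' : Equiv.Perm (Fin n)} (hσ : IsBlockShuffle n p σ) (hσ' : IsBlockShuffle n p σ') :
    σ * blockPerm p π = σ' * blockPerm p π' ↔ σ = σ' ∧ π = π' := by
  refine ⟨fun h => ?_, fun h => by rw [h.1, h.2]⟩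
  have apply_eq : ∀ a b, σ (finProdFinEquiv (a, b)) = σ' (finProdFinEquiv ((π' * π⁻¹) a, b)) :=
    fun a b => by simpa [blockPerm_finProdFinEquiv] using
      Equiv.congr_fun h (finProdFinEquiv (π⁻¹ a, b))
  let last : Fin p := ⟨p - 1, by omega⟩
  have last_add_one : (last : ℕ) + 1 = p := by simp only [last]; omega
  have mul_inv_strictMono : StrictMono (π' * π⁻¹) := fun a a' ha => by
    rw [← (hσ'.2 last last_add_one).lt_iff_lt, ← apply_eq, ← apply_eq]
    exact hσ.2 last last_add_one ha
  have mul_inv_eq_one : π' * π⁻¹ = 1 :=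
    FiberMono.eq_one (f := fun _ => ()) (fun _ _ h _ => mul_inv_strictMono h) fun _ => rfl
  obtain rfl : π' = π := _root_.mul_inv_eq_one.1 mul_inv_eq_one
  exact ⟨mul_right_cancel h, rfl⟩

open Classical in
theorem sum_fiberMono_divNat (hp : 1 ≤ p) {A : Type*} [AddCommMonoid A]
    (F : Equiv.Perm (Fin (n * p)) → A) :
    ∑ τ : Equiv.Perm (Fin (n * p)) with FiberMono Fin.divNat τ, F τ =
      ∑ π : Equiv.Perm (Fin n), ∑ σ : Equiv.Perm (Fin (n * p)) with IsBlockShuffle n p σ,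
        F (σ * blockPerm p π) := by
  rw [← Finset.sum_product']
  refine (Finset.sum_bij (fun q _ => q.2 * blockPerm p q.1) ?_ ?_ ?_ fun _ _ => rfl).symm
  · rintro ⟨π, σ⟩ h
    simp only [Finset.mem_product, Finset.mem_filter, Finset.mem_univ, true_and] at h ⊢
    exact fiberMono_divNat_mul_blockPerm (fiberMono_divNat_iff.2 h.1) π
  · rintro ⟨π, σ⟩ hσ ⟨π', σ'⟩ hσ' heq
    simp only [Finset.mem_product, Finset.mem_filter, Finset.mem_univ, true_and] at hσ hσ'
    obtain ⟨hσσ', hππ'⟩ := (hσ.mul_blockPerm_inj hp hσ').1 heq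
    exact Prod.ext hππ' hσσ'
  · intro τ hτ
    simp only [Finset.mem_filter, Finset.mem_univ, true_and] at hτ
    obtain ⟨σ, π, hσ, rfl⟩ := exists_isBlockShuffle_mul hp hτ
    exact ⟨(π, σ), by simpa using hσ, rfl⟩

theorem inversionSum_blockPerm (π : Equiv.Perm (Fin n)) {e : Fin n → Fin p → ZMod 2}
    (he : ∀ a, ∑ b, e a b = 0) :
    inversionSum (blockPerm p π) (fun i => e i.divNat i.modNat) = 0 := by
  rw [inversionSum, ← finProdFinEquiv.sum_comp, Fintype.sum_prod_type]
  refine Finset.sum_eq_zero fun a _ => ?_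
  simp only [← finProdFinEquiv.sum_comp (fun _ : Fin (n * p) => _), Fintype.sum_prod_type,
    divNat_finProdFinEquiv, modNat_finProdFinEquiv, blockPerm_finProdFinEquiv,
    finProdFinEquiv_lt_iff]
  rw [Finset.sum_comm]
  refine Finset.sum_eq_zero fun a' _ => ?_
  have inverted_iff : ∀ b b' : Fin p,
      ((a < a' ∨ a = a' ∧ b < b') ∧ (π a' < π a ∨ π a' = π a ∧ b' < b)) ↔
        (a < a' ∧ π a' < π a) := by
    grind [π.injective]
  simp only [inverted_iff]
  split_ifs
  · rw [← Finset.sum_mul_sum, he, zero_mul]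
  · simp

theorem divNat_cast_castAdd (i : Fin (n * p)) :
    (Fin.cast (Nat.succ_mul n p).symm (Fin.castAdd p i)).divNat = i.divNat.castSucc := rfl

theorem modNat_cast_castAdd (i : Fin (n * p)) :
    (Fin.cast (Nat.succ_mul n p).symm (Fin.castAdd p i)).modNat = i.modNat := rfl

theorem divNat_cast_natAdd (i : Fin p) :
    (Fin.cast (Nat.succ_mul n p).symm (Fin.natAdd (n * p) i)).divNat = Fin.last n := by
  refine Fin.ext ?_
  change (n * p + i) / p = n
  rw [Nat.mul_comm, Nat.mul_add_div i.pos, Nat.div_eq_of_lt i.2, add_zero]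

theorem modNat_cast_natAdd (i : Fin p) :
    (Fin.cast (Nat.succ_mul n p).symm (Fin.natAdd (n * p) i)).modNat = i := by
  refine Fin.ext ?_
  change (n * p + i) % p = i
  rw [Nat.mul_comm, Nat.mul_add_mod, Nat.mod_eq_of_lt i.2]

end BlockShuffle

/-! ### Powers of tensors -/

variable {k : Type u} [CommRing k] {X : CochainComplex (ModuleCat.{v} k) ℤ} {p : ℕ}

theorem cast_eq_of_mk_eq {m n : ℕ} {x : ⨂[k]^m (Tot X)} {y : ⨂[k]^n (Tot X)}
    (h : GradedMonoid.mk (A := fun n => ⨂[k]^n (Tot X)) m x = GradedMonoid.mk n y) (hmn : m = n) :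
    TensorPower.cast k (Tot X) hmn x = y := by
  cases h
  simp

theorem tensorPow_zero (x : ⨂[k]^p (Tot X)) :
    TensorPower.cast k (Tot X) (zero_mul p) (tensorPow X 0 x) =
      PiTensorProduct.tprod k Fin.elim0 :=
  cast_eq_of_mk_eq (GradedMonoid.GMonoid.gnpow_zero'
    (A := fun n => ⨂[k]^n (Tot X)) (GradedMonoid.mk p x)) _

theorem tensorPow_succ (n : ℕ) (x : ⨂[k]^p (Tot X)) :
    TensorPower.cast k (Tot X) (Nat.succ_mul n p) (tensorPow X (n + 1) x) =
      conc X (n * p) p (tensorPow X n x) x :=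
  cast_eq_of_mk_eq (GradedMonoid.GMonoid.gnpow_succ'
    (A := fun n => ⨂[k]^n (Tot X)) n (GradedMonoid.mk p x)) _

theorem tensorPow_sum_smul_tprod (n : ℕ) {ι : Type*} [Fintype ι] (a : ι → k)
    (x : ι → Fin p → Tot X) :
    tensorPow X n (∑ s, a s • PiTensorProduct.tprod k (x s)) =
      ∑ c : Fin n → ι, (∏ i, a (c i)) •
        PiTensorProduct.tprod k fun i : Fin (n * p) => x (c i.divNat) i.modNat := by
  induction n with
  | zero =>
    refine (TensorPower.cast k (Tot X) (zero_mul p)).injective ?_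
    rw [tensorPow_zero, Fintype.sum_unique, Finset.univ_eq_empty, Finset.prod_empty, one_smul,
      TensorPower.cast_tprod]
    congr 1
    exact funext nofun
  | succ n ih =>
    refine (TensorPower.cast k (Tot X) (Nat.succ_mul n p)).injective ?_
    rw [tensorPow_succ, ih, map_sum, ← (Fin.snocEquiv fun _ : Fin (n + 1) => ι).sum_comp,
      Fintype.sum_prod_type]
    simp only [map_sum, LinearMap.sum_apply]
    refine Finset.sum_congr rfl fun s _ => Finset.sum_congr rfl fun c _ => ?_
    rw [map_smul, map_smul, map_smul, LinearMap.smul_apply, smul_smul, conc_tprod,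
      TensorPower.cast_tprod, Fin.prod_univ_castSucc]
    simp only [Fin.snocEquiv_apply, Fin.snoc_castSucc, Fin.snoc_last]
    rw [mul_comm (a s)]
    congr 2
    funext i
    induction i using Fin.addCases with
    | left i =>
      rw [Fin.append_left, Function.comp_apply, divNat_cast_castAdd, modNat_cast_castAdd,
        Fin.snoc_castSucc]
    | right i =>
      rw [Fin.append_right, Function.comp_apply, divNat_cast_natAdd, modNat_cast_natAdd,
        Fin.snoc_last]

theorem exists_eq_sum_smul_tprod_of_mem_evenPart {x : ⨂[k]^p (Tot X)}
    (hx : x ∈ evenPart (powGr X p)) :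
    ∃ (N : ℕ) (a : Fin N → k) (deg : Fin N → Fin p → ℤ) (y : Fin N → Fin p → Tot X),
      (∀ s i, y s i ∈ homog X (deg s i)) ∧ (∀ s, Even (∑ i, deg s i)) ∧
        x = ∑ s, a s • PiTensorProduct.tprod k (y s) := by
  have mem_span : evenPart (powGr X p) ≤ Submodule.span k {t | ∃ (deg : Fin p → ℤ)
      (y : Fin p → Tot X), (∀ i, y i ∈ homog X (deg i)) ∧ Even (∑ i, deg i) ∧
        PiTensorProduct.tprod k y = t} :=
    evenPart_le fun r hr => powGr_le fun deg y hy hdeg =>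
      Submodule.subset_span ⟨deg, y, hy, hdeg ▸ hr, rfl⟩
  obtain ⟨N, a, t, rfl⟩ := Submodule.mem_span_set'.1 (mem_span hx)
  choose deg y hy hdeg ht using fun s => (t s).2
  exact ⟨N, a, deg, y, hy, hdeg, by simp only [ht]⟩

/-- Blocks of even degree commute without a sign, so a permutation of equal such blocks has no
effect. -/
theorem bijAct_blockPerm_tensorPow {n : ℕ} (π : Equiv.Perm (Fin n)) {x : ⨂[k]^p (Tot X)}
    (hx : x ∈ evenPart (powGr X p)) :
    bijAct X (blockPerm p π) (tensorPow X n x) = tensorPow X n x := by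
  obtain ⟨N, a, deg, y, hy, hdeg, rfl⟩ := exists_eq_sum_smul_tprod_of_mem_evenPart hx
  rw [tensorPow_sum_smul_tprod, map_sum]
  refine Fintype.sum_equiv (π.arrowCongr (Equiv.refl (Fin N))) _ _ fun c => ?_
  have block_parity : ∀ b, ∑ i, (deg (c b) i : ZMod 2) = 0 := fun b => by
    rw [← Int.cast_sum, ZMod.intCast_eq_zero_iff_even]
    exact hdeg (c b)
  rw [map_smul, bijAct_tprod (deg := fun i => deg (c i.divNat) i.modNat) _
      fun i => hy (c i.divNat) i.modNat,
    inversionSum_blockPerm π block_parity, paritySign_zero, one_smul]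
  congr 1
  · exact (π.symm.prod_comp fun i => a (c i)).symm
  · congr 1
    funext i
    obtain ⟨⟨b, j⟩, rfl⟩ := finProdFinEquiv.surjective i
    simp only [Function.comp_apply, blockPerm_symm, blockPerm_finProdFinEquiv,
      divNat_finProdFinEquiv, modNat_finProdFinEquiv]
    rfl

theorem shuffleSum_divNat_tensorPow (hp : 1 ≤ p) {n : ℕ} {x : ⨂[k]^p (Tot X)}
    (hx : x ∈ evenPart (powGr X p)) :
    shuffleSum (Fin.divNat : Fin (n * p) → Fin n) (tensorPow X n x) =
      n ! • incl X (n * p) (powGamma X n x) := by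
  classical
  rw [shuffleSum_apply, sum_fiberMono_divNat hp]
  simp only [bijAct_mul, bijAct_blockPerm_tensorPow _ hx, Finset.sum_const, Finset.card_univ,
    Fintype.card_perm, Fintype.card_fin, powGamma, map_sum, permAct_eq_bijAct]

theorem npow_incl (x : ⨂[k]^p (Tot X)) (n : ℕ) :
    npow (shuffle X) (one X) (incl X p x) n =
      shuffleSum (Fin.divNat : Fin (n * p) → Fin n) (tensorPow X n x) := by
  induction n with
  | zero =>
    rw [← shuffleSum_cast (g := fun _ : Fin 0 => ()) (zero_mul p)
      fun i => (Fin.cast (zero_mul p) i).elim0, tensorPow_zero, ← incl_eq_shuffleSum]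
    rfl
  | succ n ih =>
    rw [(isDGAlgebra X).npow_succ', ih, incl_eq_shuffleSum, shuffle_shuffleSum, ← tensorPow_succ]
    refine shuffleSum_cast _ (fun i j => ?_) _
    obtain ⟨i, rfl⟩ := (finCongr (Nat.succ_mul n p)).symm.surjective i
    obtain ⟨j, rfl⟩ := (finCongr (Nat.succ_mul n p)).symm.surjective j
    simp only [finCongr_symm, finCongr_apply, Fin.cast_cast, Fin.cast_eq_self]
    induction i using Fin.addCases <;> induction j using Fin.addCases <;>
      simp [divNat_cast_castAdd, divNat_cast_natAdd, (Fin.castSucc_ne_last _).symm]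

theorem factorial_smul_incl_powGamma (hp : 1 ≤ p) (n : ℕ) {x : ⨂[k]^p (Tot X)}
    (hx : x ∈ evenPart (powGr X p)) :
    n ! • incl X (n * p) (powGamma X n x) = npow (shuffle X) (one X) (incl X p x) n := by
  rw [npow_incl, shuffleSum_divNat_tensorPow hp hx]

variable {k : Type u} [CommRing k] {X : CochainComplex (ModuleCat.{v} k) ℤ}

theorem comp_mem_evenPart {x : T X} (hx : x ∈ evenPart (gr X)) (n : ℕ) :
    comp X n x ∈ evenPart (powGr X n) := by
  suffices evenPart (gr X) ≤ (evenPart (powGr X n)).comap (comp X n) from this hx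
  exact evenPart_le fun i hi y hy => mem_evenPart_of_mem hi (mem_gr_iff.1 hy n)

theorem incl_mem_evenPart {n : ℕ} {x : ⨂[k]^n (Tot X)} (hx : x ∈ evenPart (powGr X n)) :
    incl X n x ∈ evenPart (gr X) := by
  suffices evenPart (powGr X n) ≤ (evenPart (gr X)).comap (incl X n) from this hx
  exact evenPart_le fun i hi y hy => mem_evenPart_of_mem hi (incl_mem_gr hy)

/-! ### The ideal `T⁺(X)` -/

theorem mem_TPlus_iff {x : T X} : x ∈ TPlus X ↔ comp X 0 x = 0 := Iff.rfl

theorem incl_mem_TPlus {n : ℕ} (hn : n ≠ 0) (x : ⨂[k]^n (Tot X)) : incl X n x ∈ TPlus X :=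
  comp_incl_of_ne hn x

theorem TPlus_le {N : Submodule k (T X)} (h : ∀ n ≠ 0, ∀ x, incl X n x ∈ N) : TPlus X ≤ N := by
  intro x hx
  obtain ⟨s, hs⟩ := exists_eq_sum_incl x
  rw [hs]
  refine Submodule.sum_mem _ fun n _ => ?_
  obtain rfl | hn := eq_or_ne n 0
  · rw [mem_TPlus_iff.1 hx, map_zero]
    exact zero_mem _
  · exact h n hn _

theorem shuffle_incl_mem_TPlus {m n : ℕ} (h : m + n ≠ 0) (x : ⨂[k]^m (Tot X))
    (y : ⨂[k]^n (Tot X)) : shuffle X (incl X m x) (incl X n y) ∈ TPlus X := by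
  obtain ⟨z, hz⟩ := (isConnectedNGrading X).mul_mem m n _ ⟨x, rfl⟩ _ ⟨y, rfl⟩
  exact hz ▸ incl_mem_TPlus h z

variable (X) in
theorem isDGIdeal_TPlus : IsDGIdeal (shuffle X) (gr X) (d X) (TPlus X) where
  homogeneous := (isGradingProj_gr X).le_iSup_inf_iff.2 fun r x hx => by
    rw [mem_TPlus_iff] at hx ⊢
    rw [comp_grProj, hx, map_zero]
  mul_mem_left a x hx := by
    suffices TPlus X ≤ (TPlus X).comap (shuffle X a) from this hx
    refine TPlus_le fun n hn x => ?_
    suffices ⊤ ≤ (TPlus X).comap ((shuffle X).flip (incl X n x)) from this Submodule.mem_top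
    exact fun a _ => incl_induction a (zero_mem _)
      (fun m a => shuffle_incl_mem_TPlus (by omega) a x) fun _ _ => add_mem
  mul_mem_right a x hx := by
    suffices TPlus X ≤ (TPlus X).comap ((shuffle X).flip a) from this hx
    refine TPlus_le fun n hn x => ?_
    suffices ⊤ ≤ (TPlus X).comap (shuffle X (incl X n x)) from this Submodule.mem_top
    exact fun a _ => incl_induction a (zero_mem _)
      (fun m a => shuffle_incl_mem_TPlus (by omega) x a) fun _ _ => add_mem
  d_mem x hx := by
    rw [mem_TPlus_iff] at hx ⊢
    change powD X 0 (comp X 0 x) = 0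
    rw [hx, map_zero]

/-! ### The divided powers -/

theorem incl_powGamma_zero {p : ℕ} (x : ⨂[k]^p (Tot X)) :
    incl X (0 * p) (powGamma X 0 x) = one X := by
  classical
  have : IsEmpty (Fin (0 * p)) := by
    rw [zero_mul]
    infer_instance
  have isBlockShuffle (σ : Equiv.Perm (Fin (0 * p))) : IsBlockShuffle 0 p σ :=
    ⟨nofun, fun _ _ => nofun⟩
  simp only [powGamma, isBlockShuffle, Finset.filter_true, Fintype.sum_unique, permAct_eq_bijAct]
  rw [Subsingleton.elim default 1, bijAct_one, ← lof_cast (zero_mul p), tensorPow_zero]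
  rfl

theorem powGamma_apply_zero {n : ℕ} (hn : n ≠ 0) (p : ℕ) :
    powGamma X n (0 : ⨂[k]^p (Tot X)) = 0 := by
  obtain ⟨n, rfl⟩ := Nat.exists_eq_succ_of_ne_zero hn
  have tensorPow_eq_zero : tensorPow X (n + 1) (0 : ⨂[k]^p (Tot X)) = 0 :=
    (TensorPower.cast k (Tot X) (Nat.succ_mul n p)).injective
      (by rw [tensorPow_succ, map_zero, map_zero])
  rw [powGamma, tensorPow_eq_zero]
  simp

variable (X) in
/-- The divided powers of the sum of the components of `x` of tensor degrees `1, …, N`: the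
formula for the divided powers of a sum, applied to the divided powers `powGamma` of the
components. -/
def truncGamma : ℕ → ℕ → T X → T X
  | 0, n, _ => if n = 0 then one X else 0
  | N + 1, n, x => ∑ i ∈ Finset.range (n + 1), shuffle X (truncGamma N i x)
      (incl X ((n - i) * (N + 1)) (powGamma X (n - i) (comp X (N + 1) x)))

theorem truncGamma_succ_of_comp_eq_zero {N : ℕ} {x : T X} (hx : comp X (N + 1) x = 0) (n : ℕ) :
    truncGamma X (N + 1) n x = truncGamma X N n x := by
  rw [truncGamma, Finset.sum_range_succ, Finset.sum_eq_zero, zero_add, Nat.sub_self,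
    incl_powGamma_zero, shuffle_one]
  intro i hi
  rw [hx, powGamma_apply_zero (Nat.sub_ne_zero_of_lt (Finset.mem_range.1 hi)), map_zero, map_zero]

theorem truncGamma_eq_of_le {N M : ℕ} (hNM : N ≤ M) {x : T X}
    (hx : ∀ m, N < m → m ≤ M → comp X m x = 0) (n : ℕ) :
    truncGamma X M n x = truncGamma X N n x := by
  induction M, hNM using Nat.le_induction with
  | base => rfl
  | succ M hM ih =>
    rw [truncGamma_succ_of_comp_eq_zero (hx _ (by omega) le_rfl),
      ih fun m hm hM => hx m hm (by omega)]

theorem exists_forall_comp_eq_zero (x : T X) : ∃ N, ∀ m, N < m → comp X m x = 0 := by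
  classical
  refine ⟨(DFinsupp.support x).sup id, fun m hm => ?_⟩
  by_contra hne
  exact hm.not_ge (Finset.le_sup (f := id) (DFinsupp.mem_support_iff.2 hne))

variable (X) in
/-- The divided powers on `T⁺(X)`. The component of `x` of tensor degree `0` is ignored. -/
def gamma (n : ℕ) (x : T X) : T X := truncGamma X (exists_forall_comp_eq_zero x).choose n x

theorem gamma_eq_truncGamma {N : ℕ} {x : T X} (hx : ∀ m, N < m → comp X m x = 0) (n : ℕ) :
    gamma X n x = truncGamma X N n x := by
  have hx' := (exists_forall_comp_eq_zero x).choose_spec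
  rw [gamma, ← truncGamma_eq_of_le (le_max_left _ N) fun m hm _ => hx' m hm,
    truncGamma_eq_of_le (le_max_right _ N) fun m hm _ => hx m hm]

theorem gamma_incl (n : ℕ) {p : ℕ} (hp : 1 ≤ p) (x : ⨂[k]^p (Tot X)) :
    gamma X n (incl X p x) = incl X (n * p) (powGamma X n x) := by
  obtain ⟨q, rfl⟩ := Nat.exists_eq_add_of_le' hp
  have truncGamma_eq (i : ℕ) :
      truncGamma X q i (incl X (q + 1) x) = if i = 0 then one X else 0 := by
    rw [truncGamma_eq_of_le q.zero_le fun m _ hm => comp_incl_of_ne (by omega) x, truncGamma]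
  rw [gamma_eq_truncGamma (N := q + 1) fun m hm => comp_incl_of_ne (by omega) x, truncGamma,
    Finset.sum_eq_single_of_mem 0 (by simp), truncGamma_eq, if_pos rfl, one_shuffle, comp_incl,
    Nat.sub_zero]
  intro i _ hi
  rw [truncGamma_eq, if_neg hi, map_zero, LinearMap.zero_apply]

theorem sum_incl_comp_eq {N : ℕ} {x : T X} (hx : x ∈ TPlus X)
    (hN : ∀ m, N < m → comp X m x = 0) :
    ∑ p ∈ Finset.range N, incl X (p + 1) (comp X (p + 1) x) = x := by
  refine ext_comp fun m => ?_
  rw [map_sum]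
  cases m with
  | zero =>
    rw [mem_TPlus_iff.1 hx]
    exact Finset.sum_eq_zero fun p _ => comp_incl_of_ne p.succ_ne_zero _
  | succ m =>
    rw [Finset.sum_eq_single m (fun p _ hp => comp_incl_of_ne (by omega) _) fun hm => ?_, comp_incl]
    rw [comp_incl]
    exact hN _ (by simpa [Nat.lt_succ_iff] using hm)

theorem factorial_smul_truncGamma (N n : ℕ) {x : T X} (hx : x ∈ evenPart (gr X)) :
    n ! • truncGamma X N n x = npow (shuffle X) (one X)
      (∑ p ∈ Finset.range N, incl X (p + 1) (comp X (p + 1) x)) n := by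
  let := (isDGAlgebra X).toSemiring
  induction N generalizing n with
  | zero => cases n <;> simp [truncGamma, DGAlg.npow_zero, DGAlg.npow_succ]
  | succ N ih =>
    have sum_mem_evenPart : ∑ p ∈ Finset.range N, incl X (p + 1) (comp X (p + 1) x) ∈
        evenPart (gr X) :=
      Submodule.sum_mem _ fun p _ => incl_mem_evenPart (comp_mem_evenPart hx (p + 1))
    rw [Finset.sum_range_succ, (isDGAlgebra X).npow_eq_pow]
    refine factorial_smul_sum_mul
      (g := fun i => incl X (i * (N + 1)) (powGamma X i (comp X (N + 1) x)))
      ((isDGAlgebra X).mul_comm_of_mem_evenPart (isStrictlyGradedCommutative X) sum_mem_evenPart _)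
      (fun i => ?_) (fun i => ?_) n
    · rw [ih, (isDGAlgebra X).npow_eq_pow]
    · rw [factorial_smul_incl_powGamma (Nat.le_add_left 1 N) i (comp_mem_evenPart hx (N + 1)),
        (isDGAlgebra X).npow_eq_pow]

theorem factorial_smul_gamma (n : ℕ) {x : T X} (hx : x ∈ TPlus X ⊓ evenPart (gr X)) :
    n ! • gamma X n x = npow (shuffle X) (one X) x n := by
  obtain ⟨N, hN⟩ := exists_forall_comp_eq_zero x
  rw [gamma_eq_truncGamma hN, factorial_smul_truncGamma N n hx.2, sum_incl_comp_eq hx.1 hN]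

theorem isPDStructure_of_isAddTorsionFree [IsAddTorsionFree (T X)] :
    IsPDStructure (shuffle X) (one X) (gr X) (d X) (TPlus X) (gamma X) := by
  refine .of_factorial_smul (isDGAlgebra X) (isStrictlyGradedCommutative X) (isDGIdeal_TPlus X)
    (fun n hn x hx => ?_) fun n x hx => factorial_smul_gamma n hx
  rw [mem_TPlus_iff, map_nsmul] at hx
  refine incl_injective 0 (nsmul_right_injective hn ?_)
  simpa only [map_zero, smul_zero, map_nsmul] using congrArg (incl X 0) hx

/-! ### Functoriality -/

section Functoriality

variable {k : Type u} [CommRing k] {X : CochainComplex (ModuleCat.{v} k) ℤ}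
  {K : Type*} [CommRing K] {ρ : K →+* k} {Y : CochainComplex (ModuleCat.{w} K) ℤ}
  (f : ∀ i, Y.X i →ₛₗ[ρ] X.X i)

/-- The map `⨁ i, Yⁱ → ⨁ i, Xⁱ` induced by semilinear maps `Yⁱ → Xⁱ`. -/
def totMap : Tot Y →ₛₗ[ρ] Tot X :=
  { DirectSum.map fun i => (f i).toAddMonoidHom with
    map_smul' := fun c y => DFinsupp.ext fun i => (f i).map_smulₛₗ c (y i) }

theorem totMap_lof (i : ℤ) (y : Y.X i) :
    totMap f (DirectSum.lof K ℤ (fun i => Y.X i) i y) =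
      DirectSum.lof k ℤ (fun i => X.X i) i (f i y) :=
  DirectSum.map_of (fun i => (f i).toAddMonoidHom) i y

theorem totMap_mem_homog {r : ℤ} {y : Tot Y} (hy : y ∈ homog Y r) : totMap f y ∈ homog X r := by
  obtain ⟨z, rfl⟩ := hy
  rw [totMap_lof]
  exact lof_mem_homog _ _

theorem totMap_totD (hf : ∀ i (y : Y.X i), f (i + 1) ((Y.d i (i + 1)).hom y) =
      (X.d i (i + 1)).hom (f i y)) (y : Tot Y) : totMap f (totD Y y) = totD X (totMap f y) := by
  induction y using DirectSum.induction_on with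
  | zero => simp only [map_zero]
  | of i y =>
    change totMap f (totD Y (DirectSum.lof K ℤ (fun i => Y.X i) i y)) =
      totD X (totMap f (DirectSum.lof K ℤ (fun i => Y.X i) i y))
    rw [totD_lof, totMap_lof, totMap_lof, totD_lof, hf]
  | add x y hx hy => simp only [map_add, hx, hy]

theorem totMap_update {ι : Type*} [DecidableEq ι] (a : ι → Tot Y) (i : ι) (b : Tot Y) :
    (fun j => totMap f (Function.update a i b j)) =
      Function.update (fun j => totMap f (a j)) i (totMap f b) :=
  funext fun j => Function.apply_update (fun _ => totMap f) a i b j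

/-- The map `Tⁿ(Y) → Tⁿ(X)` induced by semilinear maps `Yⁱ → Xⁱ`. -/
def powMap (n : ℕ) : (⨂[K]^n (Tot Y)) →ₛₗ[ρ] (⨂[k]^n (Tot X)) :=
  let F : (⨂[K]^n (Tot Y)) →+ (⨂[k]^n (Tot X)) := PiTensorProduct.liftAddHom
    (fun p => ρ p.1 • PiTensorProduct.tprod k fun i => totMap f (p.2 i))
    (fun r a i h => by
      rw [MultilinearMap.map_coord_zero _ i (by simp only [h, map_zero]), smul_zero])
    (fun a => by simp only [map_zero, zero_smul])
    (fun r a i b c => by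
      simp only [totMap_update, map_add, MultilinearMap.map_update_add, smul_add])
    (fun r r' a => by simp only [map_add, add_smul])
    (fun r a i r' => by
      simp only [totMap_update, map_smulₛₗ, MultilinearMap.map_update_smul,
        Function.update_eq_self, smul_smul, map_mul, mul_comm])
  { F with
    map_smul' := fun c x => by
      change F (c • x) = ρ c • F x
      induction x using PiTensorProduct.induction_on' with
      | tprodCoeff r a =>
        change ρ (c * r) • (PiTensorProduct.tprod k fun i => totMap f (a i)) =
          ρ c • ρ r • PiTensorProduct.tprod k fun i => totMap f (a i)
        rw [map_mul, mul_smul]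
      | add x y hx hy => rw [smul_add, map_add, map_add, hx, hy, smul_add] }

theorem powMap_tprod {n : ℕ} (a : Fin n → Tot Y) :
    powMap f n (PiTensorProduct.tprod K a) = PiTensorProduct.tprod k fun i => totMap f (a i) := by
  rw [PiTensorProduct.tprod_eq_tprodCoeff_one]
  change ρ 1 • (PiTensorProduct.tprod k fun i => totMap f (a i)) = _
  rw [map_one, one_smul]

theorem powMap_elim0 :
    powMap f 0 (PiTensorProduct.tprod K Fin.elim0) = PiTensorProduct.tprod k Fin.elim0 := by
  rw [powMap_tprod]
  exact congrArg _ (Subsingleton.elim _ _)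

theorem map_paritySign {R S : Type*} [Ring R] [Ring S] (g : R →+* S) (e : ZMod 2) :
    g (paritySign R e) = paritySign S e := by
  rcases zmod_two_cases e with rfl | rfl <;> simp only [paritySign_zero, paritySign_one, map_neg,
    map_one]

theorem powMap_paritySign_smul {n : ℕ} (e : ZMod 2) (x : ⨂[K]^n (Tot Y)) :
    powMap f n (paritySign K e • x) = paritySign k e • powMap f n x := by
  rw [map_smulₛₗ, map_paritySign]

theorem semilinearMap_ext_homog {n : ℕ} {N : Type*} [AddCommMonoid N] [Module k N]
    {F G : (⨂[K]^n (Tot Y)) →ₛₗ[ρ] N}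
    (h : ∀ (deg : Fin n → ℤ) (a : Fin n → Tot Y), (∀ i, a i ∈ homog Y (deg i)) →
      F (PiTensorProduct.tprod K a) = G (PiTensorProduct.tprod K a)) : F = G := by
  refine LinearMap.ext_on (span_tprod_homog (X := Y) n) ?_
  rintro _ ⟨a, rfl⟩
  exact h (fun i => (a i).1) _ fun i => (a i).2.2

theorem powMap_bijAct {m n : ℕ} (σ : Fin m ≃ Fin n) (y : ⨂[K]^m (Tot Y)) :
    powMap f n (bijAct Y σ y) = bijAct X σ (powMap f m y) := by
  suffices (powMap f n).comp (bijAct Y σ) = (bijAct X σ).comp (powMap f m) from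
    LinearMap.congr_fun this y
  refine semilinearMap_ext_homog fun deg a ha => ?_
  rw [LinearMap.comp_apply, LinearMap.comp_apply, bijAct_tprod σ ha, powMap_paritySign_smul,
    powMap_tprod, powMap_tprod, bijAct_tprod σ fun i => totMap_mem_homog f (ha i)]
  rfl

theorem powMap_conc {m n : ℕ} (x : ⨂[K]^m (Tot Y)) (y : ⨂[K]^n (Tot Y)) :
    powMap f (m + n) (conc Y m n x y) = conc X m n (powMap f m x) (powMap f n y) := by
  suffices (powMap f (m + n)).comp ((conc Y m n).flip y) =
      ((conc X m n).flip (powMap f n y)).comp (powMap f m) from LinearMap.congr_fun this x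
  refine semilinearMap_ext_homog fun _ a _ => ?_
  suffices (powMap f (m + n)).comp (conc Y m n (PiTensorProduct.tprod K a)) =
      (conc X m n (powMap f m (PiTensorProduct.tprod K a))).comp (powMap f n) from
    LinearMap.congr_fun this y
  refine semilinearMap_ext_homog fun _ b _ => ?_
  rw [LinearMap.comp_apply, LinearMap.comp_apply, conc_tprod, powMap_tprod, powMap_tprod,
    powMap_tprod, conc_tprod]
  congr 1
  funext i
  induction i using Fin.addCases <;> simp only [Fin.append_left, Fin.append_right]

theorem powMap_cast {m n : ℕ} (h : m = n) (y : ⨂[K]^m (Tot Y)) :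
    powMap f n (TensorPower.cast K (Tot Y) h y) = TensorPower.cast k (Tot X) h (powMap f m y) := by
  subst h
  simp only [TensorPower.cast_refl, LinearEquiv.refl_apply]

theorem powMap_tensorPow (n : ℕ) {p : ℕ} (y : ⨂[K]^p (Tot Y)) :
    powMap f (n * p) (tensorPow Y n y) = tensorPow X n (powMap f p y) := by
  induction n with
  | zero =>
    refine (TensorPower.cast k (Tot X) (zero_mul p)).injective ?_
    rw [← powMap_cast, tensorPow_zero, tensorPow_zero, powMap_elim0]
  | succ n ih =>
    refine (TensorPower.cast k (Tot X) (Nat.succ_mul n p)).injective ?_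
    rw [← powMap_cast, tensorPow_succ, tensorPow_succ, powMap_conc, ih]

theorem powMap_powGamma (n : ℕ) {p : ℕ} (y : ⨂[K]^p (Tot Y)) :
    powMap f (n * p) (powGamma Y n y) = powGamma X n (powMap f p y) := by
  simp only [powGamma, permAct_eq_bijAct, map_sum, powMap_bijAct, powMap_tensorPow]

theorem powMap_powD (hf : ∀ i (y : Y.X i), f (i + 1) ((Y.d i (i + 1)).hom y) =
      (X.d i (i + 1)).hom (f i y)) (n : ℕ) (y : ⨂[K]^n (Tot Y)) :
    powMap f n (powD Y n y) = powD X n (powMap f n y) := by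
  suffices (powMap f n).comp (powD Y n) = (powD X n).comp (powMap f n) from
    LinearMap.congr_fun this y
  refine semilinearMap_ext_homog fun deg a ha => ?_
  rw [LinearMap.comp_apply, LinearMap.comp_apply, powD_eq_sum, powD_eq_sum, LinearMap.sum_apply,
    map_sum, LinearMap.sum_apply]
  refine Finset.sum_congr rfl fun i _ => ?_
  rw [powDTerm_tprod i ha, powMap_paritySign_smul, powMap_tprod, powMap_tprod,
    powDTerm_tprod i fun i => totMap_mem_homog f (ha i), totMap_update, totMap_totD f hf]

theorem powMap_mem_powGr {n : ℕ} {r : ℤ} {y : ⨂[K]^n (Tot Y)} (hy : y ∈ powGr Y n r) :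
    powMap f n y ∈ powGr X n r := by
  suffices powGr Y n r ≤ (powGr X n r).comap (powMap f n) from this hy
  refine powGr_le fun deg a ha hr => ?_
  rw [Submodule.mem_comap, powMap_tprod, ← hr]
  exact tprod_mem_powGr fun i => totMap_mem_homog f (ha i)

theorem exists_powMap_eq (hρ : Function.Surjective ρ) (hs : ∀ i, Function.Surjective (f i)) {n : ℕ}
    {r : ℤ} {x : ⨂[k]^n (Tot X)} (hx : x ∈ powGr X n r) : ∃ y ∈ powGr Y n r, powMap f n y = x := by
  have : RingHomSurjective ρ := ⟨hρ⟩
  suffices powGr X n r ≤ (powGr Y n r).map (powMap f n) from this hx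
  refine Submodule.span_le.2 ?_
  rintro _ ⟨deg, x, hr, rfl⟩
  choose y hy using fun i => hs (deg i) (x i)
  refine ⟨PiTensorProduct.tprod K fun i => DirectSum.lof K ℤ (fun i => Y.X i) (deg i) (y i),
    Submodule.subset_span ⟨deg, y, hr, rfl⟩, ?_⟩
  simp only [powMap_tprod, totMap_lof, hy]

/-- The map `T(Y) → T(X)` induced by semilinear maps `Yⁱ → Xⁱ`. -/
def tMap : T Y →+ T X := DirectSum.map fun n => (powMap f n).toAddMonoidHom

theorem tMap_incl (n : ℕ) (y : ⨂[K]^n (Tot Y)) : tMap f (incl Y n y) = incl X n (powMap f n y) :=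
  DirectSum.map_of (fun n => (powMap f n).toAddMonoidHom) n y

theorem comp_tMap (n : ℕ) (y : T Y) : comp X n (tMap f y) = powMap f n (comp Y n y) := rfl

theorem tMap_one : tMap f (one Y) = one X := by
  change tMap f (incl Y 0 _) = incl X 0 _
  rw [tMap_incl]
  exact congrArg (incl X 0) (powMap_elim0 f)

theorem tMap_shuffle (x y : T Y) : tMap f (shuffle Y x y) = shuffle X (tMap f x) (tMap f y) := by
  induction x using incl_induction with
  | zero => simp only [map_zero, LinearMap.zero_apply]
  | add x x' hx hx' => simp only [map_add, LinearMap.add_apply, hx, hx']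
  | incl m x =>
    induction y using incl_induction with
    | zero => simp only [map_zero]
    | add y y' hy hy' => simp only [map_add, hy, hy']
    | incl n y =>
      classical
      simp only [shuffle_incl_incl, tMap_incl, shuffleSum_apply, map_sum, powMap_bijAct,
        powMap_conc]

theorem tMap_mem_gr {r : ℤ} {y : T Y} (hy : y ∈ gr Y r) : tMap f y ∈ gr X r :=
  mem_gr_iff.2 fun n => powMap_mem_powGr f (mem_gr_iff.1 hy n)

theorem tMap_mem_TPlus {y : T Y} (hy : y ∈ TPlus Y) : tMap f y ∈ TPlus X := by
  rw [mem_TPlus_iff] at hy ⊢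
  rw [comp_tMap, hy, map_zero]

theorem tMap_d (hf : ∀ i (y : Y.X i), f (i + 1) ((Y.d i (i + 1)).hom y) =
      (X.d i (i + 1)).hom (f i y)) (y : T Y) : tMap f (d Y y) = d X (tMap f y) := by
  induction y using incl_induction with
  | zero => simp only [map_zero]
  | add x y hx hy => simp only [map_add, hx, hy]
  | incl n y => rw [d_incl, tMap_incl, tMap_incl, d_incl, powMap_powD f hf]

theorem isDGHom_tMap (hf : ∀ i (y : Y.X i), f (i + 1) ((Y.d i (i + 1)).hom y) =
      (X.d i (i + 1)).hom (f i y)) :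
    IsDGHom (shuffle Y) (one Y) (gr Y) (d Y) (shuffle X) (one X) (gr X) (d X) (tMap f) where
  map_mul := tMap_shuffle f
  map_one := tMap_one f
  map_mem _ _ := tMap_mem_gr f
  map_d := tMap_d f hf

theorem tMap_truncGamma (N n : ℕ) (y : T Y) :
    tMap f (truncGamma Y N n y) = truncGamma X N n (tMap f y) := by
  induction N generalizing n with
  | zero =>
    rw [truncGamma, truncGamma]
    split_ifs
    exacts [tMap_one f, map_zero _]
  | succ N ih =>
    simp only [truncGamma, map_sum, tMap_shuffle, ih, tMap_incl, powMap_powGamma, comp_tMap]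

theorem tMap_gamma (n : ℕ) (y : T Y) : tMap f (gamma Y n y) = gamma X n (tMap f y) := by
  obtain ⟨N, hN⟩ := exists_forall_comp_eq_zero y
  rw [gamma_eq_truncGamma hN,
    gamma_eq_truncGamma (N := N) fun m hm => by rw [comp_tMap, hN m hm, map_zero],
    tMap_truncGamma]

theorem exists_tMap_eq_of_mem_gr (hρ : Function.Surjective ρ)
    (hs : ∀ i, Function.Surjective (f i)) {r : ℤ} {x : T X} (hx : x ∈ gr X r) :
    ∃ y ∈ gr Y r, tMap f y = x := by
  choose y hy hfy using fun n => exists_powMap_eq f hρ hs (mem_gr_iff.1 hx n)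
  obtain ⟨s, sum_eq⟩ := exists_eq_sum_incl x
  refine ⟨∑ n ∈ s, incl Y n (y n), Submodule.sum_mem _ fun n _ => incl_mem_gr (hy n), ?_⟩
  simp only [map_sum, tMap_incl, hfy]
  exact sum_eq.symm

theorem exists_tMap_eq_of_mem_TPlus_inf_gr (hρ : Function.Surjective ρ)
    (hs : ∀ i, Function.Surjective (f i)) {r : ℤ} {x : T X} (hx : x ∈ TPlus X ⊓ gr X r) :
    ∃ y ∈ TPlus Y ⊓ gr Y r, tMap f y = x := by
  obtain ⟨y, hy, rfl⟩ := exists_tMap_eq_of_mem_gr f hρ hs hx.2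
  have comp_zero : powMap f 0 (comp Y 0 y) = 0 := mem_TPlus_iff.1 hx.1
  refine ⟨y + incl Y 0 ((-1 : K) • comp Y 0 y),
    ⟨?_, add_mem hy (incl_mem_gr (Submodule.smul_mem _ _ (mem_gr_iff.1 hy 0)))⟩, ?_⟩
  · change comp Y 0 _ = 0
    rw [map_add, comp_incl, add_neg_one_smul]
  · rw [map_add, tMap_incl, map_smulₛₗ, comp_zero, smul_zero, map_zero, add_zero]

theorem isPDStructure_of_surjective (hρ : Function.Surjective ρ)
    (hs : ∀ i, Function.Surjective (f i))
    (hf : ∀ i (y : Y.X i), f (i + 1) ((Y.d i (i + 1)).hom y) = (X.d i (i + 1)).hom (f i y))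
    (hY : IsPDStructure (shuffle Y) (one Y) (gr Y) (d Y) (TPlus Y) (gamma Y)) :
    IsPDStructure (shuffle X) (one X) (gr X) (d X) (TPlus X) (gamma X) :=
  hY.of_surjective (isDGAlgebra Y) (isDGHom_tMap f hf) (isDGAlgebra X).isInternal
    (isDGIdeal_TPlus X) (fun _ => tMap_mem_TPlus f)
    (fun _ _ => exists_tMap_eq_of_mem_gr f hρ hs)
    (fun _ _ => exists_tMap_eq_of_mem_TPlus_inf_gr f hρ hs) fun n y _ => (tMap_gamma f n y).symm

end Functoriality

/-! ### Divided powers on `T⁺(X)` -/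

theorem isAddTorsionFree_T {K : Type*} [CommRing K] [IsDomain K] [CharZero K]
    (Y : CochainComplex (ModuleCat.{w} K) ℤ) [∀ i, Module.Free K (Y.X i)] :
    IsAddTorsionFree (T Y) := by
  have (n : ℕ) : Module.Free K (⨂[K]^n (Tot Y)) := .of_basis
    (Basis.piTensorProduct fun _ : Fin n => Module.Free.chooseBasis K (Tot Y))
  exact .of_isTorsionFree K (T Y)

section FreeCover

variable {k : Type u} [CommRing k]

/-- The surjection onto `k` of the polynomial ring over `ℤ` with one variable for each element
of `k`; the free cover of a complex over `k` lives over this torsion-free domain. -/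
def evalHom (k : Type u) [CommRing k] : MvPolynomial k ℤ →+* k :=
  MvPolynomial.eval₂Hom (Int.castRingHom k) id

theorem evalHom_surjective : Function.Surjective (evalHom k) := fun c =>
  ⟨MvPolynomial.X c, by simp [evalHom]⟩

variable (X : CochainComplex (ModuleCat.{v} k) ℤ)

/-- The generators in degree `i` of the free cover of `X`: a generator for each element of `Xⁱ`, and
the differential of a generator for each element of `Xⁱ⁻¹`. -/
abbrev CoverGen (i : ℤ) : Type v := X.X i ⊕ {p : Σ j : ℤ, X.X j // p.1 + 1 = i}

/-- The terms of the free cover of `X`. -/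
abbrev CoverTerm (i : ℤ) : Type (max u v) := CoverGen X i →₀ MvPolynomial k ℤ

/-- The differential of the free cover of `X`. -/
def coverD (i : ℤ) : CoverTerm X i →ₗ[MvPolynomial k ℤ] CoverTerm X (i + 1) :=
  Finsupp.linearCombination (MvPolynomial k ℤ)
    (Sum.elim (fun x => Finsupp.single (Sum.inr ⟨⟨i, x⟩, rfl⟩) 1) fun _ => 0)

theorem coverD_comp_coverD (i : ℤ) : coverD X (i + 1) ∘ₗ coverD X i = 0 := by
  refine Finsupp.lhom_ext' fun g => LinearMap.ext_ring ?_
  rcases g with x | p <;> simp [coverD]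

/-- The free cover of `X`, a complex of free modules over a polynomial ring which surjects
onto `X`. -/
def cover : CochainComplex (ModuleCat.{max u v} (MvPolynomial k ℤ)) ℤ :=
  CochainComplex.of (fun i => ModuleCat.of _ (CoverTerm X i))
    (fun i => ModuleCat.ofHom (coverD X i)) fun i => by
      rw [← ModuleCat.ofHom_comp, coverD_comp_coverD]; rfl

theorem cover_d (i : ℤ) : (cover X).d i (i + 1) = ModuleCat.ofHom (coverD X i) :=
  CochainComplex.of_d (fun i => ModuleCat.of _ (CoverTerm X i))
    (fun i => ModuleCat.ofHom (coverD X i)) i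

instance (i : ℤ) : Module.Free (MvPolynomial k ℤ) ((cover X).X i) :=
  inferInstanceAs (Module.Free (MvPolynomial k ℤ) (CoverTerm X i))

/-- The element of `Xⁱ` corresponding to a generator of the free cover. -/
def coverVal (i : ℤ) : CoverGen X i → X.X i :=
  Sum.elim id fun p => (X.d p.1.1 i).hom p.1.2

/-- The surjection of the free cover onto `X`, on the underlying modules of finitely supported
functions. -/
def coverMap (i : ℤ) : CoverTerm X i →ₛₗ[evalHom k] X.X i :=
  Finsupp.lsum ℕ fun g =>
    (LinearMap.toSpanSingleton k (X.X i) (coverVal X i g)).comp (evalHom k).toSemilinearMap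

theorem coverMap_single (i : ℤ) (g : CoverGen X i) (a : MvPolynomial k ℤ) :
    coverMap X i (Finsupp.single g a) = evalHom k a • coverVal X i g := by
  rw [coverMap, Finsupp.lsum_single]
  rfl

theorem coverMap_surjective (i : ℤ) : Function.Surjective (coverMap X i) := fun x =>
  ⟨Finsupp.single (Sum.inl x) 1, by rw [coverMap_single, map_one, one_smul]; rfl⟩

theorem coverMap_coverD (i : ℤ) (y : CoverTerm X i) :
    coverMap X (i + 1) (coverD X i y) = (X.d i (i + 1)).hom (coverMap X i y) := by
  induction y using Finsupp.induction_linear with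
  | zero => simp only [map_zero]
  | add x y hx hy => simp only [map_add, hx, hy]
  | single g a =>
    rw [coverMap_single, coverD, Finsupp.linearCombination_single, map_smulₛₗ, map_smul]
    congr 1
    rcases g with x | ⟨⟨j, x⟩, rfl⟩
    · rw [Sum.elim_inl, coverMap_single, map_one, one_smul]
      rfl
    · rw [Sum.elim_inr, map_zero]
      change (0 : X.X (j + 1 + 1)) = (X.d (j + 1) (j + 1 + 1)).hom ((X.d j (j + 1)).hom x)
      rw [← LinearMap.comp_apply, ← ModuleCat.hom_comp, X.d_comp_d]
      rfl

/-- The surjection of the free cover onto `X`. -/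
def coverHom (i : ℤ) : (cover X).X i →ₛₗ[evalHom k] X.X i := coverMap X i

theorem coverHom_surjective (i : ℤ) : Function.Surjective (coverHom X i) := coverMap_surjective X i

theorem coverHom_d (i : ℤ) (y : (cover X).X i) :
    coverHom X (i + 1) (((cover X).d i (i + 1)).hom y) = (X.d i (i + 1)).hom (coverHom X i y) := by
  rw [cover_d]
  exact coverMap_coverD X i y

instance : IsAddTorsionFree (T (cover X)) := isAddTorsionFree_T (cover X)

theorem isPDStructure :
    IsPDStructure (shuffle X) (one X) (gr X) (d X) (TPlus X) (gamma X) :=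
  isPDStructure_of_surjective (coverHom X) evalHom_surjective (coverHom_surjective X) (coverHom_d X)
    isPDStructure_of_isAddTorsionFree

end FreeCover

/-! ### Symmetric tensors -/

section SymmetricTensors

variable {k : Type u} [CommRing k] {X : CochainComplex (ModuleCat.{v} k) ℤ} {n : ℕ}

theorem mem_powTS_iff {x : ⨂[k]^n (Tot X)} :
    x ∈ powTS X n ↔ ∀ σ : Equiv.Perm (Fin n), bijAct X σ x = x := by
  simp only [powTS, Submodule.mem_iInf, LinearMap.mem_eqLocus, permAct_eq_bijAct,
    LinearMap.id_apply]

theorem mem_TS_iff {x : T X} : x ∈ TS X ↔ ∀ n, comp X n x ∈ powTS X n := by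
  simp only [TS, Submodule.mem_iInf, Submodule.mem_comap]

theorem incl_mem_TS {x : ⨂[k]^n (Tot X)} (hx : x ∈ powTS X n) : incl X n x ∈ TS X := by
  rw [mem_TS_iff]
  intro m
  obtain rfl | hnm := eq_or_ne n m
  · rwa [comp_incl]
  · rw [comp_incl_of_ne hnm]
    exact zero_mem _

/-- The sum is over the cosets of `H`, which left translations permute. -/
theorem sum_bijAct_mem_powTS {H : Subgroup (Equiv.Perm (Fin n))}
    {R : Finset (Equiv.Perm (Fin n))} (hR : Subgroup.IsComplement (R : Set (Equiv.Perm (Fin n))) H)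
    {x : ⨂[k]^n (Tot X)} (hx : ∀ h ∈ H, bijAct X h x = x) :
    ∑ σ ∈ R, bijAct X σ x ∈ powTS X n := by
  classical
  let cosetAct : Equiv.Perm (Fin n) ⧸ H → ⨂[k]^n (Tot X) :=
    Quotient.lift (fun σ => bijAct X σ x) fun σ τ hστ => by
      obtain ⟨h, rfl⟩ : ∃ h : H, σ * h = τ :=
        ⟨⟨σ⁻¹ * τ, QuotientGroup.leftRel_apply.1 hστ⟩, mul_inv_cancel_left σ τ⟩
      exact (by rw [bijAct_mul, hx h h.2])
  have sum_eq : ∑ σ ∈ R, bijAct X σ x = ∑ q, cosetAct q := by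
    rw [← Finset.sum_coe_sort]
    exact Fintype.sum_equiv hR.leftQuotientEquiv.symm _ _ fun σ => rfl
  rw [mem_powTS_iff, sum_eq]
  intro g
  have bijAct_cosetAct (q : Equiv.Perm (Fin n) ⧸ H) : bijAct X g (cosetAct q) = cosetAct (g • q) :=
    Quotient.inductionOn q fun σ => (bijAct_mul g σ x).symm
  simp only [map_sum, bijAct_cosetAct]
  exact Equiv.sum_comp (MulAction.toPerm g) cosetAct

/-- The permutations which preserve the fibres of `f`. -/
def fiberSubgroup {L : Type*} (f : Fin n → L) : Subgroup (Equiv.Perm (Fin n)) where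
  carrier := {β | ∀ i, f (β i) = f i}
  one_mem' _ := rfl
  mul_mem' hα hβ i := (hα _).trans (hβ i)
  inv_mem' {β} hβ i := by simpa using (hβ (β⁻¹ i)).symm

theorem isComplement_fiberMono {L : Type*} (f : Fin n → L) :
    Subgroup.IsComplement {σ : Equiv.Perm (Fin n) | FiberMono f σ} (fiberSubgroup f) := by
  refine ⟨fun α α' h => ?_, fun σ => ?_⟩
  · have := (α.1.2.mul_inj α'.1.2 α.2.2 α'.2.2).1 h
    exact Prod.ext (Subtype.ext this.1) (Subtype.ext this.2)
  · obtain ⟨α, β, rfl, hα, hβ⟩ := exists_fiberMono_mul f σ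
    exact ⟨(⟨α, hα⟩, ⟨β, hβ⟩), rfl⟩

theorem bijAct_conc_of_mem_powTS {m : ℕ} {x : ⨂[k]^m (Tot X)} {y : ⨂[k]^n (Tot X)}
    (hx : x ∈ powTS X m) (hy : y ∈ powTS X n) {β : Equiv.Perm (Fin (m + n))}
    (hβ : β ∈ fiberSubgroup (side m n)) : bijAct X β (conc X m n x y) = conc X m n x y := by
  obtain ⟨β₁, β₂, rfl⟩ := exists_eq_finSum β hβ
  rw [bijAct_finSum_conc, mem_powTS_iff.1 hx, mem_powTS_iff.1 hy]

theorem shuffle_mem_TS {x y : T X} (hx : x ∈ TS X) (hy : y ∈ TS X) : shuffle X x y ∈ TS X := by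
  classical
  obtain ⟨s, hs⟩ := exists_eq_sum_incl x
  obtain ⟨t, ht⟩ := exists_eq_sum_incl y
  rw [hs, ht]
  simp only [map_sum, LinearMap.sum_apply]
  refine Submodule.sum_mem _ fun n _ => Submodule.sum_mem _ fun m _ => ?_
  rw [shuffle_incl_incl, shuffleSum_apply, ← map_sum]
  exact incl_mem_TS (sum_bijAct_mem_powTS (by simpa using isComplement_fiberMono (side m n))
    fun β hβ => bijAct_conc_of_mem_powTS (mem_TS_iff.1 hx m) (mem_TS_iff.1 hy n) hβ)

theorem one_mem_TS : one X ∈ TS X :=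
  incl_mem_TS (mem_powTS_iff.2 fun σ => by rw [Subsingleton.elim σ 1, bijAct_one])

theorem d_mem_TS {x : T X} (hx : x ∈ TS X) : d X x ∈ TS X := by
  rw [mem_TS_iff] at hx ⊢
  intro n
  change powD X n (comp X n x) ∈ powTS X n
  rw [mem_powTS_iff]
  intro σ
  rw [bijAct_powD, mem_powTS_iff.1 (hx n)]

theorem grProj_mem_TS (r : ℤ) {x : T X} (hx : x ∈ TS X) : grProj X r x ∈ TS X := by
  rw [mem_TS_iff] at hx ⊢
  intro n
  rw [comp_grProj, mem_powTS_iff]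
  intro σ
  rw [(isGradingProj_powGr X n).map_proj (isGradingProj_powGr X n)
    (fun _ _ => bijAct_mem_powGr σ), mem_powTS_iff.1 (hx n)]

variable (X) in
theorem isDGSubalgebra_TS : IsDGSubalgebra (shuffle X) (one X) (gr X) (d X) (TS X) where
  homogeneous := (isGradingProj_gr X).le_iSup_inf_iff.2 fun r _ => grProj_mem_TS r
  one_mem := one_mem_TS
  mul_mem _ hx _ hy := shuffle_mem_TS hx hy
  d_mem _ hx := d_mem_TS hx

variable (X) in
theorem TS_le_iSup_inf_tensorGr : TS X ≤ ⨆ n, TS X ⊓ tensorGr X n :=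
  (isGradingProj_tensorGr X).le_iSup_inf_iff.2 fun n _ hx => incl_mem_TS (mem_TS_iff.1 hx n)

end SymmetricTensors

/-! ### Divided powers of symmetric tensors -/

section DividedPowers

variable {k : Type u} [CommRing k] {X : CochainComplex (ModuleCat.{v} k) ℤ} {n p : ℕ}

theorem divNat_blockPerm (π : Equiv.Perm (Fin n)) (i : Fin (n * p)) :
    (blockPerm p π i).divNat = π i.divNat := by
  obtain ⟨⟨a, b⟩, rfl⟩ := finProdFinEquiv.surjective i
  rw [blockPerm_finProdFinEquiv, divNat_finProdFinEquiv, divNat_finProdFinEquiv]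

/-- The permutations of `n` blocks of size `p` which map blocks to blocks. -/
def blockSubgroup (n p : ℕ) : Subgroup (Equiv.Perm (Fin (n * p))) where
  carrier := {β | ∃ π : Equiv.Perm (Fin n), ∀ i, (β i).divNat = π i.divNat}
  one_mem' := ⟨1, fun _ => rfl⟩
  mul_mem' := fun ⟨π, hπ⟩ ⟨π', hπ'⟩ =>
    ⟨π * π', fun i => (hπ _).trans (congrArg π (hπ' i))⟩
  inv_mem' := fun {β} ⟨π, hπ⟩ =>
    ⟨π⁻¹, fun i => by rw [Equiv.Perm.eq_inv_iff_eq, ← hπ]; simp⟩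

theorem exists_blockPerm_mul {h : Equiv.Perm (Fin (n * p))} (hh : h ∈ blockSubgroup n p) :
    ∃ π, ∃ β ∈ fiberSubgroup (Fin.divNat : Fin (n * p) → Fin n), h = blockPerm p π * β := by
  obtain ⟨π, hπ⟩ := hh
  refine ⟨π, (blockPerm p π)⁻¹ * h, fun i => π.injective ?_, (mul_inv_cancel_left _ _).symm⟩
  rw [← divNat_blockPerm, ← Equiv.Perm.mul_apply, mul_inv_cancel_left, hπ]

theorem isComplement_isBlockShuffle (n : ℕ) (hp : 1 ≤ p) :
    Subgroup.IsComplement {σ | IsBlockShuffle n p σ} (blockSubgroup n p) := by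
  refine ⟨?_, fun τ => ?_⟩
  · rintro ⟨⟨σ, hσ⟩, h, hh⟩ ⟨⟨σ', hσ'⟩, h', hh'⟩ heq
    obtain ⟨π, β, hβ, rfl⟩ := exists_blockPerm_mul hh
    obtain ⟨π', β', hβ', rfl⟩ := exists_blockPerm_mul hh'
    simp only [← mul_assoc] at heq
    obtain ⟨hmul, rfl⟩ := (FiberMono.mul_inj
      (fiberMono_divNat_mul_blockPerm (fiberMono_divNat_iff.2 hσ.1) π)
      (fiberMono_divNat_mul_blockPerm (fiberMono_divNat_iff.2 hσ'.1) π') hβ hβ').1 heq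
    obtain ⟨rfl, rfl⟩ := (hσ.mul_blockPerm_inj hp hσ').1 hmul
    rfl
  · obtain ⟨α, β, rfl, hα, hβ⟩ := exists_fiberMono_mul (Fin.divNat : Fin (n * p) → Fin n) τ
    obtain ⟨σ, π, hσ, rfl⟩ := exists_isBlockShuffle_mul hp hα
    exact ⟨(⟨σ, hσ⟩, ⟨blockPerm p π * β, mul_mem ⟨π, divNat_blockPerm π⟩ ⟨1, hβ⟩⟩),
      (mul_assoc _ _ _).symm⟩

theorem side_eq_decide_divNat (i : Fin ((n + 1) * p)) :
    side (n * p) p (Fin.cast (Nat.succ_mul n p) i) = decide (i.divNat = Fin.last n) := by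
  obtain ⟨i, rfl⟩ := (finCongr (Nat.succ_mul n p)).symm.surjective i
  change side (n * p) p i = decide ((Fin.cast (Nat.succ_mul n p).symm i).divNat = Fin.last n)
  induction i using Fin.addCases with
  | left i => rw [side_castAdd, divNat_cast_castAdd, decide_eq_false (Fin.castSucc_ne_last _)]
  | right i => rw [side_natAdd, divNat_cast_natAdd, decide_eq_true rfl]

theorem exists_trans_finCongr_eq_finSum {β : Equiv.Perm (Fin ((n + 1) * p))}
    (hβ : β ∈ fiberSubgroup (Fin.divNat : Fin ((n + 1) * p) → Fin (n + 1))) :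
    ∃ β₁ ∈ fiberSubgroup (Fin.divNat : Fin (n * p) → Fin n), ∃ β₂ : Equiv.Perm (Fin p),
      β.trans (finCongr (Nat.succ_mul n p)) =
        (finCongr (Nat.succ_mul n p)).trans (finSum β₁ β₂) := by
  let c := finCongr (Nat.succ_mul n p)
  obtain ⟨β₁, β₂, heq⟩ := exists_eq_finSum ((c.symm.trans β).trans c) fun i => by
    obtain ⟨i, rfl⟩ := c.surjective i
    simp only [Equiv.trans_apply, Equiv.symm_apply_apply]
    exact (side_eq_decide_divNat (β i)).trans ((congrArg (fun a => decide (a = Fin.last n))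
      (hβ i)).trans (side_eq_decide_divNat i).symm)
  have trans_eq : β.trans c = c.trans (finSum β₁ β₂) := by rw [← heq]; ext; simp
  refine ⟨β₁, fun i => ?_, β₂, trans_eq⟩
  have apply_eq : β (c.symm (Fin.castAdd p i)) = c.symm (Fin.castAdd p (β₁ i)) :=
    c.injective (by simpa using Equiv.congr_fun trans_eq (c.symm (Fin.castAdd p i)))
  have divNat_eq := hβ (c.symm (Fin.castAdd p i))
  rw [apply_eq] at divNat_eq
  exact Fin.castSucc_injective n divNat_eq

theorem bijAct_tensorPow_of_mem_powTS {x : ⨂[k]^p (Tot X)} (hx : x ∈ powTS X p)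
    {β : Equiv.Perm (Fin (n * p))} (hβ : β ∈ fiberSubgroup (Fin.divNat : Fin (n * p) → Fin n)) :
    bijAct X β (tensorPow X n x) = tensorPow X n x := by
  induction n with
  | zero =>
    have : IsEmpty (Fin (0 * p)) := by rw [zero_mul]; infer_instance
    rw [Subsingleton.elim β 1, bijAct_one]
  | succ n ih =>
    obtain ⟨β₁, hβ₁, β₂, heq⟩ := exists_trans_finCongr_eq_finSum hβ
    refine (TensorPower.cast k (Tot X) (Nat.succ_mul n p)).injective ?_
    rw [← bijAct_finCongr, ← bijAct_trans, heq, bijAct_trans, bijAct_finCongr, tensorPow_succ,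
      bijAct_finSum_conc, ih hβ₁, mem_powTS_iff.1 hx]

theorem powGamma_mem_powTS (n : ℕ) (hp : 1 ≤ p) {x : ⨂[k]^p (Tot X)}
    (he : x ∈ evenPart (powGr X p)) (hx : x ∈ powTS X p) : powGamma X n x ∈ powTS X (n * p) := by
  classical
  simp only [powGamma, permAct_eq_bijAct]
  refine sum_bijAct_mem_powTS (by simpa using isComplement_isBlockShuffle n hp) fun h hh => ?_
  obtain ⟨π, β, hβ, rfl⟩ := exists_blockPerm_mul hh
  rw [bijAct_mul, bijAct_tensorPow_of_mem_powTS hx hβ, bijAct_blockPerm_tensorPow π he]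

theorem truncGamma_mem_TS (N n : ℕ) {x : T X} (he : x ∈ evenPart (gr X)) (hx : x ∈ TS X) :
    truncGamma X N n x ∈ TS X := by
  induction N generalizing n with
  | zero =>
    rw [truncGamma]
    split_ifs
    exacts [one_mem_TS, zero_mem _]
  | succ N ih =>
    rw [truncGamma]
    exact Submodule.sum_mem _ fun i _ => shuffle_mem_TS (ih i) (incl_mem_TS
      (powGamma_mem_powTS _ N.succ_pos (comp_mem_evenPart he _) (mem_TS_iff.1 hx _)))

theorem gamma_mem_TS (n : ℕ) {x : T X} (he : x ∈ evenPart (gr X)) (hx : x ∈ TS X) :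
    gamma X n x ∈ TS X :=
  truncGamma_mem_TS _ n he hx

end DividedPowers

end

end ShuffleAlg

open DGAlg ShuffleAlg in
theorem mainTheorem1 {k : Type u} [CommRing k] (X : CochainComplex (ModuleCat.{v} k) ℤ) :
    -- `(T(X), ⋆)` is a connected strictly graded commutative dg algebra
    IsDGAlgebra (shuffle X) (one X) (gr X) (d X) ∧
    IsStrictlyGradedCommutative (shuffle X) (gr X) ∧
    IsConnectedNGrading (shuffle X) (one X) (gr X) (d X) (tensorGr X) ∧
    -- `TS(X)` is a dg subalgebra, itself a connected strictly graded commutative dg algebra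
    ∃ h : IsDGSubalgebra (shuffle X) (one X) (gr X) (d X) (TS X),
      IsDGAlgebra h.subMul h.subOne (subGr (gr X) (TS X)) h.subD ∧
      IsStrictlyGradedCommutative h.subMul (subGr (gr X) (TS X)) ∧
      IsConnectedNGrading h.subMul h.subOne (subGr (gr X) (TS X)) h.subD
        (subGr (tensorGr X) (TS X)) ∧
      -- divided powers on `T⁺(X)`, restricting to divided powers on `TS⁺(X)`
      ∃ (γ : ℕ → T X → T X) (γ' : ℕ → TS X → TS X),
        IsPDStructure (shuffle X) (one X) (gr X) (d X) (TPlus X) γ ∧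
        IsPDStructure h.subMul h.subOne (subGr (gr X) (TS X)) h.subD (TSPlus X) γ' ∧
        (∀ n, ∀ x ∈ TSPlus X ⊓ evenPart (subGr (gr X) (TS X)), (γ' n x : T X) = γ n x) ∧
        ∀ (n p : ℕ) (x : ⨂[k]^p (Tot X)), 1 ≤ p →
          DirectSum.lof k ℕ (fun n => ⨂[k]^n (Tot X)) p x ∈ evenPart (gr X) →
          γ n (DirectSum.lof k ℕ (fun n => ⨂[k]^n (Tot X)) p x) =
            DirectSum.lof k ℕ (fun n => ⨂[k]^n (Tot X)) (n * p) (powGamma X n x) := by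
  obtain ⟨γ', hγ', coe_γ'⟩ := (isPDStructure X).exists_restrict (isDGAlgebra X)
    (isDGSubalgebra_TS X) fun n _ hx hxS => gamma_mem_TS n hx.2 hxS
  exact ⟨isDGAlgebra X, isStrictlyGradedCommutative X, isConnectedNGrading X, isDGSubalgebra_TS X,
    (isDGAlgebra X).sub _, (isStrictlyGradedCommutative X).sub _,
    (isConnectedNGrading X).sub (isDGAlgebra X) _ (TS_le_iSup_inf_tensorGr X),
    gamma X, γ', isPDStructure X, hγ', coe_γ', fun n p x hp _ => gamma_incl n hp x⟩
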